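/- **Setting.** $SE_2(3)$ is the group of real $5\times5$ matrices $\begin{bmatrix}R&p&v\\0&1&0\\0&0&1\end{bmatrix}$ with $R\in SO(3)$, $p,v\in\mathbb R^3$; its Lie algebra is $\mathfrak{se}_2(3)=\{x^\wedge: x=(\omega,\nu,a)\in\mathbb R^9\}$, $x^\wedge=\begin{bmatrix}\omega^\wedge&\nu&a\\0&0&0\\0&0&0\end{bmatrix}$ ($\omega^\wedge$ the skew matrix of $\omega\times$), and $\vee$ is the inverse of $\wedge$. Write $\mathrm{Ad}_AU=AUA^{-1}$, $\mathrm{ad}_UV=UV-VU$, and also $\mathrm{ad}_U$ for the $9\times9$ matrix of $x\mapsto(\mathrm{ad}_Ux^\wedge)^\vee$. Let $f(T)$ be the $5\times5$ matrix whose fourth column is $(v,0,0)$, $v$ being the velocity component of $T$, and whose other columns are $0$. Let $\log$ be the principal logarithm of $SE_2(3)$, the inverse of $\exp$ on the elements $(\omega,\nu,a)^\wedge$ with $|\omega|<\pi$, and $\mathcal D\subset SE_2(3)$ its domain. Fix $g\in\mathbb R^3$ and write $g^\wedge$ also for $(0,0,g)^\wedge\in\mathfrak{se}_2(3)$. Let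 $\mathcal M=SE_2(3)\times\mathfrak{se}_2(3)$ and $\xi_0=(I,0)$. For continuous inputs $w,\tau:[0,\infty)\to\mathbb R^9$ the system, with state $\xi=(T,b^\wedge)\in\mathcal M$ and (noise-free) output $y=T$, is $$\dot T=f(T)T+T(w^\wedge-b^\wedge)+g^\wedge T,\qquad \dot b^\wedge=\tau^\wedge .$$ **Observer.** Fix symmetric positive definite $P\in\mathbb R^{18\times18}$, $Q\in\mathbb R^{9\times9}$, $\Sigma_0\in\mathbb R^{18\times18}$. The observer has state $\hat X=(\hat A,\hat a)\in SE_2(3)\times\mathfrak{se}_2(3)$ and a symmetric positive definite Riccati matrix $\Sigma\in\mathbb R^{18\times18}$, with $\hat X(0)=(I,0)$, $\Sigma(0)=\Sigma_0$ and $$\dot{\hat A}=\hat A(w^\wedge+\mathrm{Ad}_{\hat A^{-1}}\hat a)+g^\wedge\hat A+f(\hat A)+\Delta_1\hat A,$$ $$\dot{\hat a}=\mathrm{ad}_{-\hat a}\big[\mathrm{Ad}_{\hat A}w^\wedge+\hat a+g^\wedge+f(\hat A)\big]-\mathrm{Ad}_{\hat A}\tau^\wedge+\Delta_2+\mathrm{ad}_{\Delta_1}\hat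 a,$$ $$\dot\Sigma=A^0_t\Sigma+\Sigma (A^0_t)^{\top}+P-\Sigma (C^0)^{\top}Q^{-1}C^0\Sigma .$$ Here $\Delta=(\Delta_1,\Delta_2)=(k_1^\wedge,-k_2^\wedge)$, where $(k_1,k_2)=\Sigma (C^0)^{\top}Q^{-1}\log(y\hat A^{-1})^\vee\in\mathbb R^9\times\mathbb R^9$ (this is $D_E|_I\phi_{\xi_0}(E)^{\dagger}\,d\varepsilon^{-1}\Sigma (C^0)^{\top}Q^{-1}\delta(y\hat A^{-1})$ for the action $\phi((A,a),(T,b^\wedge))=(TA,\mathrm{Ad}_{A^{-1}}(b^\wedge-a))$ and the coordinates $\varepsilon$, $\delta=\log(\cdot)^\vee$), and $$A^0_t=\begin{bmatrix}\Upsilon&-I\\0&\mathrm{ad}_{w_0^\wedge+g^\wedge}\end{bmatrix},\quad \Upsilon=\begin{bmatrix}0&0&0\\0&0&I\\g^\wedge&0&0\end{bmatrix},\quad C^0=\begin{bmatrix}I&0\end{bmatrix},\quad w_0^\wedge=\mathrm{Ad}_{\hat A}w^\wedge+\hat a+f(\hat A),$$ where $g^\wedge$ in $\Upsilon$ is the $3\times3$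 skew matrix. The observer is *defined* on a time interval if it solves these equations there and $y\hat A^{-1}$ stays in $\mathcal D$. The error is $e=(e_1,e_2)=(T\hat A^{-1},\ \mathrm{Ad}_{\hat A}b^\wedge+\hat a)\in\mathcal M$, so that $e(0)=\xi(0)$, and its local coordinates are $\varepsilon(e)=(\log(e_1)^\vee,e_2^\vee)\in\mathbb R^{18}$. **Uniform observability** (Kalman). A pair $(A,C)$, with $A$ continuous on $[0,\infty)$ and $\Phi(s,t)$ the transition matrix of $\dot x=A x$, is uniformly observable with constants $\theta,\alpha,\beta$ if for every $t\ge0$ and for both $t_0=t$ and $t_0=t+\theta$ $$\alpha I\le\int_t^{t+\theta}\Phi(s,t_0)^{\top}C^{\top}C\,\Phi(s,t_0)\,ds\le\beta I .$$ The observer *evolves such that $(A^0_t,C^0)$ is uniformly observable* with these constants if, whenever it is defined on an interval $[0,t_1]$, $A^0_t$ coincides on $[0,t_1]$ with a matrix $A(t)$ for which $(A,C^0)$ is uniformly observable with these constants (for an observer defined on $[0,\infty)$: if $(A^0_t,C^0)$ itself is uniformly observable with these constants). **Theorem.** For all $g,P,Q,\Sigma_0$ as above and all constants $\theta,\alpha>0$,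 $\beta$, there are a neighbourhood $U$ of $\xi_0$ in $\mathcal M$ and $k,c>0$ such that the following holds for all continuous inputs $w,\tau$ and every trajectory $\xi$ of the system on $[0,\infty)$ with $e(0)\in U$ along which the observer evolves such that $(A^0_t,C^0)$ is uniformly observable with constants $\theta,\alpha,\beta$: the observer is defined on $[0,\infty)$, and every solution of the observer equations on $[0,\infty)$ satisfies $$|\varepsilon(e(t))|\le k\,e^{-ct}\,|\varepsilon(e(0))|\quad(t\ge0),\qquad e(t)\to\xi_0\ \text{ as } t\to\infty .$$ -/

import Mathlib

open Set Filter Topology Matrix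

noncomputable section

namespace BINS

/-! ### The group `SE₂(3)` and its Lie algebra -/

/-- Index type of `ℝ⁹`, split as (rotation, position, velocity). -/
abbrev I9 := Fin 3 ⊕ (Fin 3 ⊕ Fin 3)

/-- Index type of `ℝ¹⁸ = ℝ⁹ × ℝ⁹`, split as (navigation, bias). -/
abbrev I18 := I9 ⊕ I9

/-- Real `5 × 5` matrices, in blocks of sizes `3` and `2`. -/
abbrev Mat5 := Matrix (Fin 3 ⊕ Fin 2) (Fin 3 ⊕ Fin 2) ℝ

/-- The skew-symmetric matrix `x^` of a vector `x` of `ℝ³`. -/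
def skew (x : Fin 3 → ℝ) : Matrix (Fin 3) (Fin 3) ℝ :=
  !![0, -x 2, x 1; x 2, 0, -x 0; -x 1, x 0, 0]

/-- Rotation, position and velocity components of a vector of `ℝ⁹`. -/
def rotPart (x : I9 → ℝ) : Fin 3 → ℝ := fun i => x (Sum.inl i)
def posPart (x : I9 → ℝ) : Fin 3 → ℝ := fun i => x (Sum.inr (Sum.inl i))
def velPart (x : I9 → ℝ) : Fin 3 → ℝ := fun i => x (Sum.inr (Sum.inr i))

/-- The wedge map `ℝ⁹ → se₂(3)`: `(ω, ν, a) ↦ [ω^ ν a; 0 0 0; 0 0 0]`. -/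
def wedge (x : I9 → ℝ) : Mat5 :=
  fromBlocks (skew (rotPart x))
    (Matrix.of fun i j => if j = 0 then posPart x i else velPart x i) 0 0

/-- The vee map, the inverse of the wedge map on `se₂(3)`. -/
def vee (M : Mat5) : I9 → ℝ :=
  Sum.elim
    ![M (Sum.inl 2) (Sum.inl 1), M (Sum.inl 0) (Sum.inl 2), M (Sum.inl 1) (Sum.inl 0)]
    (Sum.elim (fun i => M (Sum.inl i) (Sum.inr 0)) (fun i => M (Sum.inl i) (Sum.inr 1)))

theorem vee_wedge (x : I9 → ℝ) : vee (wedge x) = x := by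
  ext i
  rcases i with i | i | i
  · fin_cases i <;> simp [vee, wedge, skew, rotPart]
  · simp [vee, wedge, posPart]
  · simp [vee, wedge, velPart]

/-- The extended poses `[R p v; 0 1 0; 0 0 1]` with `R ∈ SO(3)` and `p, v ∈ ℝ³`. -/
def SE23 : Set Mat5 :=
  {A | ∃ R ∈ Matrix.specialOrthogonalGroup (Fin 3) ℝ, ∃ V : Matrix (Fin 3) (Fin 2) ℝ,
    A = fromBlocks R V 0 1}

/-- The Lie algebra `se₂(3)`. -/
def se23 : Set Mat5 := Set.range wedge

/-- The Adjoint map `Ad_A U = A U A⁻¹`. -/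
def Ad (A U : Mat5) : Mat5 := A * U * A⁻¹

/-- The adjoint map `ad_U V = U V - V U`. -/
def ad (U V : Mat5) : Mat5 := U * V - V * U

/-- The `9 × 9` matrix of `x ↦ (ad_U x^)^∨`. -/
def adMatrix (U : Mat5) : Matrix I9 I9 ℝ :=
  Matrix.of fun i j => vee (ad U (wedge (Pi.single j 1))) i

/-- The Euclidean norm of a real vector. -/
def euclNorm {ι : Type*} [Fintype ι] (x : ι → ℝ) : ℝ := Real.sqrt (x ⬝ᵥ x)

/-- The domain of the principal logarithm in the Lie algebra: rotation angle below `π`. -/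
def principalBall : Set (I9 → ℝ) := {x | euclNorm (rotPart x) < Real.pi}

/-- The domain of the principal logarithm in `SE₂(3)`. -/
def logDomain : Set Mat5 := (fun x => NormedSpace.exp (wedge x)) '' principalBall

/-- `E ↦ (log E)^∨`, with `log` the principal logarithm of `SE₂(3)`, which is the inverse of the
exponential map on the rotation angles below `π`; to be used on `logDomain` only. -/
def logVee (E : Mat5) : I9 → ℝ :=
  Function.invFunOn (fun x => NormedSpace.exp (wedge x)) principalBall E

/-! ### The biased inertial navigation system -/

/-- `f₁⁰([R p v; 0 1 0; 0 0 1]) = [0 v 0; 0 0 0; 0 0 0]`. -/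
def drift (M : Mat5) : Mat5 :=
  fromBlocks 0 (Matrix.of fun i j => if j = 0 then M (Sum.inl i) (Sum.inr 1) else 0) 0 0

/-- The gravity vector as the element `(0, 0, g)^` of `se₂(3)`. -/
def gravity (g : Fin 3 → ℝ) : Mat5 := wedge (Sum.elim 0 (Sum.elim 0 g))

/-- The state space `M = SE₂(3) × se₂(3)` of pairs `(T, b^)`. -/
def stateSpace : Set (Mat5 × Mat5) := SE23 ×ˢ se23

/-- The state origin `ξ₀ = (I, 0)`. -/
def origin : Mat5 × Mat5 := (1, 0)

/-- `ξ = (T, b^)` solves, on `[0, ∞)`,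
`Ṫ = f₁⁰(T) T + T (w^ - b^) + g^ T` and `ḃ^ = τ^`. -/
structure IsTrajectory (g : Fin 3 → ℝ) (w τ : ℝ → I9 → ℝ) (ξ : ℝ → Mat5 × Mat5) : Prop where
  mem : ∀ t ∈ Ici (0 : ℝ), ξ t ∈ stateSpace
  pose : ∀ t ∈ Ici (0 : ℝ), HasDerivWithinAt (fun s => (ξ s).1)
    (drift (ξ t).1 * (ξ t).1 + (ξ t).1 * (wedge (w t) - (ξ t).2) + gravity g * (ξ t).1)
    (Ici 0) t
  bias : ∀ t ∈ Ici (0 : ℝ), HasDerivWithinAt (fun s => (ξ s).2) (wedge (τ t)) (Ici 0) t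

/-- The configuration output `h(T, b^) = T`. -/
def output (ξ : Mat5 × Mat5) : Mat5 := ξ.1

/-! ### The symmetry: the group `SE₂(3) ⋉ se₂(3)` of pairs `(A, a)` and its actions -/

/-- Inverse for the semi-direct product `(B, b) (A, a) = (B A, b + Ad_B a)`:
`(A, a)⁻¹ = (A⁻¹, -Ad_{A⁻¹} a)`. -/
def sdInv (X : Mat5 × Mat5) : Mat5 × Mat5 := (X.1⁻¹, -Ad X.1⁻¹ X.2)

/-- The action `φ((A, a), (T, b)) = (T A, Ad_{A⁻¹} (b - a))` on states. -/
def phi (X ξ : Mat5 × Mat5) : Mat5 × Mat5 := (ξ.1 * X.1, Ad X.1⁻¹ (ξ.2 - X.2))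

/-- The first component `Ad_{A⁻¹} (w^ - a) + f₁⁰(A⁻¹)` of the action `ψ` on inputs. -/
def psi₁ (X : Mat5 × Mat5) (W : Mat5) : Mat5 := Ad X.1⁻¹ (W - X.2) + drift X.1⁻¹

/-- The action `ρ((A, a), y) = y A` on outputs. -/
def rho (X : Mat5 × Mat5) (y : Mat5) : Mat5 := y * X.1

/-- The state error `e = φ(X̂⁻¹, ξ)`. -/
def stateError (X ξ : Mat5 × Mat5) : Mat5 × Mat5 := phi (sdInv X) ξ

/-- The local coordinates `ε(e) = (log(e₁)^∨, e₂^∨) ∈ ℝ¹⁸`, for `e₁ ∈ logDomain`. -/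
def eps (e : Mat5 × Mat5) : I18 → ℝ := Sum.elim (logVee e.1) (vee e.2)

/-- The inverse chart `(ε₁, ε₂) ↦ (exp(ε₁^), ε₂^)`. -/
def epsInv (x : I18 → ℝ) : Mat5 × Mat5 :=
  (NormedSpace.exp (wedge fun i => x (Sum.inl i)), wedge fun i => x (Sum.inr i))

/-- The differential at `0` of the inverse chart: `(x₁, x₂) ↦ (x₁^, x₂^)`. -/
def dEpsInv (x : I18 → ℝ) : Mat5 × Mat5 :=
  (wedge fun i => x (Sum.inl i), wedge fun i => x (Sum.inr i))

/-- The differential at the identity of `E ↦ φ(E, ξ₀)`: `(U, V) ↦ (U, -V)`. -/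
def dPhi (D : Mat5 × Mat5) : Mat5 × Mat5 := (D.1, -D.2)

/-- The (pseudo-)inverse of `dPhi`. -/
def dPhiInv (D : Mat5 × Mat5) : Mat5 × Mat5 := (D.1, -D.2)

theorem dPhiInv_dPhi (D : Mat5 × Mat5) : dPhiInv (dPhi D) = D ∧ dPhi (dPhiInv D) = D := by
  simp [dPhi, dPhiInv]

theorem wedge_smul (s : ℝ) (x : I9 → ℝ) : wedge (s • x) = s • wedge x := by
  ext i j
  rcases i with i | i <;> rcases j with j | j
  · fin_cases i <;> fin_cases j <;> simp [wedge, skew, rotPart]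
  · fin_cases j <;> simp [wedge, posPart, velPart]
  · simp [wedge]
  · simp [wedge]

theorem hasDerivAt_exp_smul (U : Mat5) :
    HasDerivAt (fun s : ℝ => NormedSpace.exp (s • U)) U 0 := by
  let _ : NormedRing Mat5 := Matrix.linftyOpNormedRing
  let _ : NormedAlgebra ℝ Mat5 := Matrix.linftyOpNormedAlgebra
  have h := hasDerivAt_exp_smul_const (𝕂 := ℝ) U (0 : ℝ)
  rw [zero_smul, NormedSpace.exp_zero, one_mul] at h
  exact h

theorem hasDerivAt_smul_id (V : Mat5) : HasDerivAt (fun s : ℝ => s • V) V 0 := by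
  let _ : NormedRing Mat5 := Matrix.linftyOpNormedRing
  let _ : NormedAlgebra ℝ Mat5 := Matrix.linftyOpNormedAlgebra
  have h := (hasDerivAt_id (0 : ℝ)).smul_const V
  rw [one_smul] at h
  exact h

/-- `dEpsInv x` is the derivative at `0` of the inverse chart in the direction `x`. -/
theorem hasDerivAt_epsInv (x : I18 → ℝ) :
    HasDerivAt (fun s : ℝ => (epsInv (s • x)).1) (dEpsInv x).1 0 ∧
      HasDerivAt (fun s : ℝ => (epsInv (s • x)).2) (dEpsInv x).2 0 := by
  have h1 : ∀ s : ℝ, epsInv (s • x) =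
      (NormedSpace.exp (s • (dEpsInv x).1), s • (dEpsInv x).2) := by
    intro s
    simp only [dEpsInv, epsInv, ← wedge_smul]
    rfl
  simp only [h1]
  exact ⟨hasDerivAt_exp_smul _, hasDerivAt_smul_id _⟩

/-- `dPhi D` is the derivative at the identity of `E ↦ φ(E, ξ₀)` in the direction `D`. -/
theorem hasDerivAt_phi (D : Mat5 × Mat5) :
    HasDerivAt (fun s : ℝ => (phi (NormedSpace.exp (s • D.1), s • D.2) origin).1) (dPhi D).1 0 ∧
      HasDerivAt (fun s : ℝ => (phi (NormedSpace.exp (s • D.1), s • D.2) origin).2)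
        (dPhi D).2 0 := by
  have h1 : ∀ s : ℝ, phi (NormedSpace.exp (s • D.1), s • D.2) origin =
      (NormedSpace.exp (s • D.1),
        NormedSpace.exp (s • (-D.1)) * (s • (-D.2)) * NormedSpace.exp (s • D.1)) := by
    intro s
    have hu : IsUnit (NormedSpace.exp (s • D.1)).det :=
      (Matrix.isUnit_iff_isUnit_det _).1 (Matrix.isUnit_exp _)
    simp only [phi, origin, Ad, one_mul, zero_sub, Matrix.nonsing_inv_nonsing_inv _ hu]
    rw [← Matrix.exp_neg, smul_neg, smul_neg]
  simp only [h1]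
  refine ⟨hasDerivAt_exp_smul _, ?_⟩
  have e1 := hasDerivAt_exp_smul (-D.1)
  have e2 := hasDerivAt_smul_id (-D.2)
  have e3 := hasDerivAt_exp_smul D.1
  have e : (-D.1 * ((0 : ℝ) • -D.2) + NormedSpace.exp ((0 : ℝ) • -D.1) * -D.2) *
      NormedSpace.exp ((0 : ℝ) • D.1) + NormedSpace.exp ((0 : ℝ) • -D.1) *
      ((0 : ℝ) • -D.2) * D.1 = -D.2 := by
    simp
  let _ : NormedRing Mat5 := Matrix.linftyOpNormedRing
  let _ : NormedAlgebra ℝ Mat5 := Matrix.linftyOpNormedAlgebra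
  exact HasDerivAt.congr_deriv (HasDerivAt.mul (HasDerivAt.mul e1 e2) e3) e

/-! ### The observer -/

/-- The `(1,1)` block `[0 0 0; 0 0 I; g^ 0 0]` of the linearized state matrix. -/
def upsilon (g : Fin 3 → ℝ) : Matrix I9 I9 ℝ :=
  fromBlocks 0 0 (fromRows 0 (skew g)) (fromBlocks 0 1 0 0)

/-- The linearized state matrix `[Υ -I; 0 ad_(w₀^ + g^)]` at observer state `X` and input `w`,
where `w₀^` is the velocity component of the origin input `ψ(X⁻¹, u)`. -/
def stateMatrix (g : Fin 3 → ℝ) (w : I9 → ℝ) (X : Mat5 × Mat5) : Matrix I18 I18 ℝ :=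
  fromBlocks (upsilon g) (-1) 0 (adMatrix (psi₁ (sdInv X) (wedge w) + gravity g))

/-- The output matrix `[I 0]`. -/
def outputMatrix : Matrix I9 I18 ℝ := fromCols 1 0

/-- The innovation `Δ = Dφ_{ξ₀}(I)† dε⁻¹ Σ Cᵀ Q⁻¹ δ(ρ(X̂⁻¹, y))`, where `δ(y) = log(y)^∨`. -/
def innovation (Q : Matrix I9 I9 ℝ) (X : Mat5 × Mat5) (S : Matrix I18 I18 ℝ) (y : Mat5) :
    Mat5 × Mat5 :=
  dPhiInv (dEpsInv ((S * outputMatrixᵀ * Q⁻¹) *ᵥ logVee (rho (sdInv X) y)))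

/-- The observer state `X̂ = (Â, â)` and the Riccati matrix `S` solve the observer equations on the
time interval `J` (which contains `0`), for the noise-free output `y`, with initial values `(I, 0)`
and `S₀`.  The transformed output has to stay in the domain of the logarithm. -/
structure IsObserver (g : Fin 3 → ℝ) (P : Matrix I18 I18 ℝ) (Q : Matrix I9 I9 ℝ)
    (S₀ : Matrix I18 I18 ℝ) (w τ : ℝ → I9 → ℝ) (y : ℝ → Mat5) (J : Set ℝ)
    (X : ℝ → Mat5 × Mat5) (S : ℝ → Matrix I18 I18 ℝ) : Prop where
  init_state : X 0 = (1, 0)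
  init_riccati : S 0 = S₀
  mem_group : ∀ t ∈ J, (X t).1 ∈ SE23
  mem_algebra : ∀ t ∈ J, (X t).2 ∈ se23
  posDef : ∀ t ∈ J, (S t).PosDef
  mem_logDomain : ∀ t ∈ J, rho (sdInv (X t)) (y t) ∈ logDomain
  ode_group : ∀ t ∈ J, HasDerivWithinAt (fun s => (X s).1)
    ((X t).1 * (wedge (w t) + Ad (X t).1⁻¹ (X t).2) + gravity g * (X t).1 + drift (X t).1
      + (innovation Q (X t) (S t) (y t)).1 * (X t).1) J t
  ode_algebra : ∀ t ∈ J, HasDerivWithinAt (fun s => (X s).2)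
    (ad (-(X t).2) ((Ad (X t).1 (wedge (w t)) + (X t).2) + gravity g + drift (X t).1)
      - Ad (X t).1 (wedge (τ t)) + (innovation Q (X t) (S t) (y t)).2
      + ad (innovation Q (X t) (S t) (y t)).1 (X t).2) J t
  ode_riccati : ∀ t ∈ J, HasDerivWithinAt S
    (stateMatrix g (w t) (X t) * S t + S t * (stateMatrix g (w t) (X t))ᵀ + P
      - S t * outputMatrixᵀ * Q⁻¹ * outputMatrix * S t) J t

/-! ### Uniform observability -/

/-- `Φ s t` is the transition matrix from time `t` to time `s` of `ẋ = A x` on `[0, ∞)`. -/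
def IsTransitionMatrix {n : Type*} [Fintype n] [DecidableEq n] (A : ℝ → Matrix n n ℝ)
    (Φ : ℝ → ℝ → Matrix n n ℝ) : Prop :=
  ∀ t ∈ Ici (0 : ℝ), Φ t t = 1 ∧
    ∀ s ∈ Ici (0 : ℝ), HasDerivWithinAt (fun r => Φ r t) (A s * Φ s t) (Ici 0) s

/-- The quadratic form `xᵀ (∫_{t₁}^{t₂} Φ(s,t₀)ᵀ Cᵀ C Φ(s,t₀) ds) x` of the observability Gramian
on `[t₁, t₂]`, referred to time `t₀`. -/
def gramianForm {n m : Type*} [Fintype n] [Fintype m] (Φ : ℝ → ℝ → Matrix n n ℝ)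
    (C : Matrix m n ℝ) (t₁ t₂ t₀ : ℝ) (x : n → ℝ) : ℝ :=
  ∫ s in t₁..t₂, euclNorm (C *ᵥ (Φ s t₀ *ᵥ x)) ^ 2

/-- Uniform (complete) observability, in Kalman's sense, of the pair `(A, C)` on `[0, ∞)` with
window length `T` and bounds `α`, `β`: over every window `[t, t + T]` the observability Gramian,
referred to the initial time of the window as well as to its final time, lies between `α I` and
`β I`. -/
def UniformlyObservable {n m : Type*} [Fintype n] [DecidableEq n] [Fintype m]
    (A : ℝ → Matrix n n ℝ) (C : Matrix m n ℝ) (T α β : ℝ) : Prop :=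
  ContinuousOn A (Ici 0) ∧ ∃ Φ : ℝ → ℝ → Matrix n n ℝ, IsTransitionMatrix A Φ ∧
    ∀ t ∈ Ici (0 : ℝ), ∀ x : n → ℝ,
      (α * euclNorm x ^ 2 ≤ gramianForm Φ C t (t + T) t x ∧
        gramianForm Φ C t (t + T) t x ≤ β * euclNorm x ^ 2) ∧
      (α * euclNorm x ^ 2 ≤ gramianForm Φ C t (t + T) (t + T) x ∧
        gramianForm Φ C t (t + T) (t + T) x ≤ β * euclNorm x ^ 2)

/-- The trajectory and the observer evolve such that `(A⁰_t, C⁰)` is uniformly observable with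
constants `T`, `α`, `β`.  The observer is not yet known to exist for all time, so this is required
for as long as it exists: whenever it is defined on `[0, t₁]`, the matrix `A⁰_t` is on `[0, t₁]` the
restriction of a state matrix that is uniformly observable with these constants.  For an observer
that is defined on `[0, ∞)` this says that `(A⁰_t, C⁰)` itself is uniformly observable with these
constants. -/
def ObservableAlong (g : Fin 3 → ℝ) (P : Matrix I18 I18 ℝ) (Q : Matrix I9 I9 ℝ)
    (S₀ : Matrix I18 I18 ℝ) (w τ : ℝ → I9 → ℝ) (y : ℝ → Mat5) (T α β : ℝ) : Prop :=
  ∀ t₁ ∈ Ici (0 : ℝ), ∀ X S, IsObserver g P Q S₀ w τ y (Icc 0 t₁) X S →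
    ∃ A : ℝ → Matrix I18 I18 ℝ, UniformlyObservable A outputMatrix T α β ∧
      ∀ t ∈ Icc 0 t₁, A t = stateMatrix g (w t) (X t)

end BINS

end

/-!
The error is studied in the linear coordinates `z = (vee e₁, vee e₂)` instead of the logarithmic
ones. With the gain `K = Σ Cᵀ Q⁻¹` they satisfy `z' = (A⁰ - K C⁰) z + N` (`hasDerivWithinAt_linCoord`),
where the remainder `N` is quadratic and contains the pose error `vee e₁ = C⁰ z` as a factor
(`norm_remainder_le`). The matrix `A⁰` depends on the inputs, but the remainder does not, which is why
all constants are uniform in the inputs.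

*Upper bound of the Riccati matrix.* Completing the square in the dual control problem gives
`riccati_dual_le`: every control of the adjoint equation bounds `Σ` from above. With the control that
uniform observability provides on a window of length `θ`, this yields `Σ ≤ σ I` with a `σ` that
depends only on `P`, `Q`, `Σ₀`, `θ`, `α`, `β` (`exists_riccati_upper_bound`). No bound of `A⁰` itself is
used: the transition matrices over a window are controlled by the two Gramian inequalities, at the
left and at the right end.

*Decay.* Along `z` the function `zᵀ Σ⁻¹ z` has the derivative
`-(Σ⁻¹z)ᵀ P (Σ⁻¹z) - (C⁰z)ᵀ Q⁻¹ (C⁰z) + 2 (Σ⁻¹z)ᵀ N`. While `z` is small, `|N|` is at most a small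
multiple of `|C⁰ z|`, so the first two terms absorb the third, and `Σ ≤ σ I` turns half of the first
into exponential decay (`exp_decay_of_perturbed_filter`). A lower bound of `Σ` is needed at time `0`
only, where `Σ = Σ₀`. A continuity argument shows that `z` remains small for as long as the observer
is defined (`exists_apriori_decay`).

*Existence.* Near the identity the principal logarithm is a `C¹` function of the entries of the pose
(`exists_isLocalLog`). The errors and the Riccati matrix therefore solve an ordinary differential
equation with a `C¹` right-hand side in which time enters only through the continuous parameters
`(T, Ad_T (w - b))`. The a priori bounds confine its solutions to a compact set, so they exist for all
time (`exists_global_solution`), and the observer is recovered from them (`isObserver_of_errField`).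
Positive definiteness of the Riccati matrix, which is part of the definition of the observer, persists
by `posDef_of_riccati`.
-/

noncomputable section

namespace BINS

/-! ### Calculus of matrix-valued functions -/

section MatrixCalculus

variable {l m n : Type*} [Fintype l] [Fintype m] [Fintype n] {J : Set ℝ} {t : ℝ}

theorem hasDerivWithinAt_matrix {f : ℝ → Matrix m n ℝ} {f' : Matrix m n ℝ} :
    HasDerivWithinAt f f' J t ↔
      ∀ i j, HasDerivWithinAt (fun s => f s i j) (f' i j) J t := by
  exact Iff.trans (hasDerivWithinAt_pi (φ := fun s i => f s i) (φ' := fun i => f' i))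
    (forall_congr' fun i => hasDerivWithinAt_pi)

theorem hasDerivWithinAt_mul_matrix {f : ℝ → Matrix l m ℝ} {f' : Matrix l m ℝ}
    {g : ℝ → Matrix m n ℝ} {g' : Matrix m n ℝ} (hf : HasDerivWithinAt f f' J t)
    (hg : HasDerivWithinAt g g' J t) :
    HasDerivWithinAt (fun s => f s * g s) (f' * g t + f t * g') J t := by
  rw [hasDerivWithinAt_matrix] at *
  intro i j
  simp only [Matrix.mul_apply, Matrix.add_apply, ← Finset.sum_add_distrib]
  exact HasDerivWithinAt.fun_sum fun k _ => (hf i k).mul (hg k j)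

theorem hasDerivWithinAt_mulVec {f : ℝ → Matrix m n ℝ} {f' : Matrix m n ℝ}
    {x : ℝ → n → ℝ} {x' : n → ℝ} (hf : HasDerivWithinAt f f' J t)
    (hx : HasDerivWithinAt x x' J t) :
    HasDerivWithinAt (fun s => f s *ᵥ x s) (f' *ᵥ x t + f t *ᵥ x') J t := by
  rw [hasDerivWithinAt_matrix] at hf
  rw [hasDerivWithinAt_pi] at *
  intro i
  simp only [Matrix.mulVec, dotProduct, Pi.add_apply, ← Finset.sum_add_distrib]
  exact HasDerivWithinAt.fun_sum fun k _ => (hf i k).mul (hx k)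

theorem hasDerivWithinAt_dotProduct {x y : ℝ → n → ℝ} {x' y' : n → ℝ}
    (hx : HasDerivWithinAt x x' J t) (hy : HasDerivWithinAt y y' J t) :
    HasDerivWithinAt (fun s => x s ⬝ᵥ y s) (x' ⬝ᵥ y t + x t ⬝ᵥ y') J t := by
  rw [hasDerivWithinAt_pi] at *
  simp only [dotProduct, ← Finset.sum_add_distrib]
  exact HasDerivWithinAt.fun_sum fun k _ => (hx k).mul (hy k)

theorem hasDerivWithinAt_transpose {f : ℝ → Matrix m n ℝ} {f' : Matrix m n ℝ}
    (hf : HasDerivWithinAt f f' J t) :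
    HasDerivWithinAt (fun s => (f s)ᵀ) f'ᵀ J t := by
  rw [hasDerivWithinAt_matrix] at *
  exact fun i j => hf j i

theorem hasDerivWithinAt_add_matrix {f g : ℝ → Matrix m n ℝ} {f' g' : Matrix m n ℝ}
    (hf : HasDerivWithinAt f f' J t) (hg : HasDerivWithinAt g g' J t) :
    HasDerivWithinAt (fun s => f s + g s) (f' + g') J t := by
  rw [hasDerivWithinAt_matrix] at *
  exact fun i j => (hf i j).add (hg i j)

theorem hasDerivWithinAt_sub_matrix {f g : ℝ → Matrix m n ℝ} {f' g' : Matrix m n ℝ}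
    (hf : HasDerivWithinAt f f' J t) (hg : HasDerivWithinAt g g' J t) :
    HasDerivWithinAt (fun s => f s - g s) (f' - g') J t := by
  rw [hasDerivWithinAt_matrix] at *
  exact fun i j => (hf i j).sub (hg i j)

theorem hasDerivWithinAt_linearMap_matrix {p : Type*} [Fintype p]
    (φ : Matrix m n ℝ →ₗ[ℝ] (p → ℝ))
    {f : ℝ → Matrix m n ℝ} {f' : Matrix m n ℝ} (hf : HasDerivWithinAt f f' J t) :
    HasDerivWithinAt (fun s => φ (f s)) (φ f') J t := by
  let _ : NormedAddCommGroup (Matrix m n ℝ) := Matrix.normedAddCommGroup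
  let _ : NormedSpace ℝ (Matrix m n ℝ) := Matrix.normedSpace
  exact (LinearMap.toContinuousLinearMap φ).hasFDerivAt.comp_hasDerivWithinAt t hf

theorem hasDerivWithinAt_mono_matrix {f : ℝ → Matrix m n ℝ} {f' : Matrix m n ℝ} {J' : Set ℝ}
    (hf : HasDerivWithinAt f f' J t) (hJ : J' ⊆ J) : HasDerivWithinAt f f' J' t := by
  rw [hasDerivWithinAt_matrix] at *
  exact fun i j => (hf i j).mono hJ

theorem hasDerivWithinAt_congr_deriv_matrix {f : ℝ → Matrix m n ℝ} {f' g' : Matrix m n ℝ}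
    (hf : HasDerivWithinAt f f' J t) (h : f' = g') : HasDerivWithinAt f g' J t := h ▸ hf

theorem hasDerivWithinAt_congr_matrix {f g : ℝ → Matrix m n ℝ} {f' : Matrix m n ℝ}
    (hf : HasDerivWithinAt f f' J t) (hfg : ∀ s ∈ J, g s = f s) (ht : t ∈ J) :
    HasDerivWithinAt g f' J t := by
  rw [hasDerivWithinAt_matrix] at *
  exact fun i j => (hf i j).congr_of_mem (fun s hs => by rw [hfg s hs]) ht

theorem continuousOn_of_hasDerivWithinAt_matrix {f : ℝ → Matrix m n ℝ} {f' : ℝ → Matrix m n ℝ}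
    (hf : ∀ t ∈ J, HasDerivWithinAt f (f' t) J t) : ContinuousOn f J := by
  intro t ht
  have h1 : HasDerivWithinAt (F := m → n → ℝ) f (f' t) J t := hf t ht
  exact h1.continuousWithinAt

theorem hasDerivWithinAt_inv_matrix [DecidableEq n] {f : ℝ → Matrix n n ℝ} {f' : Matrix n n ℝ}
    (hf : HasDerivWithinAt f f' J t) (hu : IsUnit (f t)) :
    HasDerivWithinAt (fun s => (f s)⁻¹) (-((f t)⁻¹ * f' * (f t)⁻¹)) J t := by
  let _ : NormedRing (Matrix n n ℝ) := Matrix.linftyOpNormedRing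
  let _ : NormedAlgebra ℝ (Matrix n n ℝ) := Matrix.linftyOpNormedAlgebra
  obtain ⟨u, hu⟩ := hu
  have h2 := hasFDerivAt_ringInverse (𝕜 := ℝ) u
  rw [hu] at h2
  have h3 := HasFDerivAt.comp_hasDerivWithinAt t h2 hf
  have h4 : ∀ s, (f s)⁻¹ = Ring.inverse (f s) := fun s => Matrix.nonsing_inv_eq_ringInverse _
  have h5 : (f t)⁻¹ = ((u⁻¹ : (Matrix n n ℝ)ˣ) : Matrix n n ℝ) := by
    rw [h4, ← hu, Ring.inverse_unit]
  simp only [h5]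
  simp only [h4]
  refine HasDerivWithinAt.congr_deriv h3 ?_
  simp

end MatrixCalculus

/-! ### Quadratic forms -/

section QuadraticForms

variable {m n : Type*} [Fintype m] [Fintype n]

theorem euclNorm_sq (x : n → ℝ) : euclNorm x ^ 2 = x ⬝ᵥ x :=
  Real.sq_sqrt (Finset.sum_nonneg fun i _ => mul_self_nonneg (x i))

theorem dotProduct_self_nonneg_real (x : n → ℝ) : 0 ≤ x ⬝ᵥ x :=
  Finset.sum_nonneg fun i _ => mul_self_nonneg (x i)

theorem euclNorm_nonneg (x : n → ℝ) : 0 ≤ euclNorm x := Real.sqrt_nonneg _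

theorem dotProduct_sq_le (x y : n → ℝ) : (x ⬝ᵥ y) ^ 2 ≤ (x ⬝ᵥ x) * (y ⬝ᵥ y) := by
  have h := Finset.sum_mul_sq_le_sq_mul_sq Finset.univ x y
  simpa only [dotProduct, ← sq] using h

theorem mulVec_dotProduct (M : Matrix m n ℝ) (x : n → ℝ) (y : m → ℝ) :
    (M *ᵥ x) ⬝ᵥ y = x ⬝ᵥ (Mᵀ *ᵥ y) := by
  rw [Matrix.dotProduct_mulVec, Matrix.vecMul_transpose]

/-- The squared Frobenius norm. -/
def frobSq (M : Matrix m n ℝ) : ℝ := ∑ i, (M i) ⬝ᵥ (M i)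

theorem frobSq_nonneg (M : Matrix m n ℝ) : 0 ≤ frobSq M :=
  Finset.sum_nonneg fun _ _ => dotProduct_self_nonneg_real _

theorem mulVec_dotProduct_self_le (M : Matrix m n ℝ) (x : n → ℝ) :
    (M *ᵥ x) ⬝ᵥ (M *ᵥ x) ≤ frobSq M * (x ⬝ᵥ x) := by
  rw [frobSq, Finset.sum_mul]
  refine Finset.sum_le_sum fun i _ => ?_
  have h := dotProduct_sq_le (M i) x
  rw [sq] at h
  exact h

theorem dotProduct_mulVec_le (M : Matrix n n ℝ) (x : n → ℝ) :
    x ⬝ᵥ (M *ᵥ x) ≤ (frobSq M + 1) * (x ⬝ᵥ x) := by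
  have h1 := mulVec_dotProduct_self_le M x
  have h2 := dotProduct_self_nonneg_real (x - M *ᵥ x)
  have h3 := dotProduct_self_nonneg_real x
  simp only [sub_dotProduct, dotProduct_sub, dotProduct_comm (M *ᵥ x) x] at h2
  have h4 := mul_nonneg (frobSq_nonneg M) h3
  nlinarith

theorem transpose_eq_of_isHermitian {P : Matrix n n ℝ} (hP : P.IsHermitian) : Pᵀ = P := by
  rw [← conjTranspose_eq_transpose_of_trivial, hP.eq]

theorem posSemidef_cauchySchwarz {P : Matrix n n ℝ} (hP : P.PosSemidef) (x y : n → ℝ) :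
    (x ⬝ᵥ P *ᵥ y) ^ 2 ≤ (x ⬝ᵥ P *ᵥ x) * (y ⬝ᵥ P *ᵥ y) := by
  have hs : Pᵀ = P := transpose_eq_of_isHermitian hP.isHermitian
  have h0 : ∀ v : n → ℝ, 0 ≤ v ⬝ᵥ P *ᵥ v := fun v => by
    simpa using hP.dotProduct_mulVec_nonneg v
  have h1 : y ⬝ᵥ P *ᵥ x = x ⬝ᵥ P *ᵥ y := by
    rw [dotProduct_comm, mulVec_dotProduct, hs]
  have h2 : ∀ s : ℝ, 0 ≤ (y ⬝ᵥ P *ᵥ y) * (s * s) + (2 * (x ⬝ᵥ P *ᵥ y)) * s + x ⬝ᵥ P *ᵥ x := by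
    intro s
    have h := h0 (x + s • y)
    simp only [mulVec_add, mulVec_smul, dotProduct_add, add_dotProduct, smul_dotProduct,
      dotProduct_smul, smul_eq_mul, h1] at h
    linarith
  have h3 := discrim_le_zero h2
  rw [discrim] at h3
  nlinarith

theorem PosDef_coercive [DecidableEq n] {P : Matrix n n ℝ} (hP : P.PosDef) :
    ∃ p > 0, ∀ x : n → ℝ, p * (x ⬝ᵥ x) ≤ x ⬝ᵥ P *ᵥ x := by
  have hc : 0 < frobSq P⁻¹ + 1 := by linarith [frobSq_nonneg P⁻¹]
  refine ⟨(frobSq P⁻¹ + 1)⁻¹, inv_pos.2 hc, fun x => ?_⟩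
  have hu : IsUnit P.det := (Matrix.isUnit_iff_isUnit_det _).1 hP.isUnit
  have h1 := posSemidef_cauchySchwarz hP.posSemidef x (P⁻¹ *ᵥ x)
  simp only [Matrix.mulVec_mulVec, Matrix.mul_nonsing_inv _ hu, Matrix.one_mulVec] at h1
  have h2 := dotProduct_mulVec_le P⁻¹ x
  rw [dotProduct_comm (P⁻¹ *ᵥ x) x] at h1
  have h3 : 0 ≤ x ⬝ᵥ P *ᵥ x := by simpa using hP.posSemidef.dotProduct_mulVec_nonneg x
  have h4 := dotProduct_self_nonneg_real x
  rw [inv_mul_le_iff₀ hc]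
  rcases h4.eq_or_lt with h | h
  · rw [← h]; positivity
  · nlinarith [mul_le_mul_of_nonneg_left h2 h3]

/-- A positive semidefinite matrix `S ≤ σ I` satisfies `S² ≤ σ S`. -/
theorem mulVec_self_le_of_posSemidef {S : Matrix n n ℝ} (hS : S.PosSemidef) {σ : ℝ}
    (hσ : ∀ x : n → ℝ, x ⬝ᵥ S *ᵥ x ≤ σ * (x ⬝ᵥ x)) (x : n → ℝ) :
    (S *ᵥ x) ⬝ᵥ (S *ᵥ x) ≤ σ * (x ⬝ᵥ S *ᵥ x) := by
  have hs : Sᵀ = S := transpose_eq_of_isHermitian hS.isHermitian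
  have h1 := posSemidef_cauchySchwarz hS x (S *ᵥ x)
  have h2 : x ⬝ᵥ S *ᵥ (S *ᵥ x) = (S *ᵥ x) ⬝ᵥ (S *ᵥ x) := by
    rw [mulVec_dotProduct S x, hs]
  rw [h2] at h1
  have h3 := hσ (S *ᵥ x)
  have h4 := dotProduct_self_nonneg_real (S *ᵥ x)
  have h5 : 0 ≤ x ⬝ᵥ S *ᵥ x := by simpa using hS.dotProduct_mulVec_nonneg x
  rcases h4.eq_or_lt with h | h
  · rw [← h]
    have h6 := hσ x
    rcases (dotProduct_self_nonneg_real x).eq_or_lt with h0 | h0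
    · have : x ⬝ᵥ S *ᵥ x = 0 := le_antisymm (by rw [← h0] at h6; linarith) h5
      rw [this]; simp
    · have : 0 ≤ σ := by
        by_contra hneg
        nlinarith
      positivity
  · nlinarith [mul_le_mul_of_nonneg_left h3 h5]

end QuadraticForms

/-! ### Linear differential equations and transition matrices -/

section Transition

variable {m n : Type*} [Fintype m] [Fintype n] [DecidableEq n]

/-- Two solutions of a linear equation that agree at one time agree at all times. -/
theorem linearODE_unique {A : ℝ → Matrix n n ℝ} (hA : ContinuousOn A (Ici 0))
    {x y : ℝ → n → ℝ}
    (hx : ∀ s ∈ Ici (0 : ℝ), HasDerivWithinAt x (A s *ᵥ x s) (Ici 0) s)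
    (hy : ∀ s ∈ Ici (0 : ℝ), HasDerivWithinAt y (A s *ᵥ y s) (Ici 0) s)
    {t : ℝ} (ht : 0 ≤ t) (hxy : x t = y t) {s : ℝ} (hs : 0 ≤ s) : x s = y s := by
  let _ : NormedRing (Matrix n n ℝ) := Matrix.linftyOpNormedRing
  let _ : NormedAlgebra ℝ (Matrix n n ℝ) := Matrix.linftyOpNormedAlgebra
  have hcx : ContinuousOn x (Ici 0) := fun s hs => (hx s hs).continuousWithinAt
  have hcy : ContinuousOn y (Ici 0) := fun s hs => (hy s hs).continuousWithinAt
  obtain ⟨K, hK⟩ := (isCompact_Icc (a := (0 : ℝ)) (b := max s t)).exists_bound_of_continuousOn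
    (hA.mono Icc_subset_Ici_self)
  have hlip : ∀ r ∈ Icc 0 (max s t),
      LipschitzOnWith K.toNNReal (fun v : n → ℝ => A r *ᵥ v) univ := by
    intro r hr
    refine LipschitzWith.lipschitzOnWith (LipschitzWith.of_dist_le_mul fun v w => ?_)
    rw [dist_eq_norm, dist_eq_norm, ← Matrix.mulVec_sub]
    refine (Matrix.linfty_opNorm_mulVec _ _).trans ?_
    exact mul_le_mul_of_nonneg_right ((hK r hr).trans (Real.le_coe_toNNReal K)) (norm_nonneg _)
  rcases le_total t s with h | h
  · have hsub : Icc t s ⊆ Ici (0 : ℝ) := fun r hr => ht.trans hr.1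
    refine ODE_solution_unique_of_mem_Icc_right (v := fun r v => A r *ᵥ v) (s := fun _ => univ)
      (K := K.toNNReal) (fun r hr => hlip r ⟨ht.trans hr.1, hr.2.le.trans (le_max_left _ _)⟩)
      (hcx.mono hsub) (fun r hr => ?_) (fun _ _ => trivial)
      (hcy.mono hsub) (fun r hr => ?_) (fun _ _ => trivial) hxy (right_mem_Icc.2 h)
    · exact (hx r (ht.trans hr.1)).mono (Ici_subset_Ici.2 (ht.trans hr.1))
    · exact (hy r (ht.trans hr.1)).mono (Ici_subset_Ici.2 (ht.trans hr.1))
  · have hsub : Icc s t ⊆ Ici (0 : ℝ) := fun r hr => hs.trans hr.1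
    have key : ∀ {z : ℝ → n → ℝ} {z' : n → ℝ} {r : ℝ}, 0 < r →
        HasDerivWithinAt z z' (Ici 0) r → HasDerivWithinAt z z' (Iic r) r := by
      intro z z' r hr h
      exact (h.hasDerivAt (Ici_mem_nhds hr)).hasDerivWithinAt
    refine ODE_solution_unique_of_mem_Icc_left (v := fun r v => A r *ᵥ v) (s := fun _ => univ)
      (K := K.toNNReal)
      (fun r hr => hlip r ⟨hs.trans hr.1.le, hr.2.trans (le_max_right _ _)⟩)
      (hcx.mono hsub) (fun r hr => ?_) (fun _ _ => trivial)
      (hcy.mono hsub) (fun r hr => ?_) (fun _ _ => trivial) hxy (left_mem_Icc.2 h)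
    · exact key (hs.trans_lt hr.1) (hx r (hs.trans hr.1.le))
    · exact key (hs.trans_lt hr.1) (hy r (hs.trans hr.1.le))

variable {A : ℝ → Matrix n n ℝ} {Φ : ℝ → ℝ → Matrix n n ℝ}

theorem IsTransitionMatrix.hasDerivWithinAt_mulVec (hΦ : IsTransitionMatrix A Φ) {t : ℝ}
    (ht : 0 ≤ t) (v : n → ℝ) {s : ℝ} (hs : 0 ≤ s) :
    HasDerivWithinAt (fun r => Φ r t *ᵥ v) (A s *ᵥ (Φ s t *ᵥ v)) (Ici 0) s := by
  have h := BINS.hasDerivWithinAt_mulVec ((hΦ t ht).2 s hs) (hasDerivWithinAt_const s (Ici 0) v)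
  simpa only [Matrix.mulVec_mulVec, Matrix.mulVec_zero, add_zero] using h

theorem IsTransitionMatrix.comp_mulVec (hΦ : IsTransitionMatrix A Φ)
    (hA : ContinuousOn A (Ici 0)) {s t r : ℝ} (hs : 0 ≤ s) (ht : 0 ≤ t) (hr : 0 ≤ r)
    (v : n → ℝ) : Φ s t *ᵥ (Φ t r *ᵥ v) = Φ s r *ᵥ v := by
  refine linearODE_unique hA (x := fun s => Φ s t *ᵥ (Φ t r *ᵥ v)) (y := fun s => Φ s r *ᵥ v)
    (fun s hs => hΦ.hasDerivWithinAt_mulVec ht _ hs)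
    (fun s hs => hΦ.hasDerivWithinAt_mulVec hr _ hs) ht ?_ hs
  simp only [(hΦ t ht).1, Matrix.one_mulVec]

theorem IsTransitionMatrix.mul_inv (hΦ : IsTransitionMatrix A Φ)
    (hA : ContinuousOn A (Ici 0)) {s t : ℝ} (hs : 0 ≤ s) (ht : 0 ≤ t) :
    Φ s t * Φ t s = 1 := by
  refine Matrix.ext_of_mulVec_single fun i => ?_
  rw [← Matrix.mulVec_mulVec, hΦ.comp_mulVec hA hs ht hs, (hΦ s hs).1]

theorem IsTransitionMatrix.inv_eq (hΦ : IsTransitionMatrix A Φ)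
    (hA : ContinuousOn A (Ici 0)) {s t : ℝ} (hs : 0 ≤ s) (ht : 0 ≤ t) :
    (Φ s t)⁻¹ = Φ t s :=
  Matrix.inv_eq_right_inv (hΦ.mul_inv hA hs ht)

theorem IsTransitionMatrix.hasDerivWithinAt_snd (hΦ : IsTransitionMatrix A Φ)
    (hA : ContinuousOn A (Ici 0)) {s t : ℝ} (hs : 0 ≤ s) (ht : 0 ≤ t) :
    HasDerivWithinAt (fun r => Φ t r) (-(Φ t s * A s)) (Ici 0) s := by
  have hu : IsUnit (Φ s t) := IsUnit.of_mul_eq_one _ (hΦ.mul_inv hA hs ht)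
  have h := hasDerivWithinAt_inv_matrix ((hΦ t ht).2 s hs) hu
  have h1 : -((Φ s t)⁻¹ * (A s * Φ s t) * (Φ s t)⁻¹) = -(Φ t s * A s) := by
    rw [hΦ.inv_eq hA hs ht, Matrix.mul_assoc, Matrix.mul_assoc, hΦ.mul_inv hA hs ht,
      Matrix.mul_one]
  rw [h1] at h
  exact hasDerivWithinAt_congr_matrix h (fun r hr => (hΦ.inv_eq hA hr ht).symm) hs

theorem IsTransitionMatrix.continuousOn_mulVec (hΦ : IsTransitionMatrix A Φ) {t : ℝ}
    (ht : 0 ≤ t) (v : n → ℝ) : ContinuousOn (fun r => Φ r t *ᵥ v) (Ici 0) :=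
  fun _ hs => (hΦ.hasDerivWithinAt_mulVec ht v hs).continuousWithinAt

end Transition

/-! ### The upper bound of the Riccati matrix -/

section Riccati

variable {m n : Type*} [Fintype m] [Fintype n] [DecidableEq m] [DecidableEq n]
  {A : ℝ → Matrix n n ℝ} {Φ : ℝ → ℝ → Matrix n n ℝ} {C : Matrix m n ℝ}

theorem IsTransitionMatrix.continuousOn_output (hΦ : IsTransitionMatrix A Φ)
    (C : Matrix m n ℝ) {t : ℝ} (ht : 0 ≤ t) (v : n → ℝ) :
    ContinuousOn (fun r => C *ᵥ (Φ r t *ᵥ v)) (Ici 0) := by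
  have h := hΦ.continuousOn_mulVec ht v
  rw [continuousOn_pi] at *
  intro i
  simp only [Matrix.mulVec, dotProduct] at *
  exact continuousOn_finsetSum _ fun j _ => continuousOn_const.mul (h j)

theorem IsTransitionMatrix.continuousOn_gramian (hΦ : IsTransitionMatrix A Φ)
    (C : Matrix m n ℝ) {t : ℝ} (ht : 0 ≤ t) (v : n → ℝ) :
    ContinuousOn (fun r => euclNorm (C *ᵥ (Φ r t *ᵥ v)) ^ 2) (Ici 0) := by
  have h := hΦ.continuousOn_output C ht v
  rw [continuousOn_pi] at h
  simp only [euclNorm_sq, dotProduct]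
  exact continuousOn_finsetSum _ fun j _ => (h j).mul (h j)

theorem IsTransitionMatrix.intervalIntegrable_gramian (hΦ : IsTransitionMatrix A Φ)
    (C : Matrix m n ℝ) {t : ℝ} (ht : 0 ≤ t) (v : n → ℝ) {a b : ℝ} (ha : 0 ≤ a) (hb : 0 ≤ b) :
    IntervalIntegrable (fun r => euclNorm (C *ᵥ (Φ r t *ᵥ v)) ^ 2) MeasureTheory.volume a b :=
  ((hΦ.continuousOn_gramian C ht v).mono
    fun _ hx => (le_min ha hb).trans hx.1).intervalIntegrable

theorem IsTransitionMatrix.gramianForm_shift (hΦ : IsTransitionMatrix A Φ)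
    (hA : ContinuousOn A (Ici 0)) (C : Matrix m n ℝ) {a b s t : ℝ} (ha : 0 ≤ a) (hb : 0 ≤ b)
    (hs : 0 ≤ s) (ht : 0 ≤ t) (v : n → ℝ) :
    gramianForm Φ C a b s (Φ s t *ᵥ v) = gramianForm Φ C a b t v := by
  refine intervalIntegral.integral_congr fun r hr => ?_
  simp only [hΦ.comp_mulVec hA ((le_min ha hb).trans hr.1) hs ht]

/-- Uniform observability bounds the transition matrix forward over one window, although the
state matrix itself may be unbounded: the initial and the transported vector generate the same
output, whose energy controls both. -/
theorem IsTransitionMatrix.forward_bound (hΦ : IsTransitionMatrix A Φ)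
    (hA : ContinuousOn A (Ici 0)) {θ α β : ℝ} (hθ : 0 < θ) (hα : 0 < α) (hβ : 0 ≤ β)
    (hG : ∀ t ∈ Ici (0 : ℝ), ∀ x : n → ℝ,
      (α * euclNorm x ^ 2 ≤ gramianForm Φ C t (t + θ) t x ∧
        gramianForm Φ C t (t + θ) t x ≤ β * euclNorm x ^ 2) ∧
      (α * euclNorm x ^ 2 ≤ gramianForm Φ C t (t + θ) (t + θ) x ∧
        gramianForm Φ C t (t + θ) (t + θ) x ≤ β * euclNorm x ^ 2))
    {s t : ℝ} (ht : 0 ≤ t) (hts : t ≤ s) (hst : s ≤ t + θ) (v : n → ℝ) :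
    (Φ s t *ᵥ v) ⬝ᵥ (Φ s t *ᵥ v) ≤ β / α * (1 + β / α) * (v ⬝ᵥ v) := by
  have hs : 0 ≤ s := ht.trans hts
  have htθ : 0 ≤ t + θ := by linarith
  have h1 := (hG s hs (Φ s t *ᵥ v)).1.1
  have h2 := (hG t ht v).1.2
  have h3 := (hG (t + θ) htθ (Φ (t + θ) t *ᵥ v)).1.2
  have h4 := (hG t ht (Φ (t + θ) t *ᵥ v)).2.1
  rw [hΦ.gramianForm_shift hA C hs (by linarith) hs ht] at h1
  rw [hΦ.gramianForm_shift hA C htθ (by linarith) htθ ht] at h3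
  rw [hΦ.gramianForm_shift hA C ht htθ htθ ht] at h4
  have h5 : gramianForm Φ C s (s + θ) t v ≤ gramianForm Φ C t (t + θ + θ) t v := by
    refine intervalIntegral.integral_mono_interval hts (by linarith) (by linarith)
      (Eventually.of_forall fun r => sq_nonneg _) ?_
    exact hΦ.intervalIntegrable_gramian C ht v ht (by linarith)
  have h6 : gramianForm Φ C t (t + θ + θ) t v =
      gramianForm Φ C t (t + θ) t v + gramianForm Φ C (t + θ) (t + θ + θ) t v :=
    (intervalIntegral.integral_add_adjacent_intervals
      (hΦ.intervalIntegrable_gramian C ht v ht (by linarith))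
      (hΦ.intervalIntegrable_gramian C ht v htθ (by linarith))).symm
  simp only [euclNorm_sq] at *
  have h7 : (Φ (t + θ) t *ᵥ v) ⬝ᵥ (Φ (t + θ) t *ᵥ v) ≤ β / α * (v ⬝ᵥ v) := by
    rw [div_mul_eq_mul_div, le_div_iff₀ hα]
    linarith
  have h8 : α * ((Φ s t *ᵥ v) ⬝ᵥ (Φ s t *ᵥ v)) ≤ β * (v ⬝ᵥ v) + β * (β / α * (v ⬝ᵥ v)) := by
    have := mul_le_mul_of_nonneg_left h7 hβ
    linarith
  have h9 : β / α * (1 + β / α) * (v ⬝ᵥ v) = (β * (v ⬝ᵥ v) + β * (β / α * (v ⬝ᵥ v))) / α := by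
    field_simp
  rw [h9, le_div_iff₀ hα]
  linarith

/-- The operator bound of a matrix passes to its transpose. -/
theorem transpose_mulVec_bound {M : Matrix n n ℝ} {c : ℝ}
    (h : ∀ v : n → ℝ, (M *ᵥ v) ⬝ᵥ (M *ᵥ v) ≤ c * (v ⬝ᵥ v)) (v : n → ℝ) :
    (Mᵀ *ᵥ v) ⬝ᵥ (Mᵀ *ᵥ v) ≤ c * (v ⬝ᵥ v) := by
  have h1 : (Mᵀ *ᵥ v) ⬝ᵥ (Mᵀ *ᵥ v) = (M *ᵥ (Mᵀ *ᵥ v)) ⬝ᵥ v := by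
    rw [mulVec_dotProduct M]
  have h2 := dotProduct_sq_le (M *ᵥ (Mᵀ *ᵥ v)) v
  have h3 := h (Mᵀ *ᵥ v)
  have h4 := dotProduct_self_nonneg_real (Mᵀ *ᵥ v)
  have h5 := dotProduct_self_nonneg_real v
  rw [← h1] at h2
  rcases h4.eq_or_lt with h0 | h0
  · rw [← h0]
    rcases h5.eq_or_lt with h6 | h6
    · rw [← h6]; simp
    · have : 0 ≤ c := by
        by_contra hneg
        have h7 := h v
        have h8 := dotProduct_self_nonneg_real (M *ᵥ v)
        nlinarith
      positivity
  · have h6 := mul_le_mul_of_nonneg_right h3 h5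
    nlinarith

/-- Completing the square in the dual filtering problem: along `λ' = -Aᵀ λ + Cᵀ η`, where
`λ(s) = Φ(t,s)ᵀ μ(s)`, the quadratic form `λᵀ S λ` of a Riccati solution grows at most by
`λᵀ P λ + ηᵀ Q η`. -/
theorem riccati_dual_le (hΦ : IsTransitionMatrix A Φ) (hA : ContinuousOn A (Ici 0))
    {P : Matrix n n ℝ} {Q : Matrix m m ℝ} (hQ : Q.PosDef)
    {S : ℝ → Matrix n n ℝ} {t₁ : ℝ} (hsymm : ∀ s ∈ Icc 0 t₁, (S s)ᵀ = S s)
    (hS : ∀ s ∈ Icc 0 t₁, HasDerivWithinAt S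
      (A s * S s + S s * (A s)ᵀ + P - S s * Cᵀ * Q⁻¹ * C * S s) (Icc 0 t₁) s)
    {a t : ℝ} (ha : 0 ≤ a) (hat : a ≤ t) (ht : t ≤ t₁)
    {μ : ℝ → n → ℝ} {η : ℝ → m → ℝ} {h h' : ℝ → ℝ}
    (hμ : ∀ s ∈ Icc a t, HasDerivWithinAt μ ((Φ s t)ᵀ *ᵥ (Cᵀ *ᵥ η s)) (Icc a t) s)
    (hh : ∀ s ∈ Icc a t, HasDerivWithinAt h (h' s) (Icc a t) s)
    (hle : ∀ s ∈ Icc a t, ((Φ t s)ᵀ *ᵥ μ s) ⬝ᵥ (P *ᵥ ((Φ t s)ᵀ *ᵥ μ s)) + η s ⬝ᵥ (Q *ᵥ η s)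
      ≤ h' s) :
    μ t ⬝ᵥ (S t *ᵥ μ t) ≤
      ((Φ t a)ᵀ *ᵥ μ a) ⬝ᵥ (S a *ᵥ ((Φ t a)ᵀ *ᵥ μ a)) + h t - h a := by
  have ht0 : 0 ≤ t := ha.trans hat
  set lam : ℝ → n → ℝ := fun s => (Φ t s)ᵀ *ᵥ μ s with hlam
  have hlam' : ∀ s ∈ Icc a t,
      HasDerivWithinAt lam (-((A s)ᵀ *ᵥ lam s) + Cᵀ *ᵥ η s) (Icc a t) s := by
    intro s hs
    have hs0 : 0 ≤ s := ha.trans hs.1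
    have h1 := hasDerivWithinAt_transpose (hasDerivWithinAt_mono_matrix
      (hΦ.hasDerivWithinAt_snd hA hs0 ht0)
      (show Icc a t ⊆ Ici 0 from fun r hr => ha.trans hr.1))
    have h2 := hasDerivWithinAt_mulVec h1 (hμ s hs)
    refine h2.congr_deriv ?_
    have h3 : (Φ t s)ᵀ * (Φ s t)ᵀ = 1 := by
      rw [← Matrix.transpose_mul, hΦ.mul_inv hA hs0 ht0, Matrix.transpose_one]
    rw [Matrix.mulVec_mulVec _ (Φ t s)ᵀ, h3, Matrix.one_mulVec, Matrix.transpose_neg,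
      Matrix.transpose_mul, Matrix.neg_mulVec, ← Matrix.mulVec_mulVec]
  have hf : ∀ s ∈ Icc a t, HasDerivWithinAt (fun s => lam s ⬝ᵥ (S s *ᵥ lam s) - h s)
      (lam s ⬝ᵥ (P *ᵥ lam s) - (C *ᵥ (S s *ᵥ lam s)) ⬝ᵥ (Q⁻¹ *ᵥ (C *ᵥ (S s *ᵥ lam s)))
        + 2 * (η s ⬝ᵥ (C *ᵥ (S s *ᵥ lam s))) - h' s) (Icc a t) s := by
    intro s hs
    have hs1 : s ∈ Icc 0 t₁ := ⟨ha.trans hs.1, hs.2.trans ht⟩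
    have hsub : Icc a t ⊆ Icc 0 t₁ := Icc_subset_Icc ha ht
    have hSs : HasDerivWithinAt S
        (A s * S s + S s * (A s)ᵀ + P - S s * Cᵀ * Q⁻¹ * C * S s) (Icc a t) s :=
      hasDerivWithinAt_mono_matrix (hS s hs1) hsub
    have h1 := hasDerivWithinAt_dotProduct (hlam' s hs) (hasDerivWithinAt_mulVec hSs (hlam' s hs))
    refine (h1.sub (hh s hs)).congr_deriv ?_
    congr 1
    have e0 : ∀ u v : n → ℝ, u ⬝ᵥ (S s *ᵥ v) = (S s *ᵥ u) ⬝ᵥ v := fun u v => by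
      rw [mulVec_dotProduct (S s), hsymm s hs1]
    have e1 : ∀ u v : n → ℝ, u ⬝ᵥ (A s *ᵥ v) = ((A s)ᵀ *ᵥ u) ⬝ᵥ v := fun u v => by
      rw [mulVec_dotProduct (A s)ᵀ, Matrix.transpose_transpose]
    have e2 : ∀ (u : n → ℝ) (v : m → ℝ), u ⬝ᵥ (Cᵀ *ᵥ v) = (C *ᵥ u) ⬝ᵥ v := fun u v => by
      rw [mulVec_dotProduct C]
    simp only [Matrix.add_mulVec, Matrix.sub_mulVec, ← Matrix.mulVec_mulVec, dotProduct_add,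
      dotProduct_sub, add_dotProduct, neg_dotProduct, dotProduct_neg, Matrix.mulVec_add,
      Matrix.mulVec_neg, e0, e1, e2]
    have e3 : (S s *ᵥ (Cᵀ *ᵥ η s)) ⬝ᵥ lam s = η s ⬝ᵥ (C *ᵥ (S s *ᵥ lam s)) := by
      rw [← e0, dotProduct_comm, e2, dotProduct_comm]
    rw [e3, dotProduct_comm _ (η s)]
    ring
  have hanti : AntitoneOn (fun s => lam s ⬝ᵥ (S s *ᵥ lam s) - h s) (Icc a t) := by
    refine antitoneOn_of_hasDerivWithinAt_nonpos (convex_Icc a t)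
      (fun s hs => (hf s hs).continuousWithinAt)
      (fun s hs => (hf s (interior_subset hs)).mono interior_subset) fun s hs => ?_
    have hs' := interior_subset hs
    have h1 := hle s hs'
    set w : m → ℝ := C *ᵥ (S s *ᵥ lam s)
    have hu : IsUnit Q.det := (Matrix.isUnit_iff_isUnit_det _).1 hQ.isUnit
    have hQs : Qᵀ = Q := transpose_eq_of_isHermitian hQ.isHermitian
    have h2 : 0 ≤ (Q⁻¹ *ᵥ w - η s) ⬝ᵥ (Q *ᵥ (Q⁻¹ *ᵥ w - η s)) := by
      simpa using hQ.posSemidef.dotProduct_mulVec_nonneg (Q⁻¹ *ᵥ w - η s)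
    have h3 : Q *ᵥ (Q⁻¹ *ᵥ w) = w := by
      rw [Matrix.mulVec_mulVec, Matrix.mul_nonsing_inv _ hu, Matrix.one_mulVec]
    have h4 : (Q⁻¹ *ᵥ w) ⬝ᵥ (Q *ᵥ η s) = w ⬝ᵥ η s := by
      rw [← h3, mulVec_dotProduct Q, hQs, h3]
    rw [Matrix.mulVec_sub, dotProduct_sub, sub_dotProduct, sub_dotProduct, h3, h4,
      dotProduct_comm (Q⁻¹ *ᵥ w) w, dotProduct_comm w (η s)] at h2
    simp only [hlam] at *
    linarith
  have h1 := hanti (left_mem_Icc.2 hat) (right_mem_Icc.2 hat) hat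
  have h2 : lam t = μ t := by
    simp only [hlam, (hΦ t ht0).1, Matrix.transpose_one, Matrix.one_mulVec]
  simp only [h2] at h1
  linarith

end Riccati

section RiccatiBound

variable {m n : Type*} [Fintype m] [Fintype n] [DecidableEq m] [DecidableEq n]
  {A : ℝ → Matrix n n ℝ} {Φ : ℝ → ℝ → Matrix n n ℝ} {C : Matrix m n ℝ}
  {P : Matrix n n ℝ} {Q : Matrix m m ℝ} {S : ℝ → Matrix n n ℝ} {t₁ : ℝ}

/-- On an initial interval on which the transition matrix is bounded, the Riccati matrix is bounded
by the covariance of the prediction that ignores the measurements. -/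
theorem riccati_le_of_prediction (hΦ : IsTransitionMatrix A Φ) (hA : ContinuousOn A (Ici 0))
    (hQ : Q.PosDef) (hsymm : ∀ s ∈ Icc 0 t₁, (S s)ᵀ = S s)
    (hS : ∀ s ∈ Icc 0 t₁, HasDerivWithinAt S
      (A s * S s + S s * (A s)ᵀ + P - S s * Cᵀ * Q⁻¹ * C * S s) (Icc 0 t₁) s)
    {θ c t : ℝ} (ht : 0 ≤ t) (htθ : t ≤ θ) (htt : t ≤ t₁) (hc : 0 ≤ c)
    (hb : ∀ s ∈ Icc 0 t, ∀ v : n → ℝ, (Φ t s *ᵥ v) ⬝ᵥ (Φ t s *ᵥ v) ≤ c * (v ⬝ᵥ v))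
    (u : n → ℝ) :
    u ⬝ᵥ (S t *ᵥ u) ≤ ((frobSq (S 0) + 1) + θ * (frobSq P + 1)) * c * (u ⬝ᵥ u) := by
  have hP0 := frobSq_nonneg P
  have hS0 := frobSq_nonneg (S 0)
  have hu0 := dotProduct_self_nonneg_real u
  have h1 := riccati_dual_le (C := C) hΦ hA hQ hsymm hS le_rfl ht htt (μ := fun _ => u)
    (η := fun _ => 0) (h := fun s => (frobSq P + 1) * (c * (u ⬝ᵥ u)) * s)
    (h' := fun _ => (frobSq P + 1) * (c * (u ⬝ᵥ u))) (fun s _ => ?_) (fun s _ => ?_)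
    (fun s hs => ?_)
  · have h2 := dotProduct_mulVec_le (S 0) ((Φ t 0)ᵀ *ᵥ u)
    have h3 := transpose_mulVec_bound (hb 0 ⟨le_rfl, ht⟩) u
    have h4 := mul_le_mul_of_nonneg_left h3 (show 0 ≤ frobSq (S 0) + 1 by linarith)
    have h5 : (frobSq P + 1) * (c * (u ⬝ᵥ u)) * t ≤ (frobSq P + 1) * (c * (u ⬝ᵥ u)) * θ :=
      mul_le_mul_of_nonneg_left htθ (by positivity)
    linarith
  · simpa using hasDerivWithinAt_const s (Icc 0 t) u
  · simpa using ((hasDerivAt_id s).const_mul ((frobSq P + 1) * (c * (u ⬝ᵥ u)))).hasDerivWithinAt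
  · have h2 := dotProduct_mulVec_le P ((Φ t s)ᵀ *ᵥ u)
    have h3 := transpose_mulVec_bound (hb s hs) u
    have h4 := mul_le_mul_of_nonneg_left h3 (show 0 ≤ frobSq P + 1 by linarith)
    simp only [Matrix.mulVec_zero, dotProduct_zero, add_zero]
    linarith

/-- The integrand of the observability Gramian applied to `z`, referred to time `t` and extended
to negative times by its value at `0`. -/
def gramianIntegrand (Φ : ℝ → ℝ → Matrix n n ℝ) (C : Matrix m n ℝ) (t : ℝ) (z : n → ℝ) (r : ℝ) :
    n → ℝ :=
  (Φ (max r 0) t)ᵀ *ᵥ (Cᵀ *ᵥ (C *ᵥ (Φ (max r 0) t *ᵥ z)))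

theorem continuous_gramianIntegrand (hΦ : IsTransitionMatrix A Φ) {t : ℝ} (ht : 0 ≤ t)
    (C : Matrix m n ℝ) (z : n → ℝ) : Continuous (gramianIntegrand Φ C t z) := by
  have h0 : ∀ v : n → ℝ, Continuous fun r => Φ (max r 0) t *ᵥ v := fun v =>
    (hΦ.continuousOn_mulVec ht v).comp_continuous (continuous_id.max continuous_const)
      fun r => le_max_right r 0
  have h1 : Continuous fun r => Φ (max r 0) t := by
    refine continuous_matrix fun i j => ?_
    have := (continuous_pi_iff.1 (h0 (Pi.single j 1))) i
    simpa using this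
  unfold gramianIntegrand
  exact h1.matrix_transpose.matrix_mulVec
    (continuous_const.matrix_mulVec (continuous_const.matrix_mulVec (h1.matrix_mulVec
      continuous_const)))

/-- The running observability Gramian over `[a, s]`, applied to `z`. -/
def gramianVec (Φ : ℝ → ℝ → Matrix n n ℝ) (C : Matrix m n ℝ) (t a s : ℝ) (z : n → ℝ) : n → ℝ :=
  ∫ r in a..s, gramianIntegrand Φ C t z r

theorem hasDerivAt_gramianVec (hΦ : IsTransitionMatrix A Φ) {t : ℝ} (ht : 0 ≤ t)
    (C : Matrix m n ℝ) (z : n → ℝ) (a s : ℝ) :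
    HasDerivAt (fun s => gramianVec Φ C t a s z) (gramianIntegrand Φ C t z s) s :=
  ((continuous_gramianIntegrand hΦ ht C z).integral_hasStrictDerivAt a s).hasDerivAt

theorem dotProduct_gramianVec (hΦ : IsTransitionMatrix A Φ) {t : ℝ} (ht : 0 ≤ t)
    (C : Matrix m n ℝ) (y z : n → ℝ) {a s : ℝ} (ha : 0 ≤ a) (has : a ≤ s) :
    y ⬝ᵥ gramianVec Φ C t a s z =
      ∫ r in a..s, (C *ᵥ (Φ r t *ᵥ y)) ⬝ᵥ (C *ᵥ (Φ r t *ᵥ z)) := by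
  have h1 : ∀ r, HasDerivAt (fun s => y ⬝ᵥ gramianVec Φ C t a s z)
      (y ⬝ᵥ gramianIntegrand Φ C t z r) r := by
    intro r
    have h2 := hasDerivWithinAt_dotProduct (hasDerivWithinAt_const r univ y)
      (hasDerivAt_gramianVec hΦ ht C z a r).hasDerivWithinAt
    rw [hasDerivWithinAt_univ] at h2
    simpa using h2
  have h3 : Continuous fun r => y ⬝ᵥ gramianIntegrand Φ C t z r :=
    continuous_const.dotProduct (continuous_gramianIntegrand hΦ ht C z)
  have h4 := intervalIntegral.integral_eq_sub_of_hasDerivAt (fun r _ => h1 r)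
    (h3.intervalIntegrable a s)
  have h5 : y ⬝ᵥ gramianVec Φ C t a a z = 0 := by
    simp [gramianVec]
  rw [h5, sub_zero] at h4
  rw [← h4]
  refine intervalIntegral.integral_congr fun r hr => ?_
  rw [uIcc_of_le has] at hr
  simp only [gramianIntegrand, max_eq_left (ha.trans hr.1)]
  rw [mulVec_dotProduct C, mulVec_dotProduct (Φ r t)]

/-- Over a full observability window the Riccati matrix is bounded by the covariance of the
least squares estimate that uses the measurements of this window only. -/
theorem riccati_le_of_window (hΦ : IsTransitionMatrix A Φ) (hA : ContinuousOn A (Ici 0))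
    (hQ : Q.PosDef) (hsymm : ∀ s ∈ Icc 0 t₁, (S s)ᵀ = S s)
    (hS : ∀ s ∈ Icc 0 t₁, HasDerivWithinAt S
      (A s * S s + S s * (A s)ᵀ + P - S s * Cᵀ * Q⁻¹ * C * S s) (Icc 0 t₁) s)
    {θ α β c a : ℝ} (hθ : 0 < θ) (hα : 0 < α) (hβ : 0 < β) (ha : 0 ≤ a) (htt : a + θ ≤ t₁)
    (hc : 0 ≤ c)
    (hb : ∀ s ∈ Icc a (a + θ), ∀ v : n → ℝ,
      (Φ (a + θ) s *ᵥ v) ⬝ᵥ (Φ (a + θ) s *ᵥ v) ≤ c * (v ⬝ᵥ v))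
    (hG : ∀ x : n → ℝ, α * euclNorm x ^ 2 ≤ gramianForm Φ C a (a + θ) (a + θ) x ∧
        gramianForm Φ C a (a + θ) (a + θ) x ≤ β * euclNorm x ^ 2)
    (u : n → ℝ) :
    u ⬝ᵥ (S (a + θ) *ᵥ u) ≤
      (θ * (frobSq P + 1) * c * β ^ 2 + (frobSq Q + 1) * β) / α ^ 2 * (u ⬝ᵥ u) := by
  set t := a + θ with ht_def
  have hat : a ≤ t := by linarith
  have ht : 0 ≤ t := by linarith
  have hP0 := frobSq_nonneg P
  have hQ0 := frobSq_nonneg Q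
  have hlow : ∀ z : n → ℝ, α * (z ⬝ᵥ z) ≤ z ⬝ᵥ gramianVec Φ C t a t z := by
    intro z
    rw [dotProduct_gramianVec hΦ ht C z z ha hat, ← euclNorm_sq]
    simpa only [gramianForm, euclNorm_sq] using (hG z).1
  -- The full-window Gramian is linear and injective, hence onto.
  obtain ⟨z, hz⟩ : ∃ z, gramianVec Φ C t a t z = u := by
    let Γ : (n → ℝ) →ₗ[ℝ] (n → ℝ) :=
      { toFun := fun z => gramianVec Φ C t a t z
        map_add' := fun x y => by
          simp only [gramianVec]
          rw [← intervalIntegral.integral_add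
            ((continuous_gramianIntegrand hΦ ht C x).intervalIntegrable _ _)
            ((continuous_gramianIntegrand hΦ ht C y).intervalIntegrable _ _)]
          refine intervalIntegral.integral_congr fun r _ => ?_
          simp only [gramianIntegrand, Matrix.mulVec_add]
        map_smul' := fun b x => by
          simp only [gramianVec, RingHom.id_apply]
          rw [← intervalIntegral.integral_smul]
          refine intervalIntegral.integral_congr fun r _ => ?_
          simp only [gramianIntegrand, Matrix.mulVec_smul] }
    have hinj : Function.Injective Γ := by
      rw [← LinearMap.ker_eq_bot, LinearMap.ker_eq_bot']
      intro x hx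
      have h1 := hlow x
      have h2 : gramianVec Φ C t a t x = 0 := hx
      rw [h2, dotProduct_zero] at h1
      have h3 := dotProduct_self_nonneg_real x
      exact dotProduct_self_eq_zero.1 (by nlinarith)
    exact LinearMap.injective_iff_surjective.1 hinj u
  have hz0 := dotProduct_self_nonneg_real z
  have hzu : α ^ 2 * (z ⬝ᵥ z) ≤ u ⬝ᵥ u := by
    have h1 := hlow z
    rw [hz] at h1
    have h2 := dotProduct_sq_le z u
    rcases hz0.eq_or_lt with h0 | h0
    · rw [← h0, mul_zero]; exact dotProduct_self_nonneg_real u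
    · have h3 : (α * (z ⬝ᵥ z)) ^ 2 ≤ (z ⬝ᵥ u) ^ 2 := pow_le_pow_left₀ (by positivity) h1 2
      nlinarith
  have hint : ∀ (y : n → ℝ) {s : ℝ}, s ∈ Icc a t →
      ∫ r in a..s, euclNorm (C *ᵥ (Φ r t *ᵥ y)) ^ 2 ≤ β * (y ⬝ᵥ y) := by
    intro y s hs
    have h1 := (hG y).2
    rw [euclNorm_sq] at h1
    refine le_trans ?_ h1
    refine intervalIntegral.integral_mono_interval le_rfl hs.1 hs.2
      (Eventually.of_forall fun r => sq_nonneg _)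
      (hΦ.intervalIntegrable_gramian C ht y ha ht)
  have hμ : ∀ s ∈ Icc a t, gramianVec Φ C t a s z ⬝ᵥ gramianVec Φ C t a s z ≤
      β ^ 2 * (z ⬝ᵥ z) := by
    intro s hs
    set y := gramianVec Φ C t a s z with hy
    have h1 : y ⬝ᵥ y = ∫ r in a..s, (C *ᵥ (Φ r t *ᵥ y)) ⬝ᵥ (C *ᵥ (Φ r t *ᵥ z)) := by
      rw [← dotProduct_gramianVec hΦ ht C y z ha hs.1]
    have hsub : uIcc a s ⊆ Ici 0 := by
      rw [uIcc_of_le hs.1]; exact fun r hr => ha.trans hr.1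
    have hi1 := hΦ.intervalIntegrable_gramian C ht y ha (ha.trans hs.1)
    have hi2 := hΦ.intervalIntegrable_gramian C ht z ha (ha.trans hs.1)
    have h2 : ∫ r in a..s, (C *ᵥ (Φ r t *ᵥ y)) ⬝ᵥ (C *ᵥ (Φ r t *ᵥ z)) ≤
        ∫ r in a..s, ((2 * β)⁻¹ * euclNorm (C *ᵥ (Φ r t *ᵥ y)) ^ 2 +
          β / 2 * euclNorm (C *ᵥ (Φ r t *ᵥ z)) ^ 2) := by
      refine intervalIntegral.integral_mono_on hs.1 ?_ ((hi1.const_mul _).add (hi2.const_mul _))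
        fun r _ => ?_
      · refine ContinuousOn.intervalIntegrable ?_
        have c1 := continuousOn_pi.1 ((hΦ.continuousOn_output C ht y).mono hsub)
        have c2 := continuousOn_pi.1 ((hΦ.continuousOn_output C ht z).mono hsub)
        exact continuousOn_finsetSum _ fun i _ => (c1 i).mul (c2 i)
      · have h3 := dotProduct_self_nonneg_real (C *ᵥ (Φ r t *ᵥ y) - β • (C *ᵥ (Φ r t *ᵥ z)))
        simp only [euclNorm_sq]
        simp only [sub_dotProduct, dotProduct_sub, smul_dotProduct, dotProduct_smul,
          smul_eq_mul, dotProduct_comm (C *ᵥ (Φ r t *ᵥ z)) (C *ᵥ (Φ r t *ᵥ y))] at h3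
        rw [inv_mul_eq_div, div_add' _ _ _ (by positivity), le_div_iff₀ (by positivity)]
        nlinarith
    rw [intervalIntegral.integral_add (hi1.const_mul _) (hi2.const_mul _),
      intervalIntegral.integral_const_mul, intervalIntegral.integral_const_mul, ← h1] at h2
    have h4 := mul_le_mul_of_nonneg_left (hint y hs) (show 0 ≤ (2 * β)⁻¹ by positivity)
    have h5 := mul_le_mul_of_nonneg_left (hint z hs) (show 0 ≤ β / 2 by positivity)
    have h6 : (2 * β)⁻¹ * (β * (y ⬝ᵥ y)) = (y ⬝ᵥ y) / 2 := by field_simp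
    nlinarith
  have hcont : Continuous fun r => euclNorm (C *ᵥ (Φ (max r 0) t *ᵥ z)) ^ 2 :=
    (hΦ.continuousOn_gramian C ht z).comp_continuous (continuous_id.max continuous_const)
      fun r => le_max_right r 0
  set k := (frobSq P + 1) * (c * (β ^ 2 * (z ⬝ᵥ z))) with hk
  have h1 := riccati_dual_le (C := C) hΦ hA hQ hsymm hS ha hat htt
    (μ := fun s => gramianVec Φ C t a s z) (η := fun s => C *ᵥ (Φ s t *ᵥ z))
    (h := fun s => k * s +
      (frobSq Q + 1) * ∫ r in a..s, euclNorm (C *ᵥ (Φ (max r 0) t *ᵥ z)) ^ 2)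
    (h' := fun s => k * 1 + (frobSq Q + 1) * euclNorm (C *ᵥ (Φ (max s 0) t *ᵥ z)) ^ 2)
    (fun s hs => ?_) (fun s _ => ?_) (fun s hs => ?_)
  · have h2 : gramianVec Φ C t a a z = 0 := by simp [gramianVec]
    simp only [h2, hz, Matrix.mulVec_zero, dotProduct_zero, intervalIntegral.integral_same,
      mul_zero, zero_add, add_zero] at h1
    have h3 : ∫ r in a..t, euclNorm (C *ᵥ (Φ (max r 0) t *ᵥ z)) ^ 2 ≤ β * (z ⬝ᵥ z) := by
      refine le_of_eq_of_le ?_ (hint z ⟨hat, le_rfl⟩)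
      refine intervalIntegral.integral_congr fun r hr => ?_
      rw [uIcc_of_le hat] at hr
      simp only [max_eq_left (ha.trans hr.1)]
    have h4 := mul_le_mul_of_nonneg_left h3 (show 0 ≤ frobSq Q + 1 by linarith)
    have h5 : k * t - k * a = k * θ := by rw [ht_def]; ring
    rw [div_mul_eq_mul_div, le_div_iff₀ (by positivity)]
    have h6 : u ⬝ᵥ (S t *ᵥ u) ≤
        (θ * (frobSq P + 1) * c * β ^ 2 + (frobSq Q + 1) * β) * (z ⬝ᵥ z) := by
      rw [hk] at h5 h1
      linarith
    have h7 := mul_le_mul_of_nonneg_left hzu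
      (show 0 ≤ θ * (frobSq P + 1) * c * β ^ 2 + (frobSq Q + 1) * β by positivity)
    have h8 := mul_le_mul_of_nonneg_right h6 (show 0 ≤ α ^ 2 by positivity)
    linarith
  · have h2 := (hasDerivAt_gramianVec hΦ ht C z a s).hasDerivWithinAt (s := Icc a t)
    simpa only [gramianIntegrand, max_eq_left (ha.trans hs.1)] using h2
  · exact (((hasDerivAt_id s).const_mul k).add
      ((hcont.integral_hasStrictDerivAt a s).hasDerivAt.const_mul _)).hasDerivWithinAt
  · have h2 := dotProduct_mulVec_le P ((Φ t s)ᵀ *ᵥ gramianVec Φ C t a s z)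
    have h3 := transpose_mulVec_bound (hb s hs) (gramianVec Φ C t a s z)
    have h4 := mul_le_mul_of_nonneg_left (h3.trans (mul_le_mul_of_nonneg_left (hμ s hs) hc))
      (show 0 ≤ frobSq P + 1 by linarith)
    have h5 := dotProduct_mulVec_le Q (C *ᵥ (Φ s t *ᵥ z))
    simp only [max_eq_left (ha.trans hs.1), euclNorm_sq, hk]
    linarith

/-- A Riccati solution with fixed initial value is bounded above by a constant that depends on the
state matrix only through the constants of uniform observability. -/
theorem exists_riccati_upper_bound [Nonempty n] (P : Matrix n n ℝ) (hQ : Q.PosDef)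
    (S₀ : Matrix n n ℝ) (C : Matrix m n ℝ) {θ α : ℝ} (β : ℝ) (hθ : 0 < θ) (hα : 0 < α) :
    ∃ σ > 0, ∀ (A S : ℝ → Matrix n n ℝ) (t₁ : ℝ), UniformlyObservable A C θ α β → S 0 = S₀ →
      (∀ s ∈ Icc 0 t₁, (S s)ᵀ = S s) →
      (∀ s ∈ Icc 0 t₁, HasDerivWithinAt S
        (A s * S s + S s * (A s)ᵀ + P - S s * Cᵀ * Q⁻¹ * C * S s) (Icc 0 t₁) s) →
      ∀ t ∈ Icc 0 t₁, ∀ u : n → ℝ, u ⬝ᵥ (S t *ᵥ u) ≤ σ * (u ⬝ᵥ u) := by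
  set c := β / α * (1 + β / α)
  set σ₁ := ((frobSq S₀ + 1) + θ * (frobSq P + 1)) * c
  set σ₂ := (θ * (frobSq P + 1) * c * β ^ 2 + (frobSq Q + 1) * β) / α ^ 2
  refine ⟨max (max σ₁ σ₂) 1, by positivity, ?_⟩
  rintro A S t₁ ⟨hA, Φ, hΦ, hG⟩ hS0 hsymm hS t ht u
  have hβ : 0 < β := by
    have h1 := (hG 0 (by simp) (fun _ => 1)).1
    rw [euclNorm_sq] at h1
    have h2 : 0 < (fun _ : n => (1 : ℝ)) ⬝ᵥ (fun _ => 1) := by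
      simpa [dotProduct] using Fintype.card_pos
    nlinarith [h1.1.trans h1.2]
  have hc : 0 ≤ c := by positivity
  have hu := dotProduct_self_nonneg_real u
  rcases le_total t θ with h | h
  · refine (riccati_le_of_prediction hΦ hA hQ hsymm hS ht.1 h ht.2 hc (fun s hs v => ?_) u).trans ?_
    · exact hΦ.forward_bound hA hθ hα hβ.le hG hs.1 hs.2 (by linarith [hs.1]) v
    · rw [hS0]
      exact mul_le_mul_of_nonneg_right ((le_max_left _ _).trans (le_max_left _ _)) hu
  · have h1 := riccati_le_of_window (a := t - θ) hΦ hA hQ hsymm hS hθ hα hβ (by linarith)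
      (by linarith [ht.2]) hc (fun s hs v => ?_) (fun x => (hG (t - θ) (by simpa using h) x).2) u
    · rw [sub_add_cancel] at h1
      exact h1.trans (mul_le_mul_of_nonneg_right ((le_max_right _ _).trans (le_max_left _ _)) hu)
    · exact hΦ.forward_bound hA hθ hα hβ.le hG (by linarith [hs.1]) hs.2 (by linarith [hs.1]) v

end RiccatiBound

/-! ### The Lyapunov function given by the inverse Riccati matrix -/

section Lyapunov

variable {m n : Type*} [Fintype m] [Fintype n] [DecidableEq m] [DecidableEq n]
  {A : ℝ → Matrix n n ℝ} {C : Matrix m n ℝ}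
  {P : Matrix n n ℝ} {Q : Matrix m m ℝ} {S : ℝ → Matrix n n ℝ} {t₁ : ℝ}

/-- The derivative of `V = xᵀ S⁻¹ x` along `x' = (A - S Cᵀ Q⁻¹ C) x + N`, in terms of
`p = S⁻¹ x`. -/
theorem hasDerivWithinAt_lyapunov {J : Set ℝ} {s : ℝ}
    (hpd : (S s).PosDef)
    (hS : HasDerivWithinAt S
      (A s * S s + S s * (A s)ᵀ + P - S s * Cᵀ * Q⁻¹ * C * S s) J s)
    {x N : ℝ → n → ℝ}
    (hx : HasDerivWithinAt x
      (A s *ᵥ x s - (S s * Cᵀ * Q⁻¹) *ᵥ (C *ᵥ x s) + N s) J s) :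
    HasDerivWithinAt (fun s => x s ⬝ᵥ ((S s)⁻¹ *ᵥ x s))
      (-(((S s)⁻¹ *ᵥ x s) ⬝ᵥ (P *ᵥ ((S s)⁻¹ *ᵥ x s))) - (C *ᵥ x s) ⬝ᵥ (Q⁻¹ *ᵥ (C *ᵥ x s))
        + 2 * (N s ⬝ᵥ ((S s)⁻¹ *ᵥ x s))) J s := by
  have h1 := hasDerivWithinAt_dotProduct hx
    (hasDerivWithinAt_mulVec (hasDerivWithinAt_inv_matrix hS hpd.isUnit) hx)
  refine h1.congr_deriv ?_
  set x' := A s *ᵥ x s - (S s * Cᵀ * Q⁻¹) *ᵥ (C *ᵥ x s) + N s with hx'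
  set p := (S s)⁻¹ *ᵥ x s with hp
  have hu : IsUnit (S s).det := (Matrix.isUnit_iff_isUnit_det _).1 hpd.isUnit
  have hsy : (S s)ᵀ = S s := transpose_eq_of_isHermitian hpd.isHermitian
  have hZsy : ((S s)⁻¹)ᵀ = (S s)⁻¹ := by rw [Matrix.transpose_nonsing_inv, hsy]
  have hSp : S s *ᵥ p = x s := by
    rw [hp, Matrix.mulVec_mulVec, Matrix.mul_nonsing_inv _ hu, Matrix.one_mulVec]
  have e0 : ∀ v : n → ℝ, x s ⬝ᵥ ((S s)⁻¹ *ᵥ v) = p ⬝ᵥ v := fun v => by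
    rw [hp, mulVec_dotProduct (S s)⁻¹, hZsy]
  have e1 : ∀ v : n → ℝ, p ⬝ᵥ (S s *ᵥ v) = x s ⬝ᵥ v := fun v => by
    rw [← hSp, mulVec_dotProduct (S s), hsy]
  have e2 : ∀ (u : n → ℝ) (v : m → ℝ), u ⬝ᵥ (Cᵀ *ᵥ v) = (C *ᵥ u) ⬝ᵥ v := fun u v => by
    rw [mulVec_dotProduct C]
  have e3 : x s ⬝ᵥ ((A s)ᵀ *ᵥ p) = p ⬝ᵥ (A s *ᵥ x s) := by
    rw [← mulVec_dotProduct (A s), dotProduct_comm]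
  have h2 : x' ⬝ᵥ p = p ⬝ᵥ (A s *ᵥ x s) - (C *ᵥ x s) ⬝ᵥ (Q⁻¹ *ᵥ (C *ᵥ x s)) + N s ⬝ᵥ p := by
    rw [hx', add_dotProduct, sub_dotProduct, dotProduct_comm (A s *ᵥ x s),
      dotProduct_comm ((S s * Cᵀ * Q⁻¹) *ᵥ (C *ᵥ x s))]
    simp only [← Matrix.mulVec_mulVec, e1, e2]
  have h3 : p ⬝ᵥ ((A s * S s + S s * (A s)ᵀ + P - S s * Cᵀ * Q⁻¹ * C * S s) *ᵥ p) =
      2 * (p ⬝ᵥ (A s *ᵥ x s)) + p ⬝ᵥ (P *ᵥ p) - (C *ᵥ x s) ⬝ᵥ (Q⁻¹ *ᵥ (C *ᵥ x s)) := by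
    simp only [Matrix.add_mulVec, Matrix.sub_mulVec, ← Matrix.mulVec_mulVec, dotProduct_add,
      dotProduct_sub, e1, e2, hSp, e3]
    ring
  rw [Matrix.neg_mulVec, dotProduct_add, dotProduct_neg, e0, dotProduct_comm p x', h2,
    ← Matrix.mulVec_mulVec, ← Matrix.mulVec_mulVec, ← hp, e0, h3]
  ring

/-- A perturbation that is dominated by the output error is absorbed by the measurement term of
the derivative of the Lyapunov function; the process noise term and `S ≤ σ I` then give
exponential decay.  No lower bound of `S` is needed after the initial time. -/
theorem exp_decay_of_perturbed_filter {p₀ q₀ ν σ : ℝ} (hp₀ : 0 < p₀) (hσ : 0 < σ)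
    (hP : ∀ v : n → ℝ, p₀ * (v ⬝ᵥ v) ≤ v ⬝ᵥ (P *ᵥ v))
    (hQ : ∀ v : m → ℝ, q₀ * (v ⬝ᵥ v) ≤ v ⬝ᵥ (Q⁻¹ *ᵥ v)) (hν : 2 * ν ≤ p₀ * q₀)
    (hpd : ∀ s ∈ Icc 0 t₁, (S s).PosDef)
    (hSσ : ∀ s ∈ Icc 0 t₁, ∀ u : n → ℝ, u ⬝ᵥ (S s *ᵥ u) ≤ σ * (u ⬝ᵥ u))
    (hS : ∀ s ∈ Icc 0 t₁, HasDerivWithinAt S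
      (A s * S s + S s * (A s)ᵀ + P - S s * Cᵀ * Q⁻¹ * C * S s) (Icc 0 t₁) s)
    {x N : ℝ → n → ℝ}
    (hx : ∀ s ∈ Icc 0 t₁, HasDerivWithinAt x
      (A s *ᵥ x s - (S s * Cᵀ * Q⁻¹) *ᵥ (C *ᵥ x s) + N s) (Icc 0 t₁) s)
    (hN : ∀ s ∈ Icc 0 t₁, N s ⬝ᵥ N s ≤ ν * ((C *ᵥ x s) ⬝ᵥ (C *ᵥ x s)))
    {t : ℝ} (ht : t ∈ Icc 0 t₁) :
    x t ⬝ᵥ x t ≤ σ * (frobSq (S 0)⁻¹ + 1) * Real.exp (-(p₀ / (2 * σ)) * t) * (x 0 ⬝ᵥ x 0) := by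
  set κ := p₀ / (2 * σ) with hκ
  set V : ℝ → ℝ := fun s => x s ⬝ᵥ ((S s)⁻¹ *ᵥ x s) with hV
  have hSp : ∀ s ∈ Icc 0 t₁, S s *ᵥ ((S s)⁻¹ *ᵥ x s) = x s := by
    intro s hs
    rw [Matrix.mulVec_mulVec, Matrix.mul_nonsing_inv _
      ((Matrix.isUnit_iff_isUnit_det _).1 (hpd s hs).isUnit), Matrix.one_mulVec]
  have hder := fun s hs => hasDerivWithinAt_lyapunov (hpd s hs) (hS s hs) (hx s hs)
  have hexp : ∀ s, HasDerivAt (fun s => Real.exp (κ * s)) (κ * Real.exp (κ * s)) s := by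
    intro s
    have := ((hasDerivAt_id s).const_mul κ).exp
    simpa [mul_comm] using this
  have hanti : AntitoneOn (fun s => Real.exp (κ * s) * V s) (Icc 0 t₁) := by
    have hd := fun s (hs : s ∈ Icc 0 t₁) => (hexp s).hasDerivWithinAt.mul (hder s hs)
    refine antitoneOn_of_hasDerivWithinAt_nonpos (convex_Icc 0 t₁)
      (fun s hs => (hd s hs).continuousWithinAt)
      (fun s hs => (hd s (interior_subset hs)).mono interior_subset) fun s hs => ?_
    have hs' := interior_subset hs
    set p := (S s)⁻¹ *ᵥ x s with hp
    have h1 := hP p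
    have h2 := hQ (C *ᵥ x s)
    have h3 := hN s hs'
    have h4 : V s ≤ σ * (p ⬝ᵥ p) := by
      have := hSσ s hs' p
      rwa [hp, hSp s hs', dotProduct_comm, ← hp] at this
    have h5 : p₀ * (N s ⬝ᵥ p) * 2 ≤ 2 * (N s ⬝ᵥ N s) + p₀ ^ 2 / 2 * (p ⬝ᵥ p) := by
      have h := dotProduct_self_nonneg_real (N s - (p₀ / 2) • p)
      simp only [sub_dotProduct, dotProduct_sub, smul_dotProduct, dotProduct_smul, smul_eq_mul,
        dotProduct_comm p (N s)] at h
      nlinarith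
    have h6 : κ * V s ≤ p₀ / 2 * (p ⬝ᵥ p) := by
      have : p₀ / 2 * (p ⬝ᵥ p) = κ * (σ * (p ⬝ᵥ p)) := by rw [hκ]; field_simp
      rw [this]
      exact mul_le_mul_of_nonneg_left h4 (by positivity)
    have h7 : 2 * (N s ⬝ᵥ p) ≤ q₀ * ((C *ᵥ x s) ⬝ᵥ (C *ᵥ x s)) + p₀ / 2 * (p ⬝ᵥ p) := by
      have h8 := dotProduct_self_nonneg_real (C *ᵥ x s)
      have h9 := mul_le_mul_of_nonneg_right hν h8
      have h10 : p₀ * (2 * (N s ⬝ᵥ p)) ≤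
          p₀ * (q₀ * ((C *ᵥ x s) ⬝ᵥ (C *ᵥ x s)) + p₀ / 2 * (p ⬝ᵥ p)) := by nlinarith
      exact le_of_mul_le_mul_left h10 hp₀
    have h8 : κ * Real.exp (κ * s) * V s + Real.exp (κ * s) *
        (-(p ⬝ᵥ P *ᵥ p) - C *ᵥ x s ⬝ᵥ Q⁻¹ *ᵥ C *ᵥ x s + 2 * N s ⬝ᵥ p) =
        Real.exp (κ * s) * (κ * V s +
        (-(p ⬝ᵥ P *ᵥ p) - C *ᵥ x s ⬝ᵥ Q⁻¹ *ᵥ C *ᵥ x s + 2 * N s ⬝ᵥ p)) := by ring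
    rw [h8]
    exact mul_nonpos_of_nonneg_of_nonpos (Real.exp_pos _).le (by linarith)
  have h0 : (0 : ℝ) ∈ Icc 0 t₁ := ⟨le_rfl, ht.1.trans ht.2⟩
  have h1 := hanti h0 ht ht.1
  simp only [mul_zero, Real.exp_zero, one_mul] at h1
  have h2 : V 0 ≤ (frobSq (S 0)⁻¹ + 1) * (x 0 ⬝ᵥ x 0) := dotProduct_mulVec_le _ _
  have h3 : x t ⬝ᵥ x t ≤ σ * V t := by
    have := mulVec_self_le_of_posSemidef (hpd t ht).posSemidef (hSσ t ht) ((S t)⁻¹ *ᵥ x t)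
    rwa [hSp t ht, dotProduct_comm ((S t)⁻¹ *ᵥ x t)] at this
  have h4 : V t ≤ Real.exp (-κ * t) * V 0 := by
    have h5 : Real.exp (-κ * t) * Real.exp (κ * t) = 1 := by
      rw [← Real.exp_add]; simp
    calc V t = Real.exp (-κ * t) * (Real.exp (κ * t) * V t) := by rw [← mul_assoc, h5, one_mul]
      _ ≤ _ := mul_le_mul_of_nonneg_left h1 (Real.exp_pos _).le
  calc x t ⬝ᵥ x t ≤ σ * V t := h3
    _ ≤ σ * (Real.exp (-κ * t) * ((frobSq (S 0)⁻¹ + 1) * (x 0 ⬝ᵥ x 0))) := by gcongr; exact h4.trans (by gcongr)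
    _ = _ := by ring

end Lyapunov

/-- A continuous function that starts below `1/2`, and lies below `1/2` at every time up to which
it has stayed below `1`, lies below `1/2`. -/
theorem bootstrap_Icc {f : ℝ → ℝ} {t₁ : ℝ} (hf : ContinuousOn f (Icc 0 t₁)) (h0 : f 0 ≤ 1 / 2)
    (hstep : ∀ t ∈ Icc 0 t₁, (∀ s ∈ Icc 0 t, f s ≤ 1) → f t ≤ 1 / 2) :
    ∀ t ∈ Icc 0 t₁, f t ≤ 1 / 2 := by
  have key : Icc 0 t₁ ⊆ {t | f t ≤ 1 / 2} := by
    by_contra hne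
    obtain ⟨t, ht, hft⟩ := Set.not_subset.1 hne
    -- The first time at which `f` reaches `1`, if there is one, contradicts `hstep`.
    have hall : ∀ s ∈ Icc 0 t₁, f s < 1 := by
      by_contra! hex
      obtain ⟨r, hr, hfr⟩ := hex
      set B := Icc 0 t₁ ∩ f ⁻¹' (Ici 1)
      have hBc : IsCompact B := isCompact_Icc.of_isClosed_subset
        (hf.preimage_isClosed_of_isClosed isClosed_Icc isClosed_Ici) inter_subset_left
      obtain ⟨u, hu, hmin⟩ := hBc.exists_isLeast ⟨r, hr, hfr⟩
      have hlt : ∀ s ∈ Ico 0 u, f s < 1 := by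
        intro s hs
        by_contra! hge
        exact absurd (hmin ⟨⟨hs.1, hs.2.le.trans hu.1.2⟩, hge⟩) (not_le.2 hs.2)
      have hu1 : 1 ≤ f u := hu.2
      have hu0 : 0 < u := by
        rcases hu.1.1.eq_or_lt with h | h
        · rw [← h] at hu1; linarith
        · exact h
      have hle : f u ≤ 1 := by
        have hc : ContinuousWithinAt f (Ico 0 u) u :=
          (hf u hu.1).mono fun s hs => ⟨hs.1, hs.2.le.trans hu.1.2⟩
        have : u ∈ closure (Ico 0 u) := by
          rw [closure_Ico hu0.ne]; exact ⟨hu0.le, le_rfl⟩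
        have hm := hc.mem_closure this (t := Iic 1) fun s hs => (hlt s hs).le
        rwa [isClosed_Iic.closure_eq] at hm
      have := hstep u hu.1 fun s hs => by
        rcases hs.2.eq_or_lt with h | h
        · rw [h]; exact hle
        · exact (hlt s ⟨hs.1, h⟩).le
      linarith
    exact hft (hstep t ht fun s hs => (hall s ⟨hs.1, hs.2.trans ht.2⟩).le)
  exact key

/-! ### Algebra of `SE₂(3)` -/

section Group

theorem mem_SE23_fromBlocks {R : Matrix (Fin 3) (Fin 3) ℝ} {V : Matrix (Fin 3) (Fin 2) ℝ}
    (hR : R * Rᵀ = 1) (hdet : R.det = 1) : fromBlocks R V 0 1 ∈ SE23 :=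
  ⟨R, Matrix.mem_specialOrthogonalGroup_iff.2 ⟨(Matrix.mem_orthogonalGroup_iff _ _).2 hR, hdet⟩, V, rfl⟩

theorem exists_of_mem_SE23 {A : Mat5} (hA : A ∈ SE23) :
    ∃ (R : Matrix (Fin 3) (Fin 3) ℝ) (V : Matrix (Fin 3) (Fin 2) ℝ),
      A = fromBlocks R V 0 1 ∧ R * Rᵀ = 1 ∧ Rᵀ * R = 1 ∧ R.det = 1 := by
  obtain ⟨R, hR, V, rfl⟩ := hA
  have h := Matrix.mem_specialOrthogonalGroup_iff.1 hR
  exact ⟨R, V, rfl, (Matrix.mem_orthogonalGroup_iff _ _).1 h.1, (Matrix.mem_orthogonalGroup_iff' _ _).1 h.1, h.2⟩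

theorem fromBlocks_mul_inv {R : Matrix (Fin 3) (Fin 3) ℝ} (V : Matrix (Fin 3) (Fin 2) ℝ)
    (hR : R * Rᵀ = 1) :
    (fromBlocks R V 0 1 : Mat5) * fromBlocks Rᵀ (-(Rᵀ * V)) 0 1 = 1 := by
  rw [fromBlocks_multiply, ← fromBlocks_one]
  congr 1 <;> simp [hR, ← Matrix.mul_assoc]

theorem inv_fromBlocks_SE23 {R : Matrix (Fin 3) (Fin 3) ℝ} (V : Matrix (Fin 3) (Fin 2) ℝ)
    (hR : R * Rᵀ = 1) :
    (fromBlocks R V 0 1 : Mat5)⁻¹ = fromBlocks Rᵀ (-(Rᵀ * V)) 0 1 :=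
  Matrix.inv_eq_right_inv (fromBlocks_mul_inv V hR)

theorem inv_mem_SE23 {A : Mat5} (hA : A ∈ SE23) : A⁻¹ ∈ SE23 := by
  obtain ⟨R, V, rfl, h1, h2, h3⟩ := exists_of_mem_SE23 hA
  rw [inv_fromBlocks_SE23 V h1]
  exact mem_SE23_fromBlocks (by rw [Matrix.transpose_transpose, h2]) (by rw [det_transpose, h3])

theorem mul_mem_SE23 {A B : Mat5} (hA : A ∈ SE23) (hB : B ∈ SE23) : A * B ∈ SE23 := by
  obtain ⟨R, V, rfl, h1, h2, h3⟩ := exists_of_mem_SE23 hA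
  obtain ⟨R', V', rfl, h1', h2', h3'⟩ := exists_of_mem_SE23 hB
  rw [fromBlocks_multiply]
  simp only [Matrix.mul_zero, add_zero, Matrix.mul_one, Matrix.zero_mul, zero_add]
  refine mem_SE23_fromBlocks ?_ (by rw [det_mul, h3, h3', one_mul])
  rw [Matrix.transpose_mul, Matrix.mul_assoc, ← Matrix.mul_assoc R', h1', Matrix.one_mul, h1]

theorem det_isUnit_of_mem_SE23 {A : Mat5} (hA : A ∈ SE23) : IsUnit A.det := by
  obtain ⟨R, V, rfl, h1, -, -⟩ := exists_of_mem_SE23 hA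
  exact (Matrix.isUnit_iff_isUnit_det _).1 (IsUnit.of_mul_eq_one _ (fromBlocks_mul_inv V h1))

theorem drift_mul_of_mem_SE23 (M : Mat5) {A : Mat5} (hA : A ∈ SE23) : drift M * A = drift M := by
  obtain ⟨R, V, rfl, -⟩ := exists_of_mem_SE23 hA
  rw [drift, fromBlocks_multiply]
  simp

theorem drift_mul {E A : Mat5} (hE : E ∈ SE23) (hA : A ∈ SE23) :
    drift (E * A) = drift E + E * drift A := by
  obtain ⟨R, V, rfl, -⟩ := exists_of_mem_SE23 hE
  obtain ⟨R', V', rfl, -⟩ := exists_of_mem_SE23 hA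
  rw [drift, drift, drift, fromBlocks_multiply, fromBlocks_multiply, fromBlocks_add]
  simp only [Matrix.mul_zero, Matrix.zero_mul, add_zero]
  congr 1
  ext i j
  fin_cases j <;> simp [Matrix.mul_apply, add_comm]

end Group

section LieAlgebra

theorem wedge_add (x y : I9 → ℝ) : wedge (x + y) = wedge x + wedge y := by
  ext i j
  rcases i with i | i <;> rcases j with j | j
  · fin_cases i <;> fin_cases j <;> simp [wedge, skew, rotPart] <;> ring
  · fin_cases j <;> simp [wedge, posPart, velPart]
  · simp [wedge]
  · simp [wedge]

/-- The wedge map as a linear map. -/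
def wedgeₗ : (I9 → ℝ) →ₗ[ℝ] Mat5 where
  toFun := wedge
  map_add' := wedge_add
  map_smul' := wedge_smul

/-- The vee map as a linear map. -/
def veeₗ : Mat5 →ₗ[ℝ] (I9 → ℝ) where
  toFun := vee
  map_add' M N := by
    ext i
    rcases i with i | i | i
    · fin_cases i <;> simp [vee]
    · simp [vee]
    · simp [vee]
  map_smul' s M := by
    ext i
    rcases i with i | i | i
    · fin_cases i <;> simp [vee]
    · simp [vee]
    · simp [vee]

/-- The drift as a linear map. -/
def driftₗ : Mat5 →ₗ[ℝ] Mat5 where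
  toFun := drift
  map_add' M N := by
    ext i j
    rcases i with i | i <;> rcases j with j | j
    · simp [drift]
    · fin_cases j <;> simp [drift]
    · simp [drift]
    · simp [drift]
  map_smul' s M := by
    ext i j
    rcases i with i | i <;> rcases j with j | j
    · simp [drift]
    · fin_cases j <;> simp [drift]
    · simp [drift]
    · simp [drift]

theorem vee_add (M N : Mat5) : vee (M + N) = vee M + vee N := veeₗ.map_add M N
theorem vee_sub (M N : Mat5) : vee (M - N) = vee M - vee N := veeₗ.map_sub M N
theorem vee_neg (M : Mat5) : vee (-M) = -vee M := veeₗ.map_neg M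
theorem vee_smul (s : ℝ) (M : Mat5) : vee (s • M) = s • vee M := veeₗ.map_smul s M
theorem wedge_sub (x y : I9 → ℝ) : wedge (x - y) = wedge x - wedge y := wedgeₗ.map_sub x y
theorem wedge_neg (x : I9 → ℝ) : wedge (-x) = -wedge x := wedgeₗ.map_neg x
theorem wedge_zero : wedge 0 = 0 := wedgeₗ.map_zero
theorem drift_add (M N : Mat5) : drift (M + N) = drift M + drift N := driftₗ.map_add M N

theorem vee_one : vee 1 = 0 := by
  ext i
  rcases i with i | i | i
  · fin_cases i <;> simp [vee]
  · simp [vee]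
  · simp [vee]

theorem drift_one : drift 1 = 0 := by
  ext i j
  rcases i with i | i <;> rcases j with j | j <;> simp [drift]

theorem wedge_vee {M : Mat5} (hM : M ∈ se23) : wedge (vee M) = M := by
  obtain ⟨x, rfl⟩ := hM
  rw [vee_wedge]

theorem wedge_mem (x : I9 → ℝ) : wedge x ∈ se23 := ⟨x, rfl⟩

theorem add_mem_se23 {M N : Mat5} (hM : M ∈ se23) (hN : N ∈ se23) : M + N ∈ se23 := by
  obtain ⟨x, rfl⟩ := hM
  obtain ⟨y, rfl⟩ := hN
  exact ⟨x + y, wedge_add x y⟩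

theorem mem_se23_iff {M : Mat5} : M ∈ se23 ↔
    ∃ (Ω : Matrix (Fin 3) (Fin 3) ℝ) (V : Matrix (Fin 3) (Fin 2) ℝ), Ωᵀ = -Ω ∧
      M = fromBlocks Ω V 0 0 := by
  constructor
  · rintro ⟨x, rfl⟩
    refine ⟨skew (rotPart x), _, ?_, rfl⟩
    ext i j
    fin_cases i <;> fin_cases j <;> simp [skew]
  · rintro ⟨Ω, V, hΩ, rfl⟩
    have h : ∀ i j, Ω j i = -Ω i j := fun i j => congrFun (congrFun hΩ i) j
    refine ⟨vee (fromBlocks Ω V 0 0), ?_⟩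
    ext i j
    rcases i with i | i <;> rcases j with j | j
    · have h00 := h 0 0
      have h11 := h 1 1
      have h22 := h 2 2
      have h01 := h 0 1
      have h02 := h 0 2
      have h12 := h 1 2
      fin_cases i <;> fin_cases j <;> simp [wedge, skew, rotPart, vee] <;> linarith
    · fin_cases j <;> simp [wedge, posPart, velPart, vee]
    · simp [wedge]
    · simp [wedge]

theorem neg_mem_se23 {M : Mat5} (hM : M ∈ se23) : -M ∈ se23 := by
  obtain ⟨x, rfl⟩ := hM
  exact ⟨-x, wedge_neg x⟩

theorem sub_mem_se23 {M N : Mat5} (hM : M ∈ se23) (hN : N ∈ se23) : M - N ∈ se23 := by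
  rw [sub_eq_add_neg]
  exact add_mem_se23 hM (neg_mem_se23 hN)

theorem ad_mem_se23 {M N : Mat5} (hM : M ∈ se23) (hN : N ∈ se23) : ad M N ∈ se23 := by
  obtain ⟨Ω, V, h, rfl⟩ := mem_se23_iff.1 hM
  obtain ⟨Ω', V', h', rfl⟩ := mem_se23_iff.1 hN
  refine mem_se23_iff.2 ⟨Ω * Ω' - Ω' * Ω, Ω * V' - Ω' * V, ?_, ?_⟩
  · simp [Matrix.transpose_sub, Matrix.transpose_mul, h, h']
  · rw [ad, fromBlocks_multiply, fromBlocks_multiply, sub_eq_add_neg, fromBlocks_neg,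
      fromBlocks_add]
    simp [sub_eq_add_neg]

theorem Ad_mem_se23 {A M : Mat5} (hA : A ∈ SE23) (hM : M ∈ se23) : Ad A M ∈ se23 := by
  obtain ⟨Ω, V, h, rfl⟩ := mem_se23_iff.1 hM
  obtain ⟨R, W, rfl, h1, -⟩ := exists_of_mem_SE23 hA
  refine mem_se23_iff.2 ⟨R * Ω * Rᵀ, R * Ω * (-(Rᵀ * W)) + R * V, ?_, ?_⟩
  · simp [Matrix.transpose_mul, h, Matrix.mul_assoc]
  · rw [Ad, inv_fromBlocks_SE23 W h1, fromBlocks_multiply, fromBlocks_multiply]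
    simp

theorem drift_mem_se23 (M : Mat5) : drift M ∈ se23 :=
  mem_se23_iff.2 ⟨0, _, by simp, rfl⟩

theorem gravity_mem_se23 (g : Fin 3 → ℝ) : gravity g ∈ se23 := ⟨_, rfl⟩

theorem gravity_eq (g : Fin 3 → ℝ) :
    gravity g = fromBlocks 0 (Matrix.of fun i j => if j = 0 then 0 else g i) 0 0 := by
  ext i j
  rcases i with i | i <;> rcases j with j | j
  · fin_cases i <;> fin_cases j <;> simp [gravity, wedge, skew, rotPart]
  · fin_cases j <;> simp [gravity, wedge, posPart, velPart]
  · simp [gravity, wedge]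
  · simp [gravity, wedge]

theorem upsilon_mulVec (g ω ν a : Fin 3 → ℝ) :
    upsilon g *ᵥ Sum.elim ω (Sum.elim ν a) = Sum.elim (0 : Fin 3 → ℝ) (Sum.elim a (skew g *ᵥ ω)) := by
  rw [upsilon, fromBlocks_mulVec, Sum.elim_comp_inl, Sum.elim_comp_inr, fromBlocks_mulVec,
    fromRows_mulVec, Sum.elim_comp_inl, Sum.elim_comp_inr]
  ext i
  rcases i with i | i | i <;> simp

/-- The drift and the gravity terms of the pose error are linear in the error; their linear part
at the identity is the matrix `Υ`. -/
theorem vee_drift_gravity_wedge (g : Fin 3 → ℝ) (x : I9 → ℝ) :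
    vee (drift (wedge x) + gravity g * wedge x - wedge x * gravity g) = upsilon g *ᵥ x := by
  have hx : x = Sum.elim (rotPart x) (Sum.elim (posPart x) (velPart x)) := by
    ext i; rcases i with i | i | i <;> rfl
  conv_rhs => rw [hx]
  rw [upsilon_mulVec, gravity_eq, wedge, drift, fromBlocks_multiply, fromBlocks_multiply]
  ext i
  rcases i with i | i | i
  · fin_cases i <;> simp [vee]
  · simp [vee, Matrix.mul_apply]
  · fin_cases i <;> simp [vee, skew, Matrix.vecHead, Matrix.vecTail] <;> ring

theorem adMatrix_mulVec (U : Mat5) (z : I9 → ℝ) : adMatrix U *ᵥ z = vee (ad U (wedge z)) := by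
  let F : (I9 → ℝ) →ₗ[ℝ] (I9 → ℝ) :=
    { toFun := fun z => vee (ad U (wedge z))
      map_add' := fun x y => by
        rw [← vee_add, wedge_add]; congr 1; simp only [ad]; noncomm_ring
      map_smul' := fun s x => by
        rw [RingHom.id_apply, ← vee_smul, wedge_smul]
        simp only [ad, Matrix.mul_smul, Matrix.smul_mul, smul_sub] }
  have h : adMatrix U = LinearMap.toMatrix' F := by
    ext i j
    rw [LinearMap.toMatrix'_apply]
    rfl
  rw [h, LinearMap.toMatrix'_mulVec]
  rfl

end LieAlgebra

/-! ### The error dynamics -/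

section ErrorDynamics

theorem stateError_eq {A : Mat5} (hA : IsUnit A.det) (a T b : Mat5) :
    stateError (A, a) (T, b) = (T * A⁻¹, Ad A b + a) := by
  simp only [stateError, phi, sdInv, Ad, Matrix.nonsing_inv_nonsing_inv _ hA, sub_neg_eq_add]
  congr 1
  rw [Matrix.mul_add, Matrix.add_mul]
  congr 1
  have h1 : A * A⁻¹ = 1 := Matrix.mul_nonsing_inv _ hA
  calc A * (A⁻¹ * a * A) * A⁻¹ = (A * A⁻¹) * a * (A * A⁻¹) := by noncomm_ring
    _ = a := by rw [h1, Matrix.one_mul, Matrix.mul_one]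

/-- The velocity `Ad_A w + a + g + f(A)` of the observer in the fixed frame, without innovation. -/
def frameVelocity (g : Fin 3 → ℝ) (w : I9 → ℝ) (X : Mat5 × Mat5) : Mat5 :=
  Ad X.1 (wedge w) + X.2 + gravity g + drift X.1

theorem psi_add_gravity {X : Mat5 × Mat5} (hX : IsUnit X.1.det) (g : Fin 3 → ℝ) (w : I9 → ℝ) :
    psi₁ (sdInv X) (wedge w) + gravity g = frameVelocity g w X := by
  have h1 : X.1 * X.1⁻¹ = 1 := Matrix.mul_nonsing_inv _ hX
  have h2 : X.1 * (X.1⁻¹ * X.2 * X.1) * X.1⁻¹ = X.2 := by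
    calc X.1 * (X.1⁻¹ * X.2 * X.1) * X.1⁻¹ = (X.1 * X.1⁻¹) * X.2 * (X.1 * X.1⁻¹) := by
          noncomm_ring
      _ = X.2 := by rw [h1, Matrix.one_mul, Matrix.mul_one]
  simp only [psi₁, sdInv, Ad, Matrix.nonsing_inv_nonsing_inv _ hX, sub_neg_eq_add, frameVelocity,
    Matrix.mul_add, Matrix.add_mul, h2]
  abel

theorem frameVelocity_mem_se23 {X : Mat5 × Mat5} (h1 : X.1 ∈ SE23) (h2 : X.2 ∈ se23)
    (g : Fin 3 → ℝ) (w : I9 → ℝ) : frameVelocity g w X ∈ se23 :=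
  add_mem_se23 (add_mem_se23 (add_mem_se23 (Ad_mem_se23 h1 (wedge_mem w)) h2)
    (gravity_mem_se23 g)) (drift_mem_se23 _)

variable {g : Fin 3 → ℝ} {w : I9 → ℝ} {J : Set ℝ} {t : ℝ} {T A b a : ℝ → Mat5}

/-- The pose error `E = T A⁻¹` obeys an equation that involves the trajectory only through the
bias error `Ad_A b + a`. -/
theorem hasDerivWithinAt_poseError {D : Mat5} (hT : T t ∈ SE23) (hA : A t ∈ SE23)
    (hT' : HasDerivWithinAt T
      (drift (T t) * T t + T t * (wedge w - b t) + gravity g * T t) J t)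
    (hA' : HasDerivWithinAt A
      (A t * (wedge w + Ad (A t)⁻¹ (a t)) + gravity g * A t + drift (A t) + D * A t) J t) :
    HasDerivWithinAt (fun s => T s * (A s)⁻¹)
      (drift (T t * (A t)⁻¹) - T t * (A t)⁻¹ * (Ad (A t) (b t) + a t)
        + gravity g * (T t * (A t)⁻¹) - T t * (A t)⁻¹ * gravity g - T t * (A t)⁻¹ * D) J t := by
  have hu := det_isUnit_of_mem_SE23 hA
  have h1 := hasDerivWithinAt_mul_matrix hT'
    (hasDerivWithinAt_inv_matrix hA' ((Matrix.isUnit_iff_isUnit_det _).2 hu))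
  refine hasDerivWithinAt_congr_deriv_matrix h1 ?_
  have hinv := inv_mem_SE23 hA
  have hE := mul_mem_SE23 hT hinv
  have hBA : (A t)⁻¹ * A t = 1 := Matrix.nonsing_inv_mul _ hu
  have hAB : A t * (A t)⁻¹ = 1 := Matrix.mul_nonsing_inv _ hu
  have hTE : T t * (A t)⁻¹ * A t = T t := by rw [Matrix.mul_assoc, hBA, Matrix.mul_one]
  have e1 : drift (T t) = drift (T t * (A t)⁻¹) + T t * (A t)⁻¹ * drift (A t) := by
    conv_lhs => rw [← hTE]
    exact drift_mul hE hA
  have e2 : drift (T t) * T t * (A t)⁻¹ = drift (T t) := by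
    rw [Matrix.mul_assoc, drift_mul_of_mem_SE23 _ hE]
  have e3 : drift (A t) * (A t)⁻¹ = drift (A t) := drift_mul_of_mem_SE23 _ hinv
  have e4 : drift (T t * (A t)⁻¹) = drift (T t) - T t * (A t)⁻¹ * drift (A t) := by
    rw [e1]; abel
  have e5 : Ad (A t)⁻¹ (a t) = (A t)⁻¹ * a t * A t := by
    rw [Ad, Matrix.nonsing_inv_nonsing_inv _ hu]
  have e9 : Ad (A t) (b t) = A t * b t * (A t)⁻¹ := rfl
  set B := (A t)⁻¹
  have e6 : (A t * (wedge w + B * a t * A t) + gravity g * A t + drift (A t) + D * A t) * B =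
      A t * wedge w * B + a t + gravity g + drift (A t) + D := by
    calc _ = A t * wedge w * B + (A t * B) * a t * (A t * B) + gravity g * (A t * B) +
          drift (A t) * B + D * (A t * B) := by noncomm_ring
      _ = _ := by rw [hAB, e3]; simp
  have e7 : T t * B * (A t * wedge w * B) = T t * wedge w * B := by
    calc _ = T t * (B * A t) * wedge w * B := by noncomm_ring
      _ = _ := by rw [hBA, Matrix.mul_one]
  have e8 : T t * B * (A t * b t * B) = T t * b t * B := by
    calc _ = T t * (B * A t) * b t * B := by noncomm_ring
      _ = _ := by rw [hBA, Matrix.mul_one]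
  rw [e4, e5, e9, Matrix.mul_assoc B, e6, Matrix.add_mul, Matrix.add_mul, e2]
  simp only [← Matrix.mul_assoc] at e7 e8
  simp only [Matrix.mul_add, Matrix.mul_neg, Matrix.mul_sub, Matrix.sub_mul, ← Matrix.mul_assoc,
    e7, e8]
  abel

/-- The bias error `Ad_A b + a` obeys a linear equation driven by the innovation. -/
theorem hasDerivWithinAt_biasError {τ : I9 → ℝ} {D D₂ : Mat5} (hA : A t ∈ SE23)
    (hb : HasDerivWithinAt b (wedge τ) J t)
    (hA' : HasDerivWithinAt A
      (A t * (wedge w + Ad (A t)⁻¹ (a t)) + gravity g * A t + drift (A t) + D * A t) J t)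
    (ha' : HasDerivWithinAt a
      (ad (-a t) ((Ad (A t) (wedge w) + a t) + gravity g + drift (A t)) - Ad (A t) (wedge τ) + D₂
        + ad D (a t)) J t) :
    HasDerivWithinAt (fun s => Ad (A s) (b s) + a s)
      (ad (frameVelocity g w (A t, a t) + D) (Ad (A t) (b t) + a t) + D₂) J t := by
  have hu := det_isUnit_of_mem_SE23 hA
  have h1 := hasDerivWithinAt_add_matrix (hasDerivWithinAt_mul_matrix
    (hasDerivWithinAt_mul_matrix hA' hb)
    (hasDerivWithinAt_inv_matrix hA' ((Matrix.isUnit_iff_isUnit_det _).2 hu))) ha'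
  refine hasDerivWithinAt_congr_deriv_matrix h1 ?_
  have hinv := inv_mem_SE23 hA
  have hAB : A t * (A t)⁻¹ = 1 := Matrix.mul_nonsing_inv _ hu
  have e3 : drift (A t) * (A t)⁻¹ = drift (A t) := drift_mul_of_mem_SE23 _ hinv
  have hBA : (A t)⁻¹ * A t = 1 := Matrix.nonsing_inv_mul _ hu
  have e5 : Ad (A t)⁻¹ (a t) = (A t)⁻¹ * a t * A t := by
    rw [Ad, Matrix.nonsing_inv_nonsing_inv _ hu]
  have e3' : drift (A t) * A t = drift (A t) := drift_mul_of_mem_SE23 _ hA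
  rw [e5]
  simp only [Ad, frameVelocity]
  set B := (A t)⁻¹
  set Y := A t * wedge w * B + a t + gravity g + drift (A t) + D with hY
  have e6 : A t * (wedge w + B * a t * A t) + gravity g * A t + drift (A t) + D * A t =
      Y * A t := by
    calc _ = A t * wedge w + (A t * B) * a t * A t + gravity g * A t + drift (A t) + D * A t := by
          noncomm_ring
      _ = A t * wedge w * (B * A t) + a t * A t + gravity g * A t + drift (A t) * A t
          + D * A t := by rw [hAB, hBA, e3']; simp
      _ = _ := by rw [hY]; noncomm_ring
  have e7 : (A t * b t) * -(B * (Y * A t) * B) = -(A t * b t * B * Y) := by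
    calc _ = -(A t * b t * B * Y * (A t * B)) := by noncomm_ring
      _ = _ := by rw [hAB, Matrix.mul_one]
  rw [e6, e7]
  have e8 : A t * wedge w * B = Y - a t - gravity g - drift (A t) - D := by rw [hY]; abel
  rw [e8]
  simp only [ad]
  noncomm_ring

/-- Conversely, the equation of the pose error implies the group equation of the observer. -/
theorem hasDerivWithinAt_of_poseError {E : ℝ → Mat5} {D : Mat5} (hT : T t ∈ SE23)
    (hE : E t ∈ SE23)
    (hA : ∀ s, A s = (E s)⁻¹ * T s)
    (hT' : HasDerivWithinAt T
      (drift (T t) * T t + T t * (wedge w - b t) + gravity g * T t) J t)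
    (hE' : HasDerivWithinAt E
      (drift (E t) - E t * (Ad (A t) (b t) + a t) + gravity g * E t - E t * gravity g - E t * D)
      J t) :
    HasDerivWithinAt A
      (A t * (wedge w + Ad (A t)⁻¹ (a t)) + gravity g * A t + drift (A t) + D * A t) J t := by
  have hA' : A = fun s => (E s)⁻¹ * T s := funext hA
  have hAt : A t ∈ SE23 := by rw [hA]; exact mul_mem_SE23 (inv_mem_SE23 hE) hT
  have huA := det_isUnit_of_mem_SE23 hAt
  have hu := det_isUnit_of_mem_SE23 hE
  have h1 := hasDerivWithinAt_mul_matrix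
    (hasDerivWithinAt_inv_matrix hE' ((Matrix.isUnit_iff_isUnit_det _).2 hu)) hT'
  rw [← hA'] at h1
  refine hasDerivWithinAt_congr_deriv_matrix h1 ?_
  have hFE : (E t)⁻¹ * E t = 1 := Matrix.nonsing_inv_mul _ hu
  have hEF : E t * (E t)⁻¹ = 1 := Matrix.mul_nonsing_inv _ hu
  have hTE : T t = E t * A t := by rw [hA, ← Matrix.mul_assoc, hEF, Matrix.one_mul]
  have hAB : A t * (A t)⁻¹ = 1 := Matrix.mul_nonsing_inv _ huA
  have hBA : (A t)⁻¹ * A t = 1 := Matrix.nonsing_inv_mul _ huA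
  have e1 : drift (T t) * T t = drift (E t) * A t + E t * drift (A t) := by
    rw [drift_mul_of_mem_SE23 _ hT, hTE, drift_mul hE hAt, drift_mul_of_mem_SE23 _ hAt]
  have e5 : Ad (A t)⁻¹ (a t) = (A t)⁻¹ * a t * A t := by
    rw [Ad, Matrix.nonsing_inv_nonsing_inv _ huA]
  rw [e1, e5, hTE, Ad]
  have hFT : ∀ M : Mat5, (E t)⁻¹ * (E t * M) = M := fun M => by
    rw [← Matrix.mul_assoc, hFE, Matrix.one_mul]
  have hFT' : ∀ M : Mat5, A t * ((A t)⁻¹ * M) = M := fun M => by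
    rw [← Matrix.mul_assoc, hAB, Matrix.one_mul]
  simp only [Matrix.mul_add, Matrix.add_mul, Matrix.mul_sub, Matrix.sub_mul,
    Matrix.mul_assoc, hFT, hFT', hBA, Matrix.mul_one, neg_sub]
  abel

/-- Conversely, the equation of the bias error implies the bias equation of the observer. -/
theorem hasDerivWithinAt_of_biasError {e₂ : ℝ → Mat5} {τ : I9 → ℝ} {D D₂ : Mat5}
    (hA : A t ∈ SE23) (ha : ∀ s, a s = e₂ s - Ad (A s) (b s))
    (hb : HasDerivWithinAt b (wedge τ) J t)
    (hA' : HasDerivWithinAt A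
      (A t * (wedge w + Ad (A t)⁻¹ (a t)) + gravity g * A t + drift (A t) + D * A t) J t)
    (he₂ : HasDerivWithinAt e₂
      (ad (frameVelocity g w (A t, a t) + D) (Ad (A t) (b t) + a t) + D₂) J t) :
    HasDerivWithinAt a
      (ad (-a t) ((Ad (A t) (wedge w) + a t) + gravity g + drift (A t)) - Ad (A t) (wedge τ) + D₂
        + ad D (a t)) J t := by
  have hu := det_isUnit_of_mem_SE23 hA
  have h1 := hasDerivWithinAt_sub_matrix he₂ (hasDerivWithinAt_mul_matrix
    (hasDerivWithinAt_mul_matrix hA' hb)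
    (hasDerivWithinAt_inv_matrix hA' ((Matrix.isUnit_iff_isUnit_det _).2 hu)))
  have ha2 : a = fun s => e₂ s - A s * b s * (A s)⁻¹ := funext ha
  rw [← ha2] at h1
  refine hasDerivWithinAt_congr_deriv_matrix h1 ?_
  have hinv := inv_mem_SE23 hA
  have hAB : A t * (A t)⁻¹ = 1 := Matrix.mul_nonsing_inv _ hu
  have hBA : (A t)⁻¹ * A t = 1 := Matrix.nonsing_inv_mul _ hu
  have e5 : Ad (A t)⁻¹ (a t) = (A t)⁻¹ * a t * A t := by
    rw [Ad, Matrix.nonsing_inv_nonsing_inv _ hu]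
  have e3' : drift (A t) * A t = drift (A t) := drift_mul_of_mem_SE23 _ hA
  rw [e5]
  simp only [Ad, frameVelocity]
  set B := (A t)⁻¹
  set Y := A t * wedge w * B + a t + gravity g + drift (A t) + D with hY
  have e6 : A t * (wedge w + B * a t * A t) + gravity g * A t + drift (A t) + D * A t =
      Y * A t := by
    calc _ = A t * wedge w + (A t * B) * a t * A t + gravity g * A t + drift (A t) + D * A t := by
          noncomm_ring
      _ = A t * wedge w * (B * A t) + a t * A t + gravity g * A t + drift (A t) * A t
          + D * A t := by rw [hAB, hBA, e3']; simp
      _ = _ := by rw [hY]; noncomm_ring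
  have e7 : (A t * b t) * -(B * (Y * A t) * B) = -(A t * b t * B * Y) := by
    calc _ = -(A t * b t * B * Y * (A t * B)) := by noncomm_ring
      _ = _ := by rw [hAB, Matrix.mul_one]
  rw [e6, e7]
  have e8 : A t * wedge w * B = Y - a t - gravity g - drift (A t) - D := by rw [hY]; abel
  rw [e8]
  simp only [ad]
  noncomm_ring

end ErrorDynamics

/-! ### Rodrigues' formula -/

section Rodrigues

/-- The coefficient `(1 - cos θ) / θ²` of the square in Rodrigues' formula; it is `0` for `θ = 0`,
where the square vanishes. -/
def rodriguesA (θ : ℝ) : ℝ := (1 - Real.cos θ) / θ ^ 2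

/-- The coefficient `(θ - sin θ) / θ³` of the cube in Rodrigues' formula; it is `0` for `θ = 0`,
where the cube vanishes. -/
def rodriguesB (θ : ℝ) : ℝ := (θ - Real.sin θ) / θ ^ 3

theorem abs_rodriguesA_le {θ : ℝ} (hθ : 0 ≤ θ) : |rodriguesA θ| ≤ 1 / 2 := by
  rcases hθ.eq_or_lt with h | h
  · simp [rodriguesA, ← h]
  · have h1 := Real.one_sub_sq_div_two_le_cos (x := θ)
    have h2 := Real.cos_le_one θ
    rw [rodriguesA, abs_of_nonneg (div_nonneg (by linarith) (by positivity)),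
      div_le_iff₀ (by positivity)]
    linarith

theorem abs_rodriguesB_le {θ : ℝ} (hθ : 0 ≤ θ) : |rodriguesB θ| ≤ 1 / 2 := by
  rcases hθ.eq_or_lt with h | h
  · simp [rodriguesB, ← h]
  · have h1 := Real.sin_gt_sub_cube h
    have h2 := Real.sin_le h.le
    have h3 : 0 < θ ^ 3 := by positivity
    rw [rodriguesB, abs_of_nonneg (div_nonneg (by linarith) (by positivity)),
      div_le_iff₀ (by positivity)]
    linarith

variable {𝔸 : Type*} [NormedRing 𝔸] [NormedAlgebra ℝ 𝔸] [CompleteSpace 𝔸]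

/-- The exponential is characterized by its differential equation. -/
theorem exp_eq_of_hasDerivAt {X : 𝔸} {G : ℝ → 𝔸} (hG : ∀ t, HasDerivAt G (X * G t) t)
    (h0 : G 0 = 1) : NormedSpace.exp X = G 1 := by
  have h1 : ∀ t : ℝ, HasDerivAt (fun t : ℝ => NormedSpace.exp (t • -X) * G t) 0 t := by
    intro t
    have h2 := hasDerivAt_exp_smul_const (𝕂 := ℝ) (-X) t
    refine (h2.mul (hG t)).congr_deriv ?_
    noncomm_ring
  have h3 := is_const_of_deriv_eq_zero (fun t => (h1 t).differentiableAt)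
    (fun t => (h1 t).deriv) 1 0
  simp only [one_smul, zero_smul, NormedSpace.exp_zero, h0, mul_one] at h3
  have h4 : NormedSpace.exp X * NormedSpace.exp (-X) = 1 := by
    let _ : NormedAlgebra ℚ 𝔸 := NormedAlgebra.restrictScalars ℚ ℝ 𝔸
    rw [← NormedSpace.exp_add_of_commute ((Commute.refl X).neg_right), add_neg_cancel,
      NormedSpace.exp_zero]
  calc NormedSpace.exp X = NormedSpace.exp X * (NormedSpace.exp (-X) * G 1) := by
        rw [h3, mul_one]
    _ = G 1 := by rw [← mul_assoc, h4, one_mul]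

/-- The exponential of an element with `X⁴ = -θ² X²`.  The matrices `ω^∧` and `(ω, ν, a)^∧` are of
this kind with `θ = |ω|`. -/
theorem exp_eq_rodrigues {X : 𝔸} {θ : ℝ} (h4 : X * X * X * X = -(θ ^ 2) • (X * X))
    (h0 : θ = 0 → X * X = 0) :
    NormedSpace.exp X = 1 + X + rodriguesA θ • (X * X) + rodriguesB θ • (X * X * X) := by
  rcases eq_or_ne θ 0 with h | h
  · have hX := h0 h
    rw [hX, zero_mul, smul_zero, smul_zero, add_zero, add_zero]
    have h1 := exp_eq_of_hasDerivAt (X := X) (G := fun t : ℝ => 1 + t • X) (fun t => ?_) (by simp)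
    · simpa using h1
    · refine (((hasDerivAt_id t).smul_const X).const_add 1).congr_deriv ?_
      rw [mul_add, mul_smul_comm, hX]
      simp
  · have h1 := exp_eq_of_hasDerivAt (X := X)
      (G := fun t : ℝ => 1 + t • X + ((1 - Real.cos (θ * t)) / θ ^ 2) • (X * X) +
        ((θ * t - Real.sin (θ * t)) / θ ^ 3) • (X * X * X)) (fun t => ?_) (by simp)
    · simpa [rodriguesA, rodriguesB] using h1
    · have hθ : HasDerivAt (fun t : ℝ => θ * t) θ t := by
        simpa using (hasDerivAt_id t).const_mul θ
      have d1 := (((hasDerivAt_id t).smul_const X).const_add 1)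
      have d2 := ((((hθ.cos).const_sub 1).div_const (θ ^ 2)).smul_const (X * X))
      have d3 := (((hθ.sub hθ.sin).div_const (θ ^ 3)).smul_const (X * X * X))
      refine ((d1.add d2).add d3).congr_deriv ?_
      have e4 : X * (X * X * X) = -(θ ^ 2) • (X * X) := by rw [← h4]; noncomm_ring
      rw [mul_add, mul_add, mul_add, mul_smul_comm, mul_smul_comm, mul_smul_comm, e4, smul_smul,
        mul_one, one_smul, ← mul_assoc X X X]
      have e5 : (θ * t - Real.sin (θ * t)) / θ ^ 3 * -(θ ^ 2) =
          -(-Real.sin (θ * t) * θ) / θ ^ 2 - t := by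
        field_simp
        ring
      have e6 : (1 - Real.cos (θ * t)) / θ ^ 2 = (θ - Real.cos (θ * t) * θ) / θ ^ 3 := by
        field_simp
      rw [e5, e6, sub_smul]
      abel

end Rodrigues

/-! ### The principal logarithm near the identity -/

section LocalLog

attribute [local instance] Matrix.linftyOpNormedRing Matrix.linftyOpNormedAlgebra

theorem abs_entry_le_norm {n : Type*} [Fintype n] [DecidableEq n] (M : Matrix n n ℝ) (i j : n) :
    |M i j| ≤ ‖M‖ := by
  rw [Matrix.linfty_opNorm_def]
  have h1 : ‖M i j‖₊ ≤ ∑ k, ‖M i k‖₊ :=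
    Finset.single_le_sum (f := fun k => ‖M i k‖₊) (fun _ _ => zero_le) (Finset.mem_univ j)
  have h2 : ∑ k, ‖M i k‖₊ ≤ Finset.univ.sup fun i => ∑ k, ‖M i k‖₊ :=
    Finset.le_sup (f := fun i => ∑ k, ‖M i k‖₊) (Finset.mem_univ i)
  exact_mod_cast h1.trans h2

theorem norm_le_of_row_sum_le {n : Type*} [Fintype n] [DecidableEq n] {M : Matrix n n ℝ} {c : ℝ}
    (hc : 0 ≤ c) (h : ∀ i, ∑ j, |M i j| ≤ c) : ‖M‖ ≤ c := by
  lift c to NNReal using hc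
  rw [Matrix.linfty_opNorm_def, NNReal.coe_le_coe]
  refine Finset.sup_le fun i _ => ?_
  have := h i
  rw [← NNReal.coe_le_coe]
  push_cast
  exact this

theorem norm_vee_le (M : Mat5) : ‖vee M‖ ≤ ‖M‖ := by
  refine (pi_norm_le_iff_of_nonneg (norm_nonneg M)).2 fun i => ?_
  rcases i with i | i | i
  · fin_cases i <;> simpa [vee] using abs_entry_le_norm M _ _
  · simpa [vee] using abs_entry_le_norm M _ _
  · simpa [vee] using abs_entry_le_norm M _ _

theorem abs_apply_le_norm (x : I9 → ℝ) (i : I9) : |x i| ≤ ‖x‖ := norm_le_pi_norm x i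

theorem norm_wedge_le (x : I9 → ℝ) : ‖wedge x‖ ≤ 4 * ‖x‖ := by
  have h0 := norm_nonneg x
  refine norm_le_of_row_sum_le (by positivity) fun i => ?_
  have h := abs_apply_le_norm x
  rcases i with i | i
  · have h1 := h (Sum.inl 0)
    have h2 := h (Sum.inl 1)
    have h3 := h (Sum.inl 2)
    have h4 := h (Sum.inr (Sum.inl i))
    have h5 := h (Sum.inr (Sum.inr i))
    fin_cases i <;>
      simp [wedge, skew, rotPart, posPart, velPart, Fin.sum_univ_three, Fin.sum_univ_two] at * <;>
      linarith
  · simp [wedge]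

theorem norm_drift_le (M : Mat5) : ‖drift M‖ ≤ ‖M‖ := by
  refine norm_le_of_row_sum_le (norm_nonneg M) fun i => ?_
  rcases i with i | i
  · simpa [drift] using abs_entry_le_norm M (Sum.inl i) (Sum.inr 1)
  · simp [drift]

end LocalLog

section LocalLog

attribute [local instance] Matrix.linftyOpNormedRing Matrix.linftyOpNormedAlgebra

theorem skew_cube (ω : Fin 3 → ℝ) :
    skew ω * skew ω * skew ω = -(euclNorm ω ^ 2) • skew ω := by
  rw [euclNorm_sq]
  ext i j
  fin_cases i <;> fin_cases j <;>
    simp [skew, Matrix.mul_apply, Fin.sum_univ_three, dotProduct] <;> ring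

theorem skew_transpose (ω : Fin 3 → ℝ) : (skew ω)ᵀ = -skew ω := by
  ext i j
  fin_cases i <;> fin_cases j <;> simp [skew]

theorem skew_eq_zero {ω : Fin 3 → ℝ} (h : euclNorm ω = 0) : skew ω = 0 := by
  have h1 : ω ⬝ᵥ ω = 0 := by rw [← euclNorm_sq, h]; simp
  have h2 : ω = 0 := dotProduct_self_eq_zero.1 h1
  ext i j
  fin_cases i <;> fin_cases j <;> simp [skew, h2]

/-- The rotational part of a twist, as a block matrix. -/
def rotBlock (x : I9 → ℝ) : Mat5 := fromBlocks (skew (rotPart x)) 0 0 0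

theorem wedge_mul_wedge (x : I9 → ℝ) : wedge x * wedge x = rotBlock x * wedge x := by
  simp only [wedge, rotBlock, fromBlocks_multiply]
  simp

theorem rotBlock_cube (x : I9 → ℝ) :
    rotBlock x * rotBlock x * rotBlock x = -(euclNorm (rotPart x) ^ 2) • rotBlock x := by
  simp only [rotBlock, fromBlocks_multiply, fromBlocks_smul]
  simp [skew_cube]

theorem wedge_pow_four (x : I9 → ℝ) : wedge x * wedge x * wedge x * wedge x =
    -(euclNorm (rotPart x) ^ 2) • (wedge x * wedge x) := by
  have h := wedge_mul_wedge x
  calc _ = rotBlock x * rotBlock x * rotBlock x * wedge x := by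
        rw [h, Matrix.mul_assoc (rotBlock x), h, ← Matrix.mul_assoc, Matrix.mul_assoc _ (wedge x), h,
          ← Matrix.mul_assoc]
    _ = _ := by rw [rotBlock_cube, Matrix.smul_mul, h]

theorem exp_wedge (x : I9 → ℝ) : NormedSpace.exp (wedge x) = 1 + wedge x +
    rodriguesA (euclNorm (rotPart x)) • (wedge x * wedge x) +
    rodriguesB (euclNorm (rotPart x)) • (wedge x * wedge x * wedge x) := by
  refine exp_eq_rodrigues (wedge_pow_four x) fun h => ?_
  rw [wedge_mul_wedge, rotBlock, skew_eq_zero h, fromBlocks_zero, Matrix.zero_mul]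

theorem exp_skew (ω : Fin 3 → ℝ) : NormedSpace.exp (skew ω) = 1 + skew ω +
    rodriguesA (euclNorm ω) • (skew ω * skew ω) +
    rodriguesB (euclNorm ω) • (skew ω * skew ω * skew ω) := by
  refine exp_eq_rodrigues ?_ fun h => by rw [skew_eq_zero h, Matrix.zero_mul]
  rw [skew_cube, Matrix.smul_mul]

theorem exp_wedge_eq_fromBlocks (x : I9 → ℝ) : ∃ V : Matrix (Fin 3) (Fin 2) ℝ,
    NormedSpace.exp (wedge x) = fromBlocks (NormedSpace.exp (skew (rotPart x))) V 0 1 := by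
  refine ⟨(NormedSpace.exp (wedge x)).toBlocks₁₂, ?_⟩
  rw [exp_wedge, exp_skew]
  simp only [wedge, ← fromBlocks_one, fromBlocks_multiply, fromBlocks_smul, fromBlocks_add,
    toBlocks_fromBlocks₁₂]
  simp

/-- The rotation block of an exponential is orthogonal, and its determinant is positive because it
is the square of the determinant of the exponential of half the matrix. -/
theorem exp_wedge_mem_SE23 (x : I9 → ℝ) : NormedSpace.exp (wedge x) ∈ SE23 := by
  obtain ⟨V, hV⟩ := exp_wedge_eq_fromBlocks x
  rw [hV]
  set Ω := skew (rotPart x)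
  have hR : NormedSpace.exp Ω * (NormedSpace.exp Ω)ᵀ = 1 := by
    rw [← Matrix.exp_transpose, skew_transpose, Matrix.exp_neg]
    exact Matrix.mul_nonsing_inv _ ((Matrix.isUnit_iff_isUnit_det _).1 (Matrix.isUnit_exp _))
  refine mem_SE23_fromBlocks hR ?_
  have h1 : (NormedSpace.exp Ω).det ^ 2 = 1 := by
    have := congrArg Matrix.det hR
    rwa [Matrix.det_mul, Matrix.det_transpose, ← sq, Matrix.det_one] at this
  -- The exponential is a square, so its determinant is nonnegative.
  have h2 : 0 ≤ (NormedSpace.exp Ω).det := by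
    have h3 : Ω = 2 • ((1 / 2 : ℝ) • Ω) := by
      rw [two_smul, ← add_smul]; norm_num
    rw [h3, Matrix.exp_nsmul, Matrix.det_pow]
    exact sq_nonneg _
  nlinarith

theorem trace_exp_wedge (x : I9 → ℝ) : (NormedSpace.exp (wedge x)).trace =
    3 + 2 * Real.cos (euclNorm (rotPart x)) := by
  set θ := euclNorm (rotPart x) with hθ
  have h1 : (wedge x).trace = 0 := by
    simp [wedge, Matrix.trace, skew, Fin.sum_univ_three]
  have hsq : θ ^ 2 = x (Sum.inl 0) ^ 2 + x (Sum.inl 1) ^ 2 + x (Sum.inl 2) ^ 2 := by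
    rw [hθ, euclNorm_sq]
    simp [dotProduct, rotPart, Fin.sum_univ_three]
    ring
  have h2 : (wedge x * wedge x).trace = -2 * θ ^ 2 := by
    rw [hsq]
    simp [wedge, fromBlocks_multiply, Matrix.trace, skew, Fin.sum_univ_three, rotPart]
    ring
  have h3 : (wedge x * wedge x * wedge x).trace = 0 := by
    have h4 : wedge x * wedge x * wedge x = rotBlock x * rotBlock x * wedge x := by
      rw [wedge_mul_wedge, Matrix.mul_assoc, wedge_mul_wedge, Matrix.mul_assoc]
    rw [h4]
    simp [wedge, rotBlock, fromBlocks_multiply, Matrix.trace, skew_cube]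
    simp [skew, Fin.sum_univ_three]
  rw [exp_wedge, Matrix.trace_add, Matrix.trace_add, Matrix.trace_add, Matrix.trace_smul,
    Matrix.trace_smul, h1, h2, h3, ← hθ, Matrix.trace_one]
  rcases eq_or_ne θ 0 with h | h
  · simp [rodriguesA, h]; norm_num
  · simp only [rodriguesA, smul_eq_mul]
    field_simp
    simp
    ring

theorem norm_rotBlock_le (x : I9 → ℝ) : ‖rotBlock x‖ ≤ 2 * euclNorm (rotPart x) := by
  have h0 := euclNorm_nonneg (rotPart x)
  have h : ∀ i, |rotPart x i| ≤ euclNorm (rotPart x) := by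
    intro i
    refine Real.abs_le_sqrt ?_
    rw [sq]
    exact Finset.single_le_sum (f := fun i => rotPart x i * rotPart x i)
      (fun i _ => mul_self_nonneg _) (Finset.mem_univ i)
  refine norm_le_of_row_sum_le (by positivity) fun i => ?_
  rcases i with i | i
  · have h1 := h 0
    have h2 := h 1
    have h3 := h 2
    fin_cases i <;> simp [rotBlock, skew, Fin.sum_univ_three] <;> linarith
  · simp [rotBlock]
    exact h0

theorem norm_exp_wedge_sub_le {x : I9 → ℝ} (hx : ‖wedge x‖ ≤ 1) :
    ‖NormedSpace.exp (wedge x) - 1 - wedge x‖ ≤ ‖wedge x‖ ^ 2 := by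
  set θ := euclNorm (rotPart x) with hθ
  have hθ0 : 0 ≤ θ := euclNorm_nonneg _
  have h1 : NormedSpace.exp (wedge x) - 1 - wedge x =
      rodriguesA θ • (wedge x * wedge x) + rodriguesB θ • (wedge x * wedge x * wedge x) := by
    rw [exp_wedge]; abel
  have n0 := norm_nonneg (wedge x)
  have n2 : ‖wedge x * wedge x‖ ≤ ‖wedge x‖ ^ 2 := by rw [sq]; exact norm_mul_le _ _
  have n3 : ‖wedge x * wedge x * wedge x‖ ≤ ‖wedge x‖ ^ 2 := by
    refine (norm_mul_le _ _).trans ?_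
    nlinarith [norm_nonneg (wedge x * wedge x)]
  rw [h1]
  refine (norm_add_le _ _).trans ?_
  rw [norm_smul, norm_smul, Real.norm_eq_abs, Real.norm_eq_abs]
  have a1 := mul_le_mul (abs_rodriguesA_le hθ0) n2 (norm_nonneg _) (by norm_num)
  have a2 := mul_le_mul (abs_rodriguesB_le hθ0) n3 (norm_nonneg _) (by norm_num)
  linarith

/-- On rotation angles below `π` the exponential is close to the identity only near the origin:
the trace controls the angle, and Rodrigues' formula then controls the twist. -/
theorem norm_wedge_le_of_exp_near_one {x : I9 → ℝ} (hx : x ∈ principalBall)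
    (h : ‖NormedSpace.exp (wedge x) - 1‖ ≤ 1 / 512) :
    ‖wedge x‖ ≤ 2 * ‖NormedSpace.exp (wedge x) - 1‖ := by
  set θ := euclNorm (rotPart x) with hθ
  have hθ0 : 0 ≤ θ := euclNorm_nonneg _
  have hθπ : θ < Real.pi := hx
  set E := NormedSpace.exp (wedge x) with hE
  have htr : 2 - 2 * Real.cos θ ≤ 5 * ‖E - 1‖ := by
    have h1 : (E - 1).trace = 2 * Real.cos θ - 2 := by
      rw [Matrix.trace_sub, hE, trace_exp_wedge, Matrix.trace_one]
      simp
      ring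
    have h2 : |(E - 1).trace| ≤ 5 * ‖E - 1‖ := by
      refine (Finset.abs_sum_le_sum_abs _ _).trans ?_
      refine (Finset.sum_le_sum fun i _ => abs_entry_le_norm (E - 1) i i).trans ?_
      simp
    have h3 := neg_abs_le (E - 1).trace
    linarith
  have hsin : 2 / Real.pi * (θ / 2) ≤ Real.sin (θ / 2) :=
    Real.mul_le_sin (by positivity) (by linarith)
  have hcos : Real.cos θ = 1 - 2 * Real.sin (θ / 2) ^ 2 := by
    have := Real.cos_two_mul (θ / 2)
    rw [mul_div_cancel₀ θ two_ne_zero] at this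
    have h2 := Real.sin_sq_add_cos_sq (θ / 2)
    linarith
  have hθsmall : θ ≤ 1 / 4 := by
    have h1 : θ / 4 ≤ Real.sin (θ / 2) := by
      refine le_trans ?_ hsin
      rw [div_mul_div_comm, mul_comm 2 θ, mul_div_mul_right _ _ two_ne_zero]
      exact div_le_div_of_nonneg_left hθ0 Real.pi_pos Real.pi_le_four
    have h2 : (θ / 4) ^ 2 ≤ Real.sin (θ / 2) ^ 2 := pow_le_pow_left₀ (by positivity) h1 2
    nlinarith
  set M := rodriguesA θ • rotBlock x + rodriguesB θ • (rotBlock x * rotBlock x) with hM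
  have hMn : ‖M‖ ≤ 1 / 2 := by
    have n1 : ‖rotBlock x‖ ≤ 1 / 2 := (norm_rotBlock_le x).trans (by linarith)
    have n2 : ‖rotBlock x * rotBlock x‖ ≤ 1 / 2 := by
      refine (norm_mul_le _ _).trans ?_
      nlinarith [norm_nonneg (rotBlock x)]
    refine (norm_add_le _ _).trans ?_
    rw [norm_smul, norm_smul, Real.norm_eq_abs, Real.norm_eq_abs]
    have a1 := mul_le_mul (abs_rodriguesA_le hθ0) n1 (norm_nonneg _) (by norm_num)
    have a2 := mul_le_mul (abs_rodriguesB_le hθ0) n2 (norm_nonneg _) (by norm_num)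
    linarith
  have hX : wedge x = (E - 1) - M * wedge x := by
    have h4 : wedge x * wedge x * wedge x = rotBlock x * rotBlock x * wedge x := by
      rw [wedge_mul_wedge, Matrix.mul_assoc, wedge_mul_wedge, Matrix.mul_assoc]
    rw [hE, exp_wedge, h4, wedge_mul_wedge, hM, Matrix.add_mul, Matrix.smul_mul, Matrix.smul_mul]
    abel
  have h5 : ‖wedge x‖ ≤ ‖E - 1‖ + ‖M‖ * ‖wedge x‖ := by
    conv_lhs => rw [hX]
    exact (norm_sub_le _ _).trans (by gcongr; exact norm_mul_le _ _)
  nlinarith [norm_nonneg (wedge x)]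

end LocalLog

section LocalLog

attribute [local instance] Matrix.linftyOpNormedRing Matrix.linftyOpNormedAlgebra

/-- Near the identity an extended pose is determined by the nine entries that the vee map reads:
the difference of two rotations is, to first order, skew-symmetric. -/
theorem eq_of_vee_eq {R R' : Matrix (Fin 3) (Fin 3) ℝ} {V V' : Matrix (Fin 3) (Fin 2) ℝ}
    (hR : Rᵀ * R = 1) (hR' : R'ᵀ * R' = 1)
    (h1 : ‖(fromBlocks R V 0 1 : Mat5) - 1‖ ≤ 1 / 16)
    (h2 : ‖(fromBlocks R' V' 0 1 : Mat5) - 1‖ ≤ 1 / 16)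
    (h : vee (fromBlocks R V 0 1) = vee (fromBlocks R' V' 0 1)) :
    (fromBlocks R V 0 1 : Mat5) = fromBlocks R' V' 0 1 := by
  have hV : V = V' := by
    ext i j
    have e1 := congrFun h (Sum.inr (Sum.inl i))
    have e2 := congrFun h (Sum.inr (Sum.inr i))
    fin_cases j
    · simpa [vee] using e1
    · simpa [vee] using e2
  set F := R - 1 with hF
  set D := R' - R with hD
  have hFs : ∀ i j, |F i j| ≤ 1 / 16 := by
    intro i j
    have := (abs_entry_le_norm _ (Sum.inl i) (Sum.inl j)).trans h1
    simpa [hF, Matrix.one_apply] using this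
  have hFs' : ∀ i j, |(R' - 1) i j| ≤ 1 / 16 := by
    intro i j
    have := (abs_entry_le_norm _ (Sum.inl i) (Sum.inl j)).trans h2
    simpa [Matrix.one_apply] using this
  have hDs : ∀ i j, |D i j| ≤ 1 / 8 := by
    intro i j
    have e : D i j = (R' - 1) i j - F i j := by simp [hD, hF]
    rw [e]
    have := abs_sub ((R' - 1) i j) (F i j)
    linarith [hFs i j, hFs' i j]
  have hrel : D + Dᵀ = -(Fᵀ * D + Dᵀ * F + Dᵀ * D) := by
    have e1 : R = 1 + F := by rw [hF]; abel
    have e2 : R' = 1 + F + D := by rw [hF, hD]; abel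
    rw [e2] at hR'
    rw [e1] at hR
    simp only [Matrix.transpose_add, Matrix.transpose_one, Matrix.add_mul, Matrix.mul_add,
      Matrix.one_mul, Matrix.mul_one] at hR hR'
    have e3 : (1 + F + (Fᵀ + Fᵀ * F)) + (D + Dᵀ + (Fᵀ * D + Dᵀ * F + Dᵀ * D)) = 1 :=
      Eq.trans (by abel) hR'
    have e4 : 1 + F + (Fᵀ + Fᵀ * F) = 1 := Eq.trans (by abel) hR
    rw [e4] at e3
    exact eq_neg_of_add_eq_zero_left (by simpa using e3)
  have hz1 : D 2 1 = 0 := by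
    have e := congrFun h (Sum.inl 0)
    simp only [hD, Matrix.sub_apply]
    simp [vee] at e
    linarith
  have hz2 : D 0 2 = 0 := by
    have e := congrFun h (Sum.inl 1)
    simp only [hD, Matrix.sub_apply]
    simp [vee] at e
    linarith
  have hz3 : D 1 0 = 0 := by
    have e := congrFun h (Sum.inl 2)
    simp only [hD, Matrix.sub_apply]
    simp [vee] at e
    linarith
  obtain ⟨p, -, hp⟩ := Finset.exists_max_image (Finset.univ : Finset (Fin 3 × Fin 3))
    (fun p => |D p.1 p.2|) Finset.univ_nonempty
  set m := |D p.1 p.2| with hm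
  have hm0 : 0 ≤ m := abs_nonneg _
  have hDm : ∀ i j, |D i j| ≤ m := fun i j => hp (i, j) (Finset.mem_univ _)
  have hsmall : ∀ i j, |(D + Dᵀ) i j| ≤ 3 / 4 * m := by
    intro i j
    rw [hrel]
    have e : (-(Fᵀ * D + Dᵀ * F + Dᵀ * D)) i j =
        -∑ k, (F k i * D k j + D k i * F k j + D k i * D k j) := by
      simp [Matrix.mul_apply, Finset.sum_add_distrib]
    rw [e, abs_neg]
    have hk : ∀ k, |F k i * D k j + D k i * F k j + D k i * D k j| ≤ 1 / 4 * m := by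
      intro k
      have a1 : |F k i * D k j| ≤ 1 / 16 * m := by
        rw [abs_mul]; exact mul_le_mul (hFs k i) (hDm k j) (abs_nonneg _) (by norm_num)
      have a2 : |D k i * F k j| ≤ 1 / 16 * m := by
        rw [abs_mul, mul_comm]
        exact mul_le_mul (hFs k j) (hDm k i) (abs_nonneg _) (by norm_num)
      have a3 : |D k i * D k j| ≤ 1 / 8 * m := by
        rw [abs_mul]; exact mul_le_mul (hDs k i) (hDm k j) (abs_nonneg _) (by norm_num)
      have := abs_add_three (F k i * D k j) (D k i * F k j) (D k i * D k j)
      linarith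
    refine (Finset.abs_sum_le_sum_abs _ _).trans ?_
    refine (Finset.sum_le_sum fun k _ => hk k).trans ?_
    simp
    linarith
  -- Every entry of `D` is zero or an entry of `D + Dᵀ`, up to a factor.
  have hall : ∀ i j, |D i j| ≤ 3 / 4 * m := by
    intro i j
    have h00 := hsmall 0 0
    have h11 := hsmall 1 1
    have h22 := hsmall 2 2
    have h01 := hsmall 0 1
    have h20 := hsmall 2 0
    have h12 := hsmall 1 2
    simp only [Matrix.add_apply, Matrix.transpose_apply, hz1, hz2, hz3, add_zero] at h00 h11 h22 h01 h20 h12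
    rw [← two_mul, abs_mul, abs_two] at h00 h11 h22
    have hn : 0 ≤ 3 / 4 * m := by positivity
    have p00 := abs_nonneg (D 0 0)
    have p11 := abs_nonneg (D 1 1)
    have p22 := abs_nonneg (D 2 2)
    fin_cases i <;> fin_cases j <;> simp only [Fin.mk_one, Fin.zero_eta, Fin.reduceFinMk] <;>
      first
      | linarith
      | (simp only [hz1, hz2, hz3, abs_zero]; exact hn)
  have hm1 : m = 0 := by
    have := hall p.1 p.2
    linarith
  have hD0 : D = 0 := by
    ext i j
    have := hDm i j
    rw [hm1] at this
    exact abs_nonpos_iff.1 this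
  have hRR : R = R' := (sub_eq_zero.1 hD0).symm
  rw [hRR, hV]

theorem rotPart_le_norm {x : I9 → ℝ} (hx : ‖x‖ ≤ 1) : x ∈ principalBall := by
  have h1 : rotPart x ⬝ᵥ rotPart x ≤ 3 := by
    have h : ∀ i, rotPart x i * rotPart x i ≤ 1 := by
      intro i
      have := (abs_apply_le_norm x (Sum.inl i)).trans hx
      rw [← abs_mul_abs_self]
      exact mul_le_one₀ this (abs_nonneg _) this
    refine (Finset.sum_le_sum fun i _ => h i).trans ?_
    simp
  have h2 : euclNorm (rotPart x) ≤ 3 := by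
    rw [euclNorm, Real.sqrt_le_left (by norm_num)]
    linarith
  exact lt_of_le_of_lt h2 Real.pi_gt_three

/-- The exponential in the linear coordinates given by the vee map. -/
def expVee (x : I9 → ℝ) : I9 → ℝ := vee (NormedSpace.exp (wedge x))

theorem contDiffAt_expVee : ContDiffAt ℝ 1 expVee 0 := by
  have h1 : ContDiff ℝ 1 (fun M : Mat5 => vee M) := (LinearMap.toContinuousLinearMap veeₗ).contDiff
  have h2 : ContDiff ℝ 1 (fun x : I9 → ℝ => wedge x) :=
    (LinearMap.toContinuousLinearMap wedgeₗ).contDiff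
  have h3 : ContDiffAt ℝ 1 (fun M : Mat5 => NormedSpace.exp M) (wedge 0) :=
    (NormedSpace.exp_analytic (𝕂 := ℝ) (wedge 0)).contDiffAt
  exact h1.contDiffAt.comp 0 (h3.comp 0 h2.contDiffAt)

theorem hasFDerivAt_expVee :
    HasFDerivAt expVee ((ContinuousLinearEquiv.refl ℝ (I9 → ℝ) : (I9 → ℝ) →L[ℝ] (I9 → ℝ))) 0 := by
  have h1 := (LinearMap.toContinuousLinearMap veeₗ).hasFDerivAt (x := NormedSpace.exp (wedge 0))
  have h2 := (LinearMap.toContinuousLinearMap wedgeₗ).hasFDerivAt (x := (0 : I9 → ℝ))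
  have h3 : HasFDerivAt (NormedSpace.exp : Mat5 → Mat5) (1 : Mat5 →L[ℝ] Mat5) (wedge 0) := by
    rw [wedge_zero]; exact hasFDerivAt_exp_zero
  refine (h1.comp (0 : I9 → ℝ) (h3.comp (0 : I9 → ℝ) h2)).congr_fderiv ?_
  ext x i
  exact congrFun (vee_wedge _) i

/-- `Λ` represents the principal logarithm on the elements of `SE₂(3)` of distance less than `r`
from the identity: it is a smooth function of the nine linear coordinates read by the vee map, and
agrees with them up to second order.  Membership in `SE₂(3)` is a conclusion: the determinant
condition is automatic near the identity. -/
structure IsLocalLog (r : ℝ) (Λ : (I9 → ℝ) → (I9 → ℝ)) : Prop where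
  pos : 0 < r
  le_one : r ≤ 1
  contDiffOn : ContDiffOn ℝ 1 Λ (Metric.ball 0 r)
  spec : ∀ (R : Matrix (Fin 3) (Fin 3) ℝ) (V : Matrix (Fin 3) (Fin 2) ℝ), R * Rᵀ = 1 →
      ‖(fromBlocks R V 0 1 : Mat5) - 1‖ < r →
      (fromBlocks R V 0 1 : Mat5) ∈ SE23 ∧ (fromBlocks R V 0 1 : Mat5) ∈ logDomain ∧
      logVee (fromBlocks R V 0 1) = Λ (vee (fromBlocks R V 0 1)) ∧
      ‖logVee (fromBlocks R V 0 1) - vee (fromBlocks R V 0 1)‖ ≤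
        320 * ‖vee (fromBlocks R V 0 1)‖ ^ 2 ∧
      ‖(fromBlocks R V 0 1 : Mat5) - 1 - wedge (vee (fromBlocks R V 0 1))‖ ≤
        320 * ‖vee (fromBlocks R V 0 1)‖ ^ 2

/-- The inverse function theorem, applied to `x ↦ vee (exp x^∧)`, provides the local logarithm; an
extended pose near the identity is the exponential of its value by `eq_of_vee_eq`.  The value agrees
with the principal logarithm because the latter is small near the identity
(`norm_wedge_le_of_exp_near_one`). -/
theorem exists_isLocalLog : ∃ r Λ, IsLocalLog r Λ := by
  have hf0 : expVee 0 = 0 := by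
    rw [expVee, wedge_zero, NormedSpace.exp_zero, vee_one]
  have hstrict := contDiffAt_expVee.hasStrictFDerivAt' hasFDerivAt_expVee one_ne_zero
  set Λ := contDiffAt_expVee.localInverse hasFDerivAt_expVee one_ne_zero with hΛ
  have hΛc : ContDiffAt ℝ 1 Λ 0 := by
    have := contDiffAt_expVee.to_localInverse hasFDerivAt_expVee one_ne_zero
    rwa [hf0] at this
  have hΛ0 : Λ 0 = 0 := by
    have := contDiffAt_expVee.localInverse_apply_image hasFDerivAt_expVee one_ne_zero
    rwa [hf0] at this
  have hleft : ∀ᶠ x in 𝓝 (0 : I9 → ℝ), Λ (expVee x) = x := hstrict.eventually_left_inverse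
  have hright : ∀ᶠ y in 𝓝 (0 : I9 → ℝ), expVee (Λ y) = y := by
    have := hstrict.eventually_right_inverse
    rwa [hf0] at this
  have hexp0 : ContinuousAt (fun x : I9 → ℝ => NormedSpace.exp (wedge x)) 0 :=
    (hasFDerivAt_exp_zero (𝕂 := ℝ) (𝔸 := Mat5)).continuousAt.comp_of_eq
      (LinearMap.toContinuousLinearMap wedgeₗ).continuous.continuousAt wedge_zero
  have hΛt : Tendsto Λ (𝓝 0) (𝓝 0) := by
    have := hΛc.continuousAt.tendsto
    rwa [hΛ0] at this
  have hnear : ∀ᶠ x in 𝓝 (0 : I9 → ℝ), ‖NormedSpace.exp (wedge x) - 1‖ ≤ 1 / 16 := by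
    have h1 : Tendsto (fun x : I9 → ℝ => NormedSpace.exp (wedge x) - 1) (𝓝 0) (𝓝 0) := by
      have := hexp0.tendsto.sub_const (1 : Mat5)
      simpa [wedge_zero, NormedSpace.exp_zero] using this
    filter_upwards [h1 (Metric.closedBall_mem_nhds 0 (show (0 : ℝ) < 1 / 16 by norm_num))]
      with x hx
    simpa using hx
  obtain ⟨u, hu, hcu⟩ := (hΛc.contDiffOn (le_refl 1) (by simp))
  obtain ⟨r₃, hr₃, hleft'⟩ := Metric.eventually_nhds_iff_ball.1 hleft
  have hev : ∀ᶠ y in 𝓝 (0 : I9 → ℝ), y ∈ u ∧ expVee (Λ y) = y ∧ ‖Λ y‖ ≤ 1 ∧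
      ‖NormedSpace.exp (wedge (Λ y)) - 1‖ ≤ 1 / 16 := by
    filter_upwards [hu, hright, hΛt.eventually hnear,
      hΛt (Metric.closedBall_mem_nhds 0 one_pos)] with y h1 h2 h3 h4
    exact ⟨h1, h2, by simpa using h4, h3⟩
  obtain ⟨r₁, hr₁, hball⟩ := Metric.eventually_nhds_iff_ball.1 hev
  refine ⟨min r₁ (min (r₃ / 2) (1 / 512)), Λ, by positivity,
    (min_le_right _ _).trans ((min_le_right _ _).trans (by norm_num)),
    hcu.mono fun y hy => (hball y (Metric.ball_subset_ball (min_le_left _ _) hy)).1, ?_⟩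
  intro R V hR hE
  have hR' : Rᵀ * R = 1 := mul_eq_one_comm.1 hR
  obtain ⟨E, hEdef⟩ : ∃ E : Mat5, E = fromBlocks R V 0 1 := ⟨_, rfl⟩
  have hE1 : ‖E - 1‖ < r₁ := by rw [hEdef]; exact hE.trans_le (min_le_left _ _)
  have hE3 : ‖E - 1‖ < r₃ / 2 := by
    rw [hEdef]; exact hE.trans_le ((min_le_right _ _).trans (min_le_left _ _))
  have hEs : ‖E - 1‖ ≤ 1 / 512 := by
    rw [hEdef]; exact (hE.trans_le ((min_le_right _ _).trans (min_le_right _ _))).le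
  set y := vee E with hy
  have hyE : ‖y‖ ≤ ‖E - 1‖ := by
    have : y = vee (E - 1) := by rw [vee_sub, vee_one, sub_zero]
    rw [this]; exact norm_vee_le _
  obtain ⟨-, hy1, hy2, hy3⟩ := hball y (by simpa using hyE.trans_lt hE1)
  have hEexp : E = NormedSpace.exp (wedge (Λ y)) := by
    obtain ⟨W, hW⟩ := exp_wedge_eq_fromBlocks (Λ y)
    obtain ⟨R₂, W₂, hRW, -, hR2, -⟩ := exists_of_mem_SE23 (exp_wedge_mem_SE23 (Λ y))
    rw [hEdef, hRW]
    refine eq_of_vee_eq hR' hR2 ?_ ?_ ?_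
    · rw [← hEdef]; linarith
    · rw [← hRW]; exact hy3
    · rw [← hEdef, ← hRW, ← hy]; exact hy1.symm
  have hdom : E ∈ logDomain := ⟨Λ y, rotPart_le_norm hy2, hEexp.symm⟩
  -- The value chosen by the inverse function is small, so it is the one of the local inverse.
  have hlogmem : logVee E ∈ principalBall := Function.invFunOn_mem hdom
  have hlogexp : NormedSpace.exp (wedge (logVee E)) = E := Function.invFunOn_eq hdom
  have hXb := norm_wedge_le_of_exp_near_one hlogmem (by rw [hlogexp]; exact hEs)
  rw [hlogexp] at hXb
  have hxX : ‖logVee E‖ ≤ ‖wedge (logVee E)‖ := by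
    conv_lhs => rw [← vee_wedge (logVee E)]
    exact norm_vee_le _
  have hlog : logVee E = Λ y := by
    have h1 := hleft' (logVee E) (by simp; linarith)
    rw [expVee, hlogexp, ← hy] at h1
    exact h1.symm
  set x := logVee E with hx
  have hq : ‖E - 1 - wedge x‖ ≤ ‖wedge x‖ ^ 2 := by
    have := norm_exp_wedge_sub_le (x := x) (by linarith)
    rwa [hlogexp] at this
  have hX4 := norm_wedge_le x
  have hx0 := norm_nonneg x
  have hq' : ‖E - 1 - wedge x‖ ≤ 16 * ‖x‖ ^ 2 := by
    refine hq.trans ?_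
    nlinarith [norm_nonneg (wedge x)]
  have hyx : ‖y - x‖ ≤ 16 * ‖x‖ ^ 2 := by
    have : y - x = vee (E - 1 - wedge x) := by
      rw [vee_sub, vee_sub, vee_one, vee_wedge, sub_zero]
    rw [this]; exact (norm_vee_le _).trans hq'
  have hx2y : ‖x‖ ≤ 2 * ‖y‖ := by
    have h1 : ‖x‖ ≤ ‖y‖ + ‖y - x‖ := by
      have := norm_sub_norm_le x y
      rw [norm_sub_rev] at this
      linarith
    have h2 : ‖x‖ ≤ 1 / 32 := by linarith
    nlinarith
  have hx2 : ‖x‖ ^ 2 ≤ 4 * ‖y‖ ^ 2 := by nlinarith [norm_nonneg y]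
  rw [← hEdef]
  refine ⟨by rw [hEexp]; exact exp_wedge_mem_SE23 _, hdom, hlog, ?_, ?_⟩
  · rw [← hy, norm_sub_rev]
    nlinarith [norm_nonneg y]
  · have h1 : E - 1 - wedge y = (E - 1 - wedge x) - wedge (y - x) := by rw [wedge_sub]; abel
    rw [← hy, h1]
    refine (norm_sub_le _ _).trans ?_
    have := norm_wedge_le (y - x)
    nlinarith

end LocalLog

/-! ### Linearization of the error dynamics -/

section Linearization

attribute [local instance] Matrix.linftyOpNormedRing Matrix.linftyOpNormedAlgebra

/-- The linear coordinates `(e₁^∨, e₂^∨)` of an error. -/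
def linCoord (e : Mat5 × Mat5) : I18 → ℝ := Sum.elim (vee e.1) (vee e.2)

theorem outputMatrix_mulVec (u v : I9 → ℝ) : outputMatrix *ᵥ Sum.elim u v = u := by
  rw [outputMatrix, fromCols_mulVec_sumElim, Matrix.one_mulVec, Matrix.zero_mulVec, add_zero]

theorem stateMatrix_mulVec {X : Mat5 × Mat5} (hX : IsUnit X.1.det) (g : Fin 3 → ℝ) (w u v : I9 → ℝ) :
    stateMatrix g w X *ᵥ Sum.elim u v =
      Sum.elim (upsilon g *ᵥ u - v) (vee (ad (frameVelocity g w X) (wedge v))) := by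
  rw [stateMatrix, fromBlocks_mulVec, Sum.elim_comp_inl, Sum.elim_comp_inr, psi_add_gravity hX,
    adMatrix_mulVec, Matrix.neg_mulVec, Matrix.one_mulVec, Matrix.zero_mulVec, zero_add,
    ← sub_eq_add_neg]

/-- The pose component of the nonlinear remainder of the error dynamics, for gain `K` and
logarithm `ℓ` of the pose error `E`. -/
def poseRemainder (g : Fin 3 → ℝ) (K : Matrix I18 I9 ℝ) (E : Mat5) (z₂ ℓ : I9 → ℝ) : I9 → ℝ :=
  vee (drift (E - 1 - wedge (vee E)) + gravity g * (E - 1 - wedge (vee E))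
      - (E - 1 - wedge (vee E)) * gravity g)
    - vee ((E - 1) * wedge z₂) - vee ((E - 1) * wedge fun i => (K *ᵥ ℓ) (Sum.inl i))
    - fun i => (K *ᵥ (ℓ - vee E)) (Sum.inl i)

/-- The bias component of the nonlinear remainder of the error dynamics. -/
def biasRemainder (K : Matrix I18 I9 ℝ) (E : Mat5) (z₂ ℓ : I9 → ℝ) : I9 → ℝ :=
  vee (ad (wedge fun i => (K *ᵥ ℓ) (Sum.inl i)) (wedge z₂))
    - fun i => (K *ᵥ (ℓ - vee E)) (Sum.inr i)

theorem vee_poseError_eq (g : Fin 3 → ℝ) (K : Matrix I18 I9 ℝ) (E : Mat5) (z₂ ℓ : I9 → ℝ) :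
    vee (drift E - E * wedge z₂ + gravity g * E - E * gravity g
      - E * wedge fun i => (K *ᵥ ℓ) (Sum.inl i)) =
    upsilon g *ᵥ vee E - z₂ - (fun i => (K *ᵥ vee E) (Sum.inl i)) + poseRemainder g K E z₂ ℓ := by
  obtain ⟨H, hH⟩ : ∃ H, H = E - 1 - wedge (vee E) := ⟨_, rfl⟩
  have hE : E - 1 = wedge (vee E) + H := by rw [hH]; abel
  set D := wedge fun i => (K *ᵥ ℓ) (Sum.inl i) with hD
  have hvD : vee D = fun i => (K *ᵥ ℓ) (Sum.inl i) := vee_wedge _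
  have h1 : drift E - E * wedge z₂ + gravity g * E - E * gravity g - E * D =
      (drift (wedge (vee E)) + gravity g * wedge (vee E) - wedge (vee E) * gravity g)
      + (drift H + gravity g * H - H * gravity g) - wedge z₂ - (E - 1) * wedge z₂ - D
      - (E - 1) * D := by
    have e1 : E = 1 + (E - 1) := by abel
    have e2 : drift E = drift (wedge (vee E)) + drift H := by
      conv_lhs => rw [e1, drift_add, drift_one, hE, drift_add, zero_add]
    have e3 : gravity g * E - E * gravity g =
        gravity g * (wedge (vee E) + H) - (wedge (vee E) + H) * gravity g := by
      rw [← hE]; noncomm_ring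
    have e4 : drift E - E * wedge z₂ + gravity g * E - E * gravity g - E * D =
      drift E - E * wedge z₂ + (gravity g * E - E * gravity g) - E * D := by abel
    rw [e4, e3, e2]
    noncomm_ring
  have h3 : (fun i => (K *ᵥ (ℓ - vee E)) (Sum.inl i)) =
      (fun i => (K *ᵥ ℓ) (Sum.inl i)) - fun i => (K *ᵥ vee E) (Sum.inl i) := by
    rw [Matrix.mulVec_sub]; rfl
  rw [h1, poseRemainder, ← hH, ← hD, h3]
  simp only [vee_sub, vee_add, ← vee_drift_gravity_wedge, hvD, vee_wedge]
  abel

theorem vee_biasError_eq (U : Mat5) (K : Matrix I18 I9 ℝ) (E : Mat5) (z₂ ℓ : I9 → ℝ) :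
    vee (ad (U + wedge fun i => (K *ᵥ ℓ) (Sum.inl i)) (wedge z₂)
      + -wedge fun i => (K *ᵥ ℓ) (Sum.inr i)) =
    vee (ad U (wedge z₂)) - (fun i => (K *ᵥ vee E) (Sum.inr i)) + biasRemainder K E z₂ ℓ := by
  have h1 : ∀ M N L : Mat5, ad (M + N) L = ad M L + ad N L := fun M N L => by
    simp only [ad]; noncomm_ring
  have h3 : (fun i => (K *ᵥ (ℓ - vee E)) (Sum.inr i)) =
      (fun i => (K *ᵥ ℓ) (Sum.inr i)) - fun i => (K *ᵥ vee E) (Sum.inr i) := by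
    rw [Matrix.mulVec_sub]; rfl
  rw [biasRemainder, h3, h1]
  simp only [vee_add, vee_neg, vee_wedge]
  abel

theorem norm_restrict_inl_le (y : I18 → ℝ) : ‖fun i => y (Sum.inl i)‖ ≤ ‖y‖ :=
  (pi_norm_le_iff_of_nonneg (norm_nonneg y)).2 fun i => norm_le_pi_norm y (Sum.inl i)

theorem norm_restrict_inr_le (y : I18 → ℝ) : ‖fun i => y (Sum.inr i)‖ ≤ ‖y‖ :=
  (pi_norm_le_iff_of_nonneg (norm_nonneg y)).2 fun i => norm_le_pi_norm y (Sum.inr i)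

theorem norm_ad_le (U V : Mat5) : ‖ad U V‖ ≤ 2 * ‖U‖ * ‖V‖ := by
  refine (norm_sub_le _ _).trans ?_
  have h1 := norm_mul_le U V
  have h2 := norm_mul_le V U
  nlinarith

/-- A constant for the quadratic bound of the remainder. -/
def remainderConst (g : Fin 3 → ℝ) (κ : ℝ) : ℝ := 320 * (1 + 2 * ‖gravity g‖) + 1000000 * (κ + 1)

/-- The nonlinear remainder is quadratic, with the pose error as a factor. -/
theorem norm_remainder_le (g : Fin 3 → ℝ) {K : Matrix I18 I9 ℝ} {E : Mat5} {z₂ ℓ : I9 → ℝ} {κ : ℝ}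
    (hκ : 0 ≤ κ) (hK : ∀ v, ‖K *ᵥ v‖ ≤ κ * ‖v‖) (h1 : ‖vee E‖ ≤ 1)
    (hℓ : ‖ℓ - vee E‖ ≤ 320 * ‖vee E‖ ^ 2)
    (hH : ‖E - 1 - wedge (vee E)‖ ≤ 320 * ‖vee E‖ ^ 2) :
    ‖Sum.elim (poseRemainder g K E z₂ ℓ) (biasRemainder K E z₂ ℓ)‖ ≤
      remainderConst g κ * ‖vee E‖ * (‖vee E‖ + ‖z₂‖) := by
  set a := ‖vee E‖ with ha
  set b := ‖z₂‖ with hb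
  set G := ‖gravity g‖ with hG
  have ha0 : 0 ≤ a := norm_nonneg _
  have hb0 : 0 ≤ b := norm_nonneg _
  have hG0 : 0 ≤ G := norm_nonneg _
  have hE1 : ‖E - 1‖ ≤ 324 * a := by
    have e : E - 1 = wedge (vee E) + (E - 1 - wedge (vee E)) := by abel
    rw [e]
    refine (norm_add_le _ _).trans ?_
    have := norm_wedge_le (vee E)
    nlinarith
  have hℓ1 : ‖ℓ‖ ≤ 321 * a := by
    have e : ℓ = vee E + (ℓ - vee E) := by abel
    rw [e]
    refine (norm_add_le _ _).trans ?_
    nlinarith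
  have hz : ‖wedge z₂‖ ≤ 4 * b := norm_wedge_le z₂
  set D := wedge fun i => (K *ᵥ ℓ) (Sum.inl i) with hD
  have hDn : ‖D‖ ≤ 1284 * κ * a := by
    refine (norm_wedge_le _).trans ?_
    have e1 := (norm_restrict_inl_le (K *ᵥ ℓ)).trans (hK ℓ)
    have e2 := mul_le_mul_of_nonneg_left hℓ1 hκ
    linarith
  have hKd : ‖K *ᵥ (ℓ - vee E)‖ ≤ 320 * κ * a ^ 2 := by
    have := mul_le_mul_of_nonneg_left hℓ hκ
    linarith [hK (ℓ - vee E)]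
  have p1 : ‖vee (drift (E - 1 - wedge (vee E)) + gravity g * (E - 1 - wedge (vee E))
      - (E - 1 - wedge (vee E)) * gravity g)‖ ≤ (1 + 2 * G) * (320 * a ^ 2) := by
    set H := E - 1 - wedge (vee E)
    have e1 := norm_drift_le H
    have e2 := norm_mul_le (gravity g) H
    have e3 := norm_mul_le H (gravity g)
    have e4 : ‖drift H + gravity g * H - H * gravity g‖ ≤
        ‖drift H‖ + ‖gravity g * H‖ + ‖H * gravity g‖ :=
      (norm_sub_le _ _).trans (by gcongr; exact norm_add_le _ _)
    have e5 : ‖drift H + gravity g * H - H * gravity g‖ ≤ (1 + 2 * G) * ‖H‖ := by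
      rw [← hG] at e2 e3
      linarith
    refine (norm_vee_le _).trans (e5.trans ?_)
    exact mul_le_mul_of_nonneg_left hH (by positivity)
  have p2 : ‖vee ((E - 1) * wedge z₂)‖ ≤ 1296 * a * b := by
    refine (norm_vee_le _).trans ((norm_mul_le _ _).trans ?_)
    have := mul_le_mul hE1 hz (norm_nonneg _) (by positivity)
    linarith
  have p3 : ‖vee ((E - 1) * D)‖ ≤ 416016 * κ * a ^ 2 := by
    refine (norm_vee_le _).trans ((norm_mul_le _ _).trans ?_)
    have := mul_le_mul hE1 hDn (norm_nonneg _) (by positivity)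
    linarith
  have p4 := (norm_restrict_inl_le (K *ᵥ (ℓ - vee E))).trans hKd
  have p5 := (norm_restrict_inr_le (K *ᵥ (ℓ - vee E))).trans hKd
  have p6 : ‖vee (ad D (wedge z₂))‖ ≤ 10272 * κ * a * b := by
    refine (norm_vee_le _).trans ((norm_ad_le _ _).trans ?_)
    have := mul_le_mul (mul_le_mul_of_nonneg_left hDn (show (0 : ℝ) ≤ 2 by norm_num)) hz
      (norm_nonneg _) (by positivity)
    linarith
  have hab : 0 ≤ a * b := by positivity
  have haa : 0 ≤ a ^ 2 := by positivity
  have hκa : 0 ≤ κ * a ^ 2 := by positivity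
  have hκb : 0 ≤ κ * (a * b) := by positivity
  have hGa : 0 ≤ G * (a * b) := by positivity
  have hGaa : 0 ≤ G * a ^ 2 := by positivity
  have hfin : remainderConst g κ * a * (a + b) = 320 * a ^ 2 + 640 * (G * a ^ 2)
      + 320 * (a * b) + 640 * (G * (a * b)) + 1000000 * (κ * a ^ 2) + 1000000 * (κ * (a * b))
      + 1000000 * a ^ 2 + 1000000 * (a * b) := by
    rw [remainderConst]; ring
  have q1 : ‖poseRemainder g K E z₂ ℓ‖ ≤ remainderConst g κ * a * (a + b) := by
    rw [poseRemainder, ← hD, hfin]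
    refine (norm_sub_le _ _).trans ?_
    refine (add_le_add ((norm_sub_le _ _).trans (add_le_add ((norm_sub_le _ _).trans
      (add_le_add p1 p2)) p3)) p4).trans ?_
    linarith
  have q2 : ‖biasRemainder K E z₂ ℓ‖ ≤ remainderConst g κ * a * (a + b) := by
    rw [biasRemainder, ← hD, hfin]
    refine (norm_sub_le _ _).trans ((add_le_add p6 p5).trans ?_)
    linarith
  refine (pi_norm_le_iff_of_nonneg (by rw [hfin]; positivity)).2 fun i => ?_
  rcases i with i | i
  · exact (norm_le_pi_norm (poseRemainder g K E z₂ ℓ) i).trans q1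
  · exact (norm_le_pi_norm (biasRemainder K E z₂ ℓ) i).trans q2

/-- Matrix equations for the two errors become, in linear coordinates, the linearized equation with
gain `K`, up to the nonlinear remainder. -/
theorem hasDerivWithinAt_sumElim_vee {E e₂ : ℝ → Mat5} {J : Set ℝ} {t : ℝ} (g : Fin 3 → ℝ)
    (w : I9 → ℝ) {X : Mat5 × Mat5} (hX : IsUnit X.1.det) (K : Matrix I18 I9 ℝ) (ℓ : I9 → ℝ)
    (he : e₂ t ∈ se23)
    (hEd : HasDerivWithinAt E (drift (E t) - E t * e₂ t + gravity g * E t - E t * gravity g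
      - E t * wedge fun i => (K *ᵥ ℓ) (Sum.inl i)) J t)
    (hed : HasDerivWithinAt e₂ (ad (frameVelocity g w X + wedge fun i => (K *ᵥ ℓ) (Sum.inl i)) (e₂ t)
      + -wedge fun i => (K *ᵥ ℓ) (Sum.inr i)) J t) :
    HasDerivWithinAt (fun s => (Sum.elim (vee (E s)) (vee (e₂ s)) : I18 → ℝ))
      (stateMatrix g w X *ᵥ Sum.elim (vee (E t)) (vee (e₂ t))
        - K *ᵥ (outputMatrix *ᵥ Sum.elim (vee (E t)) (vee (e₂ t)))
        + Sum.elim (poseRemainder g K (E t) (vee (e₂ t)) ℓ)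
          (biasRemainder K (E t) (vee (e₂ t)) ℓ)) J t := by
  have hw : wedge (vee (e₂ t)) = e₂ t := wedge_vee he
  have d1 := hasDerivWithinAt_linearMap_matrix veeₗ hEd
  have d2 := hasDerivWithinAt_linearMap_matrix veeₗ hed
  have v1 := vee_poseError_eq g K (E t) (vee (e₂ t)) ℓ
  have v2 := vee_biasError_eq (frameVelocity g w X) K (E t) (vee (e₂ t)) ℓ
  rw [hw] at v1 v2
  change HasDerivWithinAt (fun s => vee (E s)) (vee _) J t at d1
  change HasDerivWithinAt (fun s => vee (e₂ s)) (vee _) J t at d2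
  rw [v1] at d1
  rw [v2] at d2
  rw [outputMatrix_mulVec, stateMatrix_mulVec hX, hw]
  rw [hasDerivWithinAt_pi] at d1 d2 ⊢
  rintro (i | i)
  · exact d1 i
  · exact d2 i

theorem innovation_eq (Q : Matrix I9 I9 ℝ) (X : Mat5 × Mat5) (S : Matrix I18 I18 ℝ) (y : Mat5) :
    innovation Q X S y =
      (wedge fun i => ((S * outputMatrixᵀ * Q⁻¹) *ᵥ logVee (y * X.1⁻¹)) (Sum.inl i),
       -wedge fun i => ((S * outputMatrixᵀ * Q⁻¹) *ᵥ logVee (y * X.1⁻¹)) (Sum.inr i)) := by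
  simp only [innovation, dPhiInv, dEpsInv, rho, sdInv]

/-- The error of the observer, in linear coordinates, solves the linearized equation with the gain
`S Cᵀ Q⁻¹`, up to the nonlinear remainder. -/
theorem hasDerivWithinAt_linCoord {g : Fin 3 → ℝ} {P : Matrix I18 I18 ℝ} {Q : Matrix I9 I9 ℝ}
    {S₀ : Matrix I18 I18 ℝ} {w τ : ℝ → I9 → ℝ} {ξ : ℝ → Mat5 × Mat5} {J : Set ℝ}
    {X : ℝ → Mat5 × Mat5} {S : ℝ → Matrix I18 I18 ℝ} (hξ : IsTrajectory g w τ ξ)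
    (hX : IsObserver g P Q S₀ w τ (fun t => output (ξ t)) J X S) (hJ : J ⊆ Ici 0)
    {t : ℝ} (ht : t ∈ J) :
    HasDerivWithinAt (fun s => linCoord (stateError (X s) (ξ s)))
      (stateMatrix g (w t) (X t) *ᵥ linCoord (stateError (X t) (ξ t))
        - (S t * outputMatrixᵀ * Q⁻¹) *ᵥ (outputMatrix *ᵥ linCoord (stateError (X t) (ξ t)))
        + Sum.elim
          (poseRemainder g (S t * outputMatrixᵀ * Q⁻¹) (stateError (X t) (ξ t)).1
            (vee (stateError (X t) (ξ t)).2) (logVee (stateError (X t) (ξ t)).1))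
          (biasRemainder (S t * outputMatrixᵀ * Q⁻¹) (stateError (X t) (ξ t)).1
            (vee (stateError (X t) (ξ t)).2) (logVee (stateError (X t) (ξ t)).1))) J t := by
  have hse : ∀ s ∈ J, stateError (X s) (ξ s) =
      ((ξ s).1 * (X s).1⁻¹, Ad (X s).1 (ξ s).2 + (X s).2) := fun s hs =>
    stateError_eq (det_isUnit_of_mem_SE23 (hX.mem_group s hs)) (X s).2 (ξ s).1 (ξ s).2
  have ht0 : t ∈ Ici (0 : ℝ) := hJ ht
  have hT := (hξ.mem t ht0).1
  have hA := hX.mem_group t ht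
  have hTd := hasDerivWithinAt_mono_matrix (hξ.pose t ht0) hJ
  have hbd := hasDerivWithinAt_mono_matrix (hξ.bias t ht0) hJ
  have hEd := hasDerivWithinAt_poseError (T := fun s => (ξ s).1) (A := fun s => (X s).1)
    (b := fun s => (ξ s).2) (a := fun s => (X s).2) (t := t) hT hA hTd (hX.ode_group t ht)
  have hed := hasDerivWithinAt_biasError (A := fun s => (X s).1)
    (b := fun s => (ξ s).2) (a := fun s => (X s).2) (t := t) hA hbd (hX.ode_group t ht) (hX.ode_algebra t ht)
  have hE2 : Ad (X t).1 (ξ t).2 + (X t).2 ∈ se23 :=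
    add_mem_se23 (Ad_mem_se23 hA (hξ.mem t ht0).2) (hX.mem_algebra t ht)
  rw [innovation_eq] at hEd hed
  have hmain := hasDerivWithinAt_sumElim_vee (E := fun s => (ξ s).1 * (X s).1⁻¹)
    (e₂ := fun s => Ad (X s).1 (ξ s).2 + (X s).2) (X := X t) g (w t) (det_isUnit_of_mem_SE23 hA)
    (S t * outputMatrixᵀ * Q⁻¹) (logVee ((ξ t).1 * (X t).1⁻¹)) hE2 hEd hed
  rw [hse t ht]
  refine hmain.congr_of_mem (fun s hs => ?_) ht
  rw [hse s hs, linCoord]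

end Linearization

/-! ### A priori decay of the error -/

section SupNorm

variable {n m : Type*} [Fintype n] [Fintype m]

theorem norm_sq_le_dotProduct_self (x : n → ℝ) : ‖x‖ ^ 2 ≤ x ⬝ᵥ x := by
  have h0 := dotProduct_self_nonneg_real x
  have h : ‖x‖ ≤ Real.sqrt (x ⬝ᵥ x) := by
    refine (pi_norm_le_iff_of_nonneg (Real.sqrt_nonneg _)).2 fun i => ?_
    rw [Real.norm_eq_abs]
    refine Real.abs_le_sqrt ?_
    rw [sq]
    exact Finset.single_le_sum (f := fun i => x i * x i) (fun j _ => mul_self_nonneg _)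
      (Finset.mem_univ i)
  calc ‖x‖ ^ 2 ≤ Real.sqrt (x ⬝ᵥ x) ^ 2 := by gcongr
    _ = x ⬝ᵥ x := Real.sq_sqrt h0

theorem dotProduct_self_le_norm_sq (x : n → ℝ) : x ⬝ᵥ x ≤ Fintype.card n * ‖x‖ ^ 2 := by
  have h : ∀ i, x i * x i ≤ ‖x‖ ^ 2 := fun i => by
    rw [← sq, ← sq_abs, ← Real.norm_eq_abs]
    gcongr
    exact norm_le_pi_norm x i
  refine (Finset.sum_le_sum fun i _ => h i).trans ?_
  simp

/-- The gain `S B` is bounded if the positive semidefinite matrix `S` is. -/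
theorem norm_mul_mulVec_le {S : Matrix n n ℝ} (hS : S.PosSemidef) {σ : ℝ} (hσ : 0 < σ)
    (hSσ : ∀ u : n → ℝ, u ⬝ᵥ (S *ᵥ u) ≤ σ * (u ⬝ᵥ u)) (B : Matrix n m ℝ) (v : m → ℝ) :
    ‖(S * B) *ᵥ v‖ ≤ σ * (Fintype.card m * frobSq B + 1) * ‖v‖ := by
  have hF := frobSq_nonneg B
  set y := B *ᵥ v with hy
  have h1 : (S *ᵥ y) ⬝ᵥ (S *ᵥ y) ≤ σ ^ 2 * (y ⬝ᵥ y) := by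
    have := mul_le_mul_of_nonneg_left (hSσ y) hσ.le
    nlinarith [mulVec_self_le_of_posSemidef hS hSσ y]
  have h2 : y ⬝ᵥ y ≤ (Fintype.card m * frobSq B) * ‖v‖ ^ 2 := by
    refine (mulVec_dotProduct_self_le B v).trans ?_
    have := mul_le_mul_of_nonneg_left (dotProduct_self_le_norm_sq v) hF
    linarith
  set k : ℝ := Fintype.card m * frobSq B with hk
  have hk0 : 0 ≤ k := by positivity
  have hmain : ‖S *ᵥ y‖ ^ 2 ≤ (σ * (k + 1) * ‖v‖) ^ 2 := by
    refine (norm_sq_le_dotProduct_self _).trans (h1.trans ?_)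
    have e1 := mul_le_mul_of_nonneg_left h2 (sq_nonneg σ)
    refine e1.trans ?_
    have e2 : (σ * (k + 1) * ‖v‖) ^ 2 - σ ^ 2 * (k * ‖v‖ ^ 2) =
        σ ^ 2 * ‖v‖ ^ 2 * (k ^ 2 + k + 1) := by ring
    have e3 : 0 ≤ σ ^ 2 * ‖v‖ ^ 2 * (k ^ 2 + k + 1) := by positivity
    linarith
  rw [← Matrix.mulVec_mulVec]
  exact (sq_le_sq₀ (norm_nonneg _) (by positivity)).1 hmain

end SupNorm

section APriori

attribute [local instance] Matrix.linftyOpNormedRing Matrix.linftyOpNormedAlgebra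

variable {g : Fin 3 → ℝ} {P : Matrix I18 I18 ℝ} {Q : Matrix I9 I9 ℝ} {S₀ : Matrix I18 I18 ℝ}
  {w τ : ℝ → I9 → ℝ} {ξ : ℝ → Mat5 × Mat5} {J : Set ℝ} {X : ℝ → Mat5 × Mat5}
  {S : ℝ → Matrix I18 I18 ℝ} {r : ℝ} {Λ : (I9 → ℝ) → (I9 → ℝ)}

theorem stateError_fst_mem (hξ : IsTrajectory g w τ ξ)
    (hX : IsObserver g P Q S₀ w τ (fun t => output (ξ t)) J X S) (hJ : J ⊆ Ici 0) {t : ℝ}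
    (ht : t ∈ J) : (stateError (X t) (ξ t)).1 ∈ SE23 := by
  have hA := hX.mem_group t ht
  have h := stateError_eq (det_isUnit_of_mem_SE23 hA) (X t).2 (ξ t).1 (ξ t).2
  have h' : (stateError (X t) (ξ t)).1 = (ξ t).1 * (X t).1⁻¹ := congrArg Prod.fst h
  rw [h']
  exact mul_mem_SE23 (hξ.mem t (hJ ht)).1 (inv_mem_SE23 hA)

theorem stateError_snd_mem (hξ : IsTrajectory g w τ ξ)
    (hX : IsObserver g P Q S₀ w τ (fun t => output (ξ t)) J X S) (hJ : J ⊆ Ici 0) {t : ℝ}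
    (ht : t ∈ J) : (stateError (X t) (ξ t)).2 ∈ se23 := by
  have hA := hX.mem_group t ht
  have h := stateError_eq (det_isUnit_of_mem_SE23 hA) (X t).2 (ξ t).1 (ξ t).2
  have h' : (stateError (X t) (ξ t)).2 = Ad (X t).1 (ξ t).2 + (X t).2 := congrArg Prod.snd h
  rw [h']
  exact add_mem_se23 (Ad_mem_se23 hA (hξ.mem t (hJ ht)).2) (hX.mem_algebra t ht)

theorem continuousOn_stateError_fst (hξ : IsTrajectory g w τ ξ)
    (hX : IsObserver g P Q S₀ w τ (fun t => output (ξ t)) J X S) (hJ : J ⊆ Ici 0) :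
    ContinuousOn (fun t => (stateError (X t) (ξ t)).1) J := by
  intro t ht
  have hA := hX.mem_group t ht
  have h1 := hasDerivWithinAt_poseError (T := fun s => (ξ s).1) (A := fun s => (X s).1)
    (b := fun s => (ξ s).2) (a := fun s => (X s).2) (t := t) (hξ.mem t (hJ ht)).1 hA
    (hasDerivWithinAt_mono_matrix (hξ.pose t (hJ ht)) hJ) (hX.ode_group t ht)
  have h2 := hasDerivWithinAt_congr_matrix (g := fun t => (stateError (X t) (ξ t)).1) h1
    (fun s hs => ?_) ht
  · exact h2.continuousWithinAt
  exact congrArg Prod.fst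
    (stateError_eq (det_isUnit_of_mem_SE23 (hX.mem_group s hs)) (X s).2 (ξ s).1 (ξ s).2)

theorem IsObserver.mono {J' : Set ℝ} {y : ℝ → Mat5} (hX : IsObserver g P Q S₀ w τ y J X S)
    (hJ : J' ⊆ J) : IsObserver g P Q S₀ w τ y J' X S where
  init_state := hX.init_state
  init_riccati := hX.init_riccati
  mem_group t ht := hX.mem_group t (hJ ht)
  mem_algebra t ht := hX.mem_algebra t (hJ ht)
  posDef t ht := hX.posDef t (hJ ht)
  mem_logDomain t ht := hX.mem_logDomain t (hJ ht)
  ode_group t ht := hasDerivWithinAt_mono_matrix (hX.ode_group t (hJ ht)) hJ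
  ode_algebra t ht := hasDerivWithinAt_mono_matrix (hX.ode_algebra t (hJ ht)) hJ
  ode_riccati t ht := hasDerivWithinAt_mono_matrix (hX.ode_riccati t (hJ ht)) hJ

theorem IsLocalLog.bounds (hΛ : IsLocalLog r Λ) {E : Mat5} (hE : E ∈ SE23) (h : ‖E - 1‖ < r) :
    ‖logVee E - vee E‖ ≤ 320 * ‖vee E‖ ^ 2 ∧ ‖E - 1 - wedge (vee E)‖ ≤ 320 * ‖vee E‖ ^ 2 := by
  obtain ⟨R, V, rfl, hR, -, -⟩ := exists_of_mem_SE23 hE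
  exact (hΛ.spec R V hR h).2.2.2

/-- The constant bounding the gain `S Cᵀ Q⁻¹` when `S ≤ σ I`. -/
def gainBound (Q : Matrix I9 I9 ℝ) (σ : ℝ) : ℝ := σ * (9 * frobSq (outputMatrixᵀ * Q⁻¹) + 1)

theorem linCoord_outputMatrix (e : Mat5 × Mat5) : outputMatrix *ᵥ linCoord e = vee e.1 :=
  outputMatrix_mulVec _ _

theorem norm_vee_fst_le (e : Mat5 × Mat5) : ‖vee e.1‖ ≤ ‖linCoord e‖ :=
  norm_restrict_inl_le (linCoord e)

theorem norm_vee_snd_le (e : Mat5 × Mat5) : ‖vee e.2‖ ≤ ‖linCoord e‖ :=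
  norm_restrict_inr_le (linCoord e)

/-- As long as the error is small it decays exponentially, at a rate that only depends on an upper
bound of the Riccati matrix. -/
theorem exp_decay_of_small {p₀ q₀ σ ρ t₁ : ℝ} (hΛ : IsLocalLog r Λ) (hp₀ : 0 < p₀) (hσ : 0 < σ)
    (hP : ∀ v, p₀ * (v ⬝ᵥ v) ≤ v ⬝ᵥ (P *ᵥ v)) (hQ : ∀ v, q₀ * (v ⬝ᵥ v) ≤ v ⬝ᵥ (Q⁻¹ *ᵥ v))
    (hρ0 : 0 ≤ ρ) (hρ1 : ρ ≤ 1) (hρ : 144 * remainderConst g (gainBound Q σ) ^ 2 * ρ ≤ p₀ * q₀)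
    (hξ : IsTrajectory g w τ ξ)
    (hX : IsObserver g P Q S₀ w τ (fun t => output (ξ t)) (Icc 0 t₁) X S)
    (hSσ : ∀ s ∈ Icc 0 t₁, ∀ u, u ⬝ᵥ (S s *ᵥ u) ≤ σ * (u ⬝ᵥ u))
    (hsmall : ∀ s ∈ Icc 0 t₁, ‖(stateError (X s) (ξ s)).1 - 1‖ < r ∧
      ‖linCoord (stateError (X s) (ξ s))‖ ≤ ρ) {t : ℝ} (ht : t ∈ Icc 0 t₁) :
    linCoord (stateError (X t) (ξ t)) ⬝ᵥ linCoord (stateError (X t) (ξ t)) ≤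
      σ * (frobSq S₀⁻¹ + 1) * Real.exp (-(p₀ / (2 * σ)) * t) *
        (linCoord (stateError (X 0) (ξ 0)) ⬝ᵥ linCoord (stateError (X 0) (ξ 0))) := by
  have hJ : Icc 0 t₁ ⊆ Ici 0 := Icc_subset_Ici_self
  set c := remainderConst g (gainBound Q σ) with hc
  have hκ0 : 0 ≤ gainBound Q σ := by
    have := frobSq_nonneg (outputMatrixᵀ * Q⁻¹)
    rw [gainBound]; positivity
  have hν : 2 * (72 * c ^ 2 * ρ ^ 2) ≤ p₀ * q₀ := by
    refine le_trans ?_ hρ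
    have e : ρ ^ 2 ≤ ρ := by nlinarith
    have := mul_le_mul_of_nonneg_left e (show 0 ≤ 144 * c ^ 2 by positivity)
    linarith
  have h := exp_decay_of_perturbed_filter (A := fun s => stateMatrix g (w s) (X s))
    (S := S) (C := outputMatrix) (Q := Q) (P := P) hp₀ hσ hP hQ hν hX.posDef hSσ hX.ode_riccati
    (x := fun s => linCoord (stateError (X s) (ξ s)))
    (fun s hs => hasDerivWithinAt_linCoord hξ hX hJ hs) (fun s hs => ?_) ht
  · rw [hX.init_riccati] at h
    exact h
  · obtain ⟨hs1, hs2⟩ := hsmall s hs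
    set e := stateError (X s) (ξ s) with he
    obtain ⟨b1, b2⟩ := hΛ.bounds (stateError_fst_mem hξ hX hJ hs) hs1
    have hv1 := norm_vee_fst_le e
    have hv2 := norm_vee_snd_le e
    have hK : ∀ v, ‖(S s * outputMatrixᵀ * Q⁻¹) *ᵥ v‖ ≤ gainBound Q σ * ‖v‖ := by
      intro v
      rw [Matrix.mul_assoc]
      have := norm_mul_mulVec_le (hX.posDef s hs).posSemidef hσ (hSσ s hs) (outputMatrixᵀ * Q⁻¹) v
      simpa [gainBound] using this
    have hN := norm_remainder_le g (z₂ := vee e.2) hκ0 hK (hv1.trans (hs2.trans hρ1)) b1 b2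
    rw [← hc] at hN
    have hc0 : 0 ≤ c := by
      rw [hc, remainderConst]; positivity
    have hN' : ‖Sum.elim (poseRemainder g (S s * outputMatrixᵀ * Q⁻¹) e.1 (vee e.2) (logVee e.1))
        (biasRemainder (S s * outputMatrixᵀ * Q⁻¹) e.1 (vee e.2) (logVee e.1))‖ ≤
        c * ‖vee e.1‖ * (2 * ρ) :=
      hN.trans (mul_le_mul_of_nonneg_left (by linarith) (by positivity))
    rw [linCoord_outputMatrix]
    refine (dotProduct_self_le_norm_sq _).trans ?_
    have h18 : (Fintype.card I18 : ℝ) = 18 := by norm_num [I18, I9]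
    rw [h18]
    have e1 : ‖Sum.elim (poseRemainder g (S s * outputMatrixᵀ * Q⁻¹) e.1 (vee e.2) (logVee e.1))
        (biasRemainder (S s * outputMatrixᵀ * Q⁻¹) e.1 (vee e.2) (logVee e.1))‖ ^ 2 ≤
        (c * ‖vee e.1‖ * (2 * ρ)) ^ 2 := pow_le_pow_left₀ (norm_nonneg _) hN' 2
    have e2 := mul_le_mul_of_nonneg_left (norm_sq_le_dotProduct_self (vee e.1))
      (show 0 ≤ 72 * c ^ 2 * ρ ^ 2 by positivity)
    calc _ ≤ 18 * (c * ‖vee e.1‖ * (2 * ρ)) ^ 2 := by gcongr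
      _ = 72 * c ^ 2 * ρ ^ 2 * ‖vee e.1‖ ^ 2 := by ring
      _ ≤ _ := e2

/-- For initial errors in a fixed neighbourhood of the origin, every solution of the observer
equations stays away from the boundary of the domain of the equations, and its error decays. -/
theorem exists_apriori_decay (g : Fin 3 → ℝ) (hP : P.PosDef) (hQ : Q.PosDef)
    (S₀ : Matrix I18 I18 ℝ) {T α : ℝ} (β : ℝ) (hT : 0 < T) (hα : 0 < α)
    (hΛ : IsLocalLog r Λ) :
    ∃ δ > 0, δ ≤ r ∧ ∃ C > 0, ∃ c > 0, ∃ σ > 0, ∀ (w τ : ℝ → I9 → ℝ) (ξ : ℝ → Mat5 × Mat5),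
      IsTrajectory g w τ ξ → ‖(stateError (1, 0) (ξ 0)).1 - 1‖ < δ →
      ‖vee (stateError (1, 0) (ξ 0)).2‖ < δ →
      ObservableAlong g P Q S₀ w τ (fun t => output (ξ t)) T α β →
      ∀ (t₁ : ℝ) (X : ℝ → Mat5 × Mat5) (S : ℝ → Matrix I18 I18 ℝ),
      IsObserver g P Q S₀ w τ (fun t => output (ξ t)) (Icc 0 t₁) X S → ∀ t ∈ Icc 0 t₁,
        ‖(stateError (X t) (ξ t)).1 - 1‖ ≤ r / 4 ∧
        ‖linCoord (stateError (X t) (ξ t))‖ ≤ 1 / 640 ∧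
        linCoord (stateError (X t) (ξ t)) ⬝ᵥ linCoord (stateError (X t) (ξ t)) ≤
          C * Real.exp (-c * t) *
            (linCoord (stateError (X 0) (ξ 0)) ⬝ᵥ linCoord (stateError (X 0) (ξ 0))) ∧
        ∀ u, u ⬝ᵥ (S t *ᵥ u) ≤ σ * (u ⬝ᵥ u) := by
  obtain ⟨p₀, hp₀, hP'⟩ := PosDef_coercive hP
  obtain ⟨q₀, hq₀, hQ'⟩ := PosDef_coercive hQ.inv
  obtain ⟨σ, hσ, hσ'⟩ := exists_riccati_upper_bound P hQ S₀ outputMatrix β hT hα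
  have hr := hΛ.pos
  have hr1 := hΛ.le_one
  set c := remainderConst g (gainBound Q σ) with hc
  -- As long as `‖z‖ ≤ ρ`, the bound `hρc` lets the measurement term absorb the remainder, and `hρr`
  -- keeps the pose error well inside the domain of the local logarithm.
  obtain ⟨ρ, hρ0, hρr, hρc⟩ : ∃ ρ > 0, ρ ≤ r / 648 ∧ 144 * c ^ 2 * ρ ≤ p₀ * q₀ := by
    refine ⟨min (r / 648) (p₀ * q₀ / (144 * c ^ 2 + 1)), by positivity, min_le_left _ _, ?_⟩
    refine (mul_le_mul_of_nonneg_left (min_le_right _ _) (by positivity)).trans ?_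
    rw [mul_div_assoc', div_le_iff₀ (by positivity)]
    have : 0 < p₀ * q₀ := by positivity
    nlinarith
  set C := σ * (frobSq S₀⁻¹ + 1) with hC
  have hC0 : 0 < C := by
    have := frobSq_nonneg S₀⁻¹
    positivity
  -- The last bound on the initial error absorbs the overshoot `C` of the exponential decay; `18`
  -- compares the supremum norm with the Euclidean norm.
  refine ⟨min (r / 4) (min (ρ / 2) (ρ / (2 * (18 * C + 1)))), by positivity,
    (min_le_left _ _).trans (by linarith), C, hC0,
    p₀ / (2 * σ), by positivity, σ, hσ, ?_⟩
  intro w τ ξ hξ h1 h2 hobs t₁ X S hX t ht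
  have ht₁ : 0 ≤ t₁ := ht.1.trans ht.2
  have hJ : Icc 0 t₁ ⊆ Ici 0 := Icc_subset_Ici_self
  rw [← hX.init_state] at h1 h2
  have hSσ : ∀ s ∈ Icc 0 t₁, ∀ u, u ⬝ᵥ (S s *ᵥ u) ≤ σ * (u ⬝ᵥ u) := by
    obtain ⟨A, hA, hAeq⟩ := hobs t₁ ht₁ X S hX
    refine hσ' A S t₁ hA hX.init_riccati
      (fun s hs => transpose_eq_of_isHermitian (hX.posDef s hs).isHermitian) fun s hs => ?_
    rw [hAeq s hs]
    exact hX.ode_riccati s hs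
  set e := fun s => stateError (X s) (ξ s) with he
  change ‖(e 0).1 - 1‖ < _ at h1
  change ‖vee (e 0).2‖ < _ at h2
  have hz : ∀ s, ‖linCoord (e s)‖ ≤ max ‖vee (e s).1‖ ‖vee (e s).2‖ := fun s => by
    refine (pi_norm_le_iff_of_nonneg (by positivity)).2 ?_
    rintro (i | i)
    · exact (norm_le_pi_norm (vee (e s).1) i).trans (le_max_left _ _)
    · exact (norm_le_pi_norm (vee (e s).2) i).trans (le_max_right _ _)
  have hv0 : ‖vee (e 0).1‖ ≤ ‖(e 0).1 - 1‖ := by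
    have h := norm_vee_le ((e 0).1 - 1)
    rwa [vee_sub, vee_one, sub_zero] at h
  have hz0 : ‖linCoord (e 0)‖ < min (r / 4) (min (ρ / 2) (ρ / (2 * (18 * C + 1)))) :=
    (hz 0).trans_lt (max_lt (hv0.trans_lt h1) h2)
  have hz01 : ‖linCoord (e 0)‖ ≤ ρ / 2 :=
    (hz0.trans_le ((min_le_right _ _).trans (min_le_left _ _))).le
  have hz02 : ‖linCoord (e 0)‖ ≤ ρ / (2 * (18 * C + 1)) :=
    (hz0.trans_le ((min_le_right _ _).trans (min_le_right _ _))).le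
  have h18 : (Fintype.card I18 : ℝ) = 18 := by norm_num [I18, I9]
  have hdecay : ∀ t ∈ Icc 0 t₁, (∀ s ∈ Icc 0 t, ‖(e s).1 - 1‖ < r ∧ ‖linCoord (e s)‖ ≤ ρ) →
      linCoord (e t) ⬝ᵥ linCoord (e t) ≤ C * Real.exp (-(p₀ / (2 * σ)) * t) *
        (linCoord (e 0) ⬝ᵥ linCoord (e 0)) := fun t ht hs =>
    exp_decay_of_small hΛ hp₀ hσ hP' hQ' hρ0.le (by linarith) hρc hξ
      (hX.mono (Icc_subset_Icc_right ht.2)) (fun s hs => hSσ s ⟨hs.1, hs.2.trans ht.2⟩) hs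
      ⟨ht.1, le_rfl⟩
  -- The error is small when `f ≤ 1`; then the decay estimate improves this to `f ≤ 1 / 2`.
  set f := fun s => max (‖(e s).1 - 1‖ / (r / 2)) (‖linCoord (e s)‖ / ρ) with hf
  have hfc : ContinuousOn f (Icc 0 t₁) := by
    have c1 : ContinuousOn (fun s => (e s).1) (Icc 0 t₁) := continuousOn_stateError_fst hξ hX hJ
    have c2 : ContinuousOn (fun s => linCoord (e s)) (Icc 0 t₁) := fun s hs =>
      (hasDerivWithinAt_linCoord hξ hX hJ hs).continuousWithinAt
    exact ((c1.sub continuousOn_const).norm.div_const _).sup (c2.norm.div_const _)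
  have hf1 : ∀ s a, 0 ≤ a → (f s ≤ a ↔ ‖(e s).1 - 1‖ ≤ a * (r / 2) ∧ ‖linCoord (e s)‖ ≤ a * ρ) := by
    intro s a _
    rw [hf]
    simp only [max_le_iff]
    rw [div_le_iff₀ (by positivity), div_le_iff₀ hρ0]
  have hboot := bootstrap_Icc hfc ?_ ?_
  · have hsm : ∀ s ∈ Icc 0 t₁, ‖(e s).1 - 1‖ ≤ 1 / 2 * (r / 2) ∧ ‖linCoord (e s)‖ ≤ 1 / 2 * ρ :=
      fun s hs => (hf1 s _ (by norm_num)).1 (hboot s hs)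
    refine ⟨?_, ?_, ?_, hSσ t ht⟩
    · linarith [(hsm t ht).1]
    · have := (hsm t ht).2
      change ‖linCoord (e t)‖ ≤ _
      linarith
    · refine hdecay t ht fun s hs => ?_
      have := hsm s ⟨hs.1, hs.2.trans ht.2⟩
      exact ⟨by linarith [this.1], by linarith [this.2]⟩
  · rw [hf1 0 _ (by norm_num)]
    have := h1.le.trans (min_le_left _ _)
    exact ⟨by linarith, by linarith⟩
  · intro t ht hs
    have hs' : ∀ s ∈ Icc 0 t, ‖(e s).1 - 1‖ < r ∧ ‖linCoord (e s)‖ ≤ ρ := fun s hst => by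
      have := (hf1 s 1 zero_le_one).1 (hs s hst)
      exact ⟨by linarith [this.1], by linarith [this.2]⟩
    have hd := hdecay t ht hs'
    have hexp : Real.exp (-(p₀ / (2 * σ)) * t) ≤ 1 := by
      rw [Real.exp_le_one_iff]
      have : 0 < p₀ / (2 * σ) := by positivity
      nlinarith [ht.1]
    have hzt : ‖linCoord (e t)‖ ≤ ρ / 2 := by
      rw [← sq_le_sq₀ (norm_nonneg _) (by positivity)]
      refine (norm_sq_le_dotProduct_self _).trans (hd.trans ?_)
      have a1 : linCoord (e 0) ⬝ᵥ linCoord (e 0) ≤ 18 * (ρ / (2 * (18 * C + 1))) ^ 2 := by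
        refine (dotProduct_self_le_norm_sq _).trans ?_
        rw [h18]
        gcongr
      have a0 := dotProduct_self_nonneg_real (linCoord (e 0))
      have a2 : C * Real.exp (-(p₀ / (2 * σ)) * t) ≤ C := by nlinarith
      calc _ ≤ C * (18 * (ρ / (2 * (18 * C + 1))) ^ 2) := mul_le_mul a2 a1 a0 hC0.le
        _ = (ρ / 2) ^ 2 * (18 * C / (18 * C + 1) ^ 2) := by field_simp
        _ ≤ (ρ / 2) ^ 2 * 1 := by
          gcongr
          rw [div_le_one (by positivity)]
          nlinarith
        _ = _ := mul_one _
    have hE := (hΛ.bounds (stateError_fst_mem hξ hX hJ ht) (hs' t ⟨ht.1, le_rfl⟩).1).2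
    change ‖(e t).1 - 1 - wedge (vee (e t).1)‖ ≤ 320 * ‖vee (e t).1‖ ^ 2 at hE
    have hv : ‖vee (e t).1‖ ≤ ρ / 2 := (norm_vee_fst_le (e t)).trans hzt
    rw [hf1 t _ (by norm_num)]
    refine ⟨?_, by linarith⟩
    have hw := norm_wedge_le (vee (e t).1)
    have htri : ‖(e t).1 - 1‖ ≤ ‖(e t).1 - 1 - wedge (vee (e t).1)‖ + ‖wedge (vee (e t).1)‖ := by
      have := norm_add_le ((e t).1 - 1 - wedge (vee (e t).1)) (wedge (vee (e t).1))
      rwa [sub_add_cancel] at this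
    have hv0 := norm_nonneg (vee (e t).1)
    nlinarith

end APriori

/-! ### Global solutions of ordinary differential equations -/

section GlobalODE

variable {D E : Type*} [NormedAddCommGroup D] [NormedSpace ℝ D] [NormedAddCommGroup E]
  [NormedSpace ℝ E] [FiniteDimensional ℝ E]

/-- A `C¹` vector field with parameters can be cut off outside a neighbourhood of a compact subset
of its domain. -/
theorem exists_cutoff {G : D × E → E} {Ω K : Set E} (hΩ : IsOpen Ω)
    (hG : ContDiffOn ℝ 1 G (univ ×ˢ Ω)) (hK : IsCompact K) (hKΩ : K ⊆ Ω) :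
    ∃ H : D × E → E, ContDiff ℝ 1 H ∧
      (∃ η > 0, Metric.cthickening η K ⊆ Ω ∧ ∀ d, ∀ y ∈ Metric.cthickening η K, H (d, y) = G (d, y)) ∧
      ∃ Z, IsCompact Z ∧ ∀ d, ∀ y ∉ Z, H (d, y) = 0 := by
  obtain ⟨η, hη, hηΩ⟩ := hK.exists_cthickening_subset_open hΩ hKΩ
  have hZ : IsCompact (Metric.cthickening η K) := hK.cthickening
  have hsub : Metric.cthickening (η / 2) K ⊆ interior (Metric.cthickening η K) :=
    (Metric.cthickening_subset_thickening' hη (by linarith) K).trans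
      (interior_maximal (Metric.thickening_subset_cthickening η K) Metric.isOpen_thickening)
  obtain ⟨χ, h1, h0, -⟩ := exists_contMDiffMap_one_nhds_of_subset_interior
    (modelWithCornersSelf ℝ E) (n := 1) (Metric.isClosed_cthickening (δ := η / 2) (E := K)) hsub
  have hχ : ContDiff ℝ 1 (χ : E → ℝ) := χ.contMDiff.contDiff
  refine ⟨fun p => χ p.2 • G p, ?_, ⟨η / 2, by positivity, ?_, ?_⟩, Metric.cthickening η K, hZ, ?_⟩
  · rw [contDiff_iff_contDiffAt]
    rintro ⟨d, y⟩
    by_cases hy : y ∈ Ω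
    · have hGa : ContDiffAt ℝ 1 G (d, y) :=
        hG.contDiffAt ((isOpen_univ.prod hΩ).mem_nhds ⟨mem_univ _, hy⟩)
      exact (hχ.contDiffAt.comp (d, y) contDiffAt_snd).smul hGa
    · have hev : (fun p : D × E => χ p.2 • G p) =ᶠ[𝓝 (d, y)] fun _ => 0 := by
        have ho : IsOpen {p : D × E | p.2 ∉ Metric.cthickening η K} :=
          (Metric.isClosed_cthickening.isOpen_compl).preimage continuous_snd
        filter_upwards [ho.mem_nhds (show (d, y) ∈ {p : D × E | p.2 ∉ Metric.cthickening η K} from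
          fun h => hy (hηΩ h))] with p hp
        rw [h0 _ hp, zero_smul]
      exact contDiffAt_const.congr_of_eventuallyEq hev
  · exact (hsub.trans interior_subset).trans hηΩ
  · intro d y hy
    simp only [h1.self_of_nhdsSet y hy, one_smul]
  · intro d y hy
    simp only [h0 y hy, zero_smul]

/-- On a bounded interval the equation with the cut-off field has a solution by the Picard–Lindelöf
theorem.  It cannot leave `K`: up to the first exit time from the region where the cut-off field
agrees with `G`, it solves the original equation, so the a priori bound applies to it. -/
theorem exists_global_solution_Icc {G : D × E → E} {Ω K : Set E} {c : ℝ → D} {y₀ : E} (hΩ : IsOpen Ω)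
    (hG : ContDiffOn ℝ 1 G (univ ×ˢ Ω)) (hK : IsCompact K) (hKΩ : K ⊆ Ω)
    (hc : ContinuousOn c (Ici 0)) (hy₀ : y₀ ∈ K)
    (hap : ∀ (t₁ : ℝ) (y : ℝ → E), y 0 = y₀ →
      (∀ t ∈ Icc 0 t₁, y t ∈ Ω ∧ HasDerivWithinAt y (G (c t, y t)) (Icc 0 t₁) t) →
      ∀ t ∈ Icc 0 t₁, y t ∈ K) {N : ℝ} (hN : 0 ≤ N) :
    ∃ (y : ℝ → E) (M : NNReal), y 0 = y₀ ∧
      (∀ t ∈ Icc 0 N, y t ∈ K ∧ HasDerivWithinAt y (G (c t, y t)) (Icc 0 N) t) ∧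
      ∀ t ∈ Icc 0 N, LipschitzOnWith M (fun x => G (c t, x)) K := by
  obtain ⟨H, hH, ⟨η, hη, hηΩ, hHG⟩, Z, hZ, hHZ⟩ := exists_cutoff hΩ hG hK hKΩ
  have hcN : ContinuousOn c (Icc 0 N) := hc.mono Icc_subset_Ici_self
  have hcc : IsCompact (c '' Icc 0 N) := isCompact_Icc.image_of_continuousOn hcN
  obtain ⟨L, hL⟩ := ((hcc.prod hZ).image hH.continuous).isBounded.exists_norm_le
  obtain ⟨L', hL'0, hL'⟩ : ∃ L' : ℝ, 0 ≤ L' ∧ ∀ t ∈ Icc 0 N, ∀ x, ‖H (c t, x)‖ ≤ L' := by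
    refine ⟨max L 0, le_max_right _ _, fun t ht x => ?_⟩
    by_cases hx : x ∈ Z
    · exact (hL _ ⟨(c t, x), ⟨⟨t, ht, rfl⟩, hx⟩, rfl⟩).trans (le_max_left _ _)
    · rw [hHZ _ _ hx, norm_zero]
      exact le_max_right _ _
  obtain ⟨R, hR0, hR⟩ := hK.isBounded.subset_closedBall_lt 0 y₀
  obtain ⟨a, haR, haL⟩ : ∃ a : ℝ, R ≤ a ∧ L' * N ≤ a := ⟨max R (L' * N), le_max_left _ _, le_max_right _ _⟩
  have ha0 : 0 ≤ a := hR0.le.trans haR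
  have hball : IsCompact (Metric.closedBall y₀ a) := isCompact_closedBall y₀ a
  obtain ⟨M, hM⟩ := ((hcc.prod hball).image (hH.continuous_fderiv one_ne_zero)).isBounded.exists_norm_le
  have hlip : ∀ t ∈ Icc 0 N, LipschitzOnWith (Real.toNNReal M) (fun x => H (c t, x))
      (Metric.closedBall y₀ a) := by
    intro t ht
    have hd : ∀ x, HasFDerivAt (fun x => H (c t, x))
        ((fderiv ℝ H (c t, x)).comp (ContinuousLinearMap.inr ℝ D E)) x := fun x =>
      (hH.differentiable one_ne_zero (c t, x)).hasFDerivAt.comp x (hasFDerivAt_prodMk_right (c t) x)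
    refine (convex_closedBall y₀ a).lipschitzOnWith_of_nnnorm_hasFDerivWithin_le
      (fun x _ => (hd x).hasFDerivWithinAt) fun x hx => ?_
    rw [← NNReal.coe_le_coe, coe_nnnorm]
    have h1 : ‖fderiv ℝ H (c t, x)‖ ≤ M := hM _ ⟨(c t, x), ⟨⟨t, ht, rfl⟩, hx⟩, rfl⟩
    refine ((ContinuousLinearMap.opNorm_comp_le _ _).trans ?_).trans (Real.le_coe_toNNReal M)
    have h2 := ContinuousLinearMap.norm_inr_le_one ℝ D E
    have h3 := mul_le_mul h1 h2 (norm_nonneg _) ((norm_nonneg _).trans h1)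
    linarith
  have hPL : IsPicardLindelof (fun t x => H (c t, x)) (⟨0, left_mem_Icc.2 hN⟩ : Icc 0 N) y₀
      (Real.toNNReal a) 0 (Real.toNNReal L') (Real.toNNReal M) := by
    refine ⟨fun t ht => ?_, fun x _ => ?_, fun t ht x _ => ?_, ?_⟩
    · rw [Real.coe_toNNReal _ ha0]
      exact hlip t ht
    · exact hH.continuous.comp_continuousOn (hcN.prodMk continuousOn_const)
    · rw [Real.coe_toNNReal _ hL'0]
      exact hL' t ht x
    · rw [Real.coe_toNNReal _ ha0, Real.coe_toNNReal _ hL'0]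
      simp only [sub_zero, NNReal.coe_zero, sub_self]
      rw [max_eq_left hN]
      exact haL
  obtain ⟨y, hy0, hy⟩ := hPL.exists_eq_forall_mem_Icc_hasDerivWithinAt₀
  change y 0 = y₀ at hy0
  have hycont : ContinuousOn y (Icc 0 N) := fun t ht => (hy t ht).continuousWithinAt
  have hnear : ∀ t ∈ Icc 0 N, Metric.infDist (y t) K / η ≤ 1 → y t ∈ Metric.cthickening η K := by
    intro t _ h
    rw [div_le_one hη] at h
    rw [Metric.mem_cthickening_iff, ENNReal.le_ofReal_iff_toReal_le
      (Metric.infEDist_ne_top ⟨y₀, hy₀⟩) hη.le]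
    exact h
  have hsol : ∀ t ∈ Icc 0 N, (∀ s ∈ Icc 0 t, Metric.infDist (y s) K / η ≤ 1) →
      (∀ s ∈ Icc 0 t, y s ∈ K) := by
    intro t ht hs
    refine hap t y hy0 fun s hst => ?_
    have hsN : s ∈ Icc 0 N := ⟨hst.1, hst.2.trans ht.2⟩
    have h1 := hnear s hsN (hs s hst)
    refine ⟨hηΩ h1, ?_⟩
    rw [← hHG _ _ h1]
    exact (hy s hsN).mono (Icc_subset_Icc_right ht.2)
  have hboot := bootstrap_Icc (f := fun t => Metric.infDist (y t) K / η) (t₁ := N)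
    (((Metric.continuous_infDist_pt K).comp_continuousOn hycont).div_const η)
    (by simp [hy0, Metric.infDist_zero_of_mem hy₀])
    (fun t ht hs => by
      simp only [Metric.infDist_zero_of_mem (hsol t ht hs t ⟨ht.1, le_rfl⟩)]; norm_num)
  have hyK : ∀ t ∈ Icc 0 N, y t ∈ K := hsol N ⟨hN, le_rfl⟩ fun s hs => (hboot s hs).trans (by norm_num)
  refine ⟨y, Real.toNNReal M, hy0, fun t ht => ⟨hyK t ht, ?_⟩, fun t ht => ?_⟩
  · rw [← hHG _ _ (Metric.self_subset_cthickening K (hyK t ht))]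
    exact hy t ht
  · have := (hlip t ht).mono (hR.trans (Metric.closedBall_subset_closedBall haR))
    intro x hx z hz
    have h := this hx hz
    simp only [hHG _ _ (Metric.self_subset_cthickening K hx),
      hHG _ _ (Metric.self_subset_cthickening K hz)] at h
    exact h

/-- A solution that stays in a compact part of the domain of the equation for as long as it exists,
exists for all time. -/
theorem exists_global_solution {G : D × E → E} {Ω K : Set E} {c : ℝ → D} {y₀ : E} (hΩ : IsOpen Ω)
    (hG : ContDiffOn ℝ 1 G (univ ×ˢ Ω)) (hK : IsCompact K) (hKΩ : K ⊆ Ω)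
    (hc : ContinuousOn c (Ici 0)) (hy₀ : y₀ ∈ K)
    (hap : ∀ (t₁ : ℝ) (y : ℝ → E), y 0 = y₀ →
      (∀ t ∈ Icc 0 t₁, y t ∈ Ω ∧ HasDerivWithinAt y (G (c t, y t)) (Icc 0 t₁) t) →
      ∀ t ∈ Icc 0 t₁, y t ∈ K) :
    ∃ y : ℝ → E, y 0 = y₀ ∧
      ∀ t ∈ Ici 0, y t ∈ Ω ∧ HasDerivWithinAt y (G (c t, y t)) (Ici 0) t := by
  have hex := fun N : ℕ => exists_global_solution_Icc hΩ hG hK hKΩ hc hy₀ hap (N := N)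
    (Nat.cast_nonneg N)
  choose Y M hY0 hY hM using hex
  have hagree : ∀ m n : ℕ, m ≤ n → EqOn (Y m) (Y n) (Icc 0 m) := by
    intro m n hmn
    have hmn' : (m : ℝ) ≤ n := by exact_mod_cast hmn
    have hd : ∀ {k : ℕ}, (m : ℝ) ≤ k → ∀ t ∈ Ico (0 : ℝ) m,
        HasDerivWithinAt (Y k) (G (c t, Y k t)) (Ici t) t := by
      intro k hk t ht
      refine ((hY k t ⟨ht.1, ht.2.le.trans hk⟩).2).mono_of_mem_nhdsWithin ?_
      exact mem_of_superset (Icc_mem_nhdsGE (ht.2.trans_le hk)) (Icc_subset_Icc_left ht.1)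
    exact ODE_solution_unique_of_mem_Icc_right (v := fun t x => G (c t, x)) (s := fun _ => K)
      (fun t ht => hM m t ⟨ht.1, ht.2.le⟩)
      (fun t ht => ((hY m t ht).2).continuousWithinAt) (hd le_rfl)
      (fun t ht => (hY m t ⟨ht.1, ht.2.le⟩).1)
      (fun t ht => (((hY n t ⟨ht.1, ht.2.trans hmn'⟩).2).continuousWithinAt).mono
        (Icc_subset_Icc_right hmn')) (hd hmn')
      (fun t ht => (hY n t ⟨ht.1, ht.2.le.trans hmn'⟩).1) ((hY0 m).trans (hY0 n).symm)
  have heq : ∀ (n : ℕ) (t : ℝ), t ∈ Ico (0 : ℝ) n → Y (⌊t⌋₊ + 1) t = Y n t := by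
    intro n t ht
    refine hagree _ n ?_ ⟨ht.1, ?_⟩
    · exact Nat.succ_le_of_lt ((Nat.floor_lt ht.1).2 ht.2)
    · push_cast
      exact (Nat.lt_floor_add_one t).le
  refine ⟨fun t => Y (⌊t⌋₊ + 1) t, hY0 _, fun t ht => ?_⟩
  obtain ⟨n, hn⟩ := exists_nat_gt t
  have htn : t ∈ Ico (0 : ℝ) n := ⟨ht, hn⟩
  have h := hY n t ⟨ht, hn.le⟩
  beta_reduce
  rw [heq n t htn]
  refine ⟨hKΩ h.1, ?_⟩
  have hnhds : Ico (0 : ℝ) n ∈ 𝓝[Ici 0] t := by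
    rw [← Ici_inter_Iio]
    exact inter_mem_nhdsWithin _ (Iio_mem_nhds hn)
  have h2 : HasDerivWithinAt (Y n) (G (c t, Y n t)) (Ici 0) t :=
    h.2.mono_of_mem_nhdsWithin (mem_of_superset hnhds Ico_subset_Icc_self)
  refine h2.congr_of_eventuallyEq ?_ (heq n t htn)
  filter_upwards [hnhds] with s hs using heq n s hs

end GlobalODE

/-! ### Positive definiteness of solutions of the Riccati equation -/

section RiccatiPosDef

variable {n : Type*} [Fintype n]

theorem posDef_of_forall_unit {S : Matrix n n ℝ} (hs : Sᵀ = S)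
    (h : ∀ u : n → ℝ, u ⬝ᵥ u = 1 → 0 < u ⬝ᵥ (S *ᵥ u)) : S.PosDef := by
  refine Matrix.PosDef.of_dotProduct_mulVec_pos (by rw [Matrix.IsHermitian, conjTranspose_eq_transpose_of_trivial, hs])
    fun x hx => ?_
  rw [star_trivial]
  have hxx : 0 < x ⬝ᵥ x := lt_of_le_of_ne (dotProduct_self_nonneg_real x)
    fun h => hx (dotProduct_self_eq_zero.1 h.symm)
  set k := Real.sqrt (x ⬝ᵥ x) with hk
  have hk0 : 0 < k := Real.sqrt_pos.2 hxx
  have hkk : k * k = x ⬝ᵥ x := Real.mul_self_sqrt hxx.le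
  have h1 := h (k⁻¹ • x) (by
    rw [smul_dotProduct, dotProduct_smul, ← hkk, smul_eq_mul, smul_eq_mul]
    field_simp)
  rw [Matrix.mulVec_smul, smul_dotProduct, dotProduct_smul, smul_eq_mul, smul_eq_mul] at h1
  have h2 := mul_pos (mul_pos hk0 hk0) h1
  have e : k * k * (k⁻¹ * (k⁻¹ * (x ⬝ᵥ S *ᵥ x))) = x ⬝ᵥ S *ᵥ x := by field_simp
  rwa [e] at h2

theorem isCompact_unitSphere_dotProduct : IsCompact {u : n → ℝ | u ⬝ᵥ u = 1} := by
  refine Metric.isCompact_of_isClosed_isBounded ?_ ?_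
  · exact isClosed_eq (by unfold dotProduct; fun_prop) continuous_const
  · refine Metric.isBounded_iff_subset_closedBall 0 |>.2 ⟨1, fun u hu => ?_⟩
    rw [mem_closedBall_zero_iff]
    have := norm_sq_le_dotProduct_self u
    rw [show u ⬝ᵥ u = 1 from hu] at this
    nlinarith [norm_nonneg u]

/-- A symmetric solution of the Riccati equation that starts positive definite stays so: at the
first time at which some direction `u` became isotropic, `S u = 0` and `uᵀ S u` would increase at
the rate `uᵀ P u > 0`. -/
theorem posDef_of_riccati [DecidableEq n] {A : ℝ → Matrix n n ℝ} {B P : Matrix n n ℝ} (hP : P.PosDef)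
    {S : ℝ → Matrix n n ℝ} {t₁ : ℝ} (h0 : (S 0).PosDef) (hs : ∀ t ∈ Icc 0 t₁, (S t)ᵀ = S t)
    (hS : ∀ t ∈ Icc 0 t₁, HasDerivWithinAt S (A t * S t + S t * (A t)ᵀ + P - S t * B * S t)
      (Icc 0 t₁) t) : ∀ t ∈ Icc 0 t₁, (S t).PosDef := by
  have hder : ∀ u : n → ℝ, ∀ t ∈ Icc 0 t₁, HasDerivWithinAt (fun t => u ⬝ᵥ (S t *ᵥ u))
      (u ⬝ᵥ ((A t * S t + S t * (A t)ᵀ + P - S t * B * S t) *ᵥ u)) (Icc 0 t₁) t := by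
    intro u t ht
    have h := hasDerivWithinAt_dotProduct (hasDerivWithinAt_const t (Icc 0 t₁) u)
      (hasDerivWithinAt_mulVec (hS t ht) (hasDerivWithinAt_const t (Icc 0 t₁) u))
    simpa using h
  set F : Set (ℝ × (n → ℝ)) := {p | p ∈ Icc 0 t₁ ×ˢ {u : n → ℝ | u ⬝ᵥ u = 1} ∧
    p.2 ⬝ᵥ (S p.1 *ᵥ p.2) ∈ Iic 0} with hF
  have hSc : ContinuousOn S (Icc 0 t₁) := continuousOn_of_hasDerivWithinAt_matrix hS
  have hQc : ContinuousOn (fun p : ℝ × (n → ℝ) => p.2 ⬝ᵥ (S p.1 *ᵥ p.2))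
      (Icc 0 t₁ ×ˢ {u : n → ℝ | u ⬝ᵥ u = 1}) := by
    have h1 : ContinuousOn (fun p : ℝ × (n → ℝ) => S p.1) (Icc 0 t₁ ×ˢ {u : n → ℝ | u ⬝ᵥ u = 1}) :=
      hSc.comp continuousOn_fst fun p hp => hp.1
    have h2 : ∀ i j, ContinuousOn (fun p : ℝ × (n → ℝ) => S p.1 i j)
        (Icc 0 t₁ ×ˢ {u : n → ℝ | u ⬝ᵥ u = 1}) := fun i j =>
      (continuous_apply_apply i j).comp_continuousOn h1
    simp only [dotProduct, Matrix.mulVec]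
    refine continuousOn_finsetSum _ fun i _ => ContinuousOn.mul (by fun_prop) ?_
    exact continuousOn_finsetSum _ fun j _ => (h2 i j).mul (by fun_prop)
  have hFc : IsCompact F := by
    have hcomp := isCompact_Icc.prod (isCompact_unitSphere_dotProduct (n := n)) (s := Icc 0 t₁)
    exact hcomp.of_isClosed_subset
      (hQc.preimage_isClosed_of_isClosed hcomp.isClosed isClosed_Iic) fun p hp => hp.1
  have hFe : F = ∅ := by
    by_contra hne
    obtain ⟨t, hmem, hmin⟩ := (hFc.image continuous_fst).exists_isLeast
      ((nonempty_iff_ne_empty.2 hne).image _)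
    obtain ⟨⟨t', u⟩, ⟨⟨ht, hu⟩, hneg⟩, rfl⟩ := hmem
    replace hu : u ⬝ᵥ u = 1 := hu
    replace hneg : u ⬝ᵥ (S t' *ᵥ u) ≤ 0 := hneg
    replace ht : t' ∈ Icc 0 t₁ := ht
    have hbefore : ∀ s ∈ Ico 0 t', (S s).PosDef := by
      intro s hst
      have hs1 : s ∈ Icc 0 t₁ := ⟨hst.1, hst.2.le.trans ht.2⟩
      refine posDef_of_forall_unit (hs s hs1) fun v hv => ?_
      by_contra hcon
      have h := hmin (mem_image_of_mem Prod.fst (show (s, v) ∈ F from ⟨⟨hs1, hv⟩, not_lt.1 hcon⟩))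
      exact absurd hst.2 (not_lt.2 h)
    have hnn : ∀ (M : Matrix n n ℝ), M.PosDef → ∀ v : n → ℝ, 0 ≤ v ⬝ᵥ (M *ᵥ v) := fun M hM v => by
      simpa using hM.posSemidef.dotProduct_mulVec_nonneg v
    have ht0 : 0 < t' := by
      refine lt_of_le_of_ne ht.1 fun h => ?_
      have hu0 : u ≠ 0 := fun h => by simp [h] at hu
      have := h0.dotProduct_mulVec_pos hu0
      rw [star_trivial, h] at this
      linarith
    have hsub : Ico 0 t' ⊆ Icc 0 t₁ := fun s hst => ⟨hst.1, hst.2.le.trans ht.2⟩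
    have hbot : (𝓝[Ico 0 t'] t').NeBot := by
      rw [← mem_closure_iff_nhdsWithin_neBot, closure_Ico ht0.ne]
      exact right_mem_Icc.2 ht0.le
    have hpsd : (S t').PosSemidef := by
      refine Matrix.PosSemidef.of_dotProduct_mulVec_nonneg
        (by rw [Matrix.IsHermitian, conjTranspose_eq_transpose_of_trivial, hs t' ht]) fun v => ?_
      rw [star_trivial]
      exact ge_of_tendsto (((hder v t' ht).continuousWithinAt.mono hsub).tendsto)
        (eventually_mem_nhdsWithin.mono fun s hst => hnn _ (hbefore s hst) v)
    have hzero : u ⬝ᵥ (S t' *ᵥ u) = 0 :=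
      le_antisymm hneg (by simpa using hpsd.dotProduct_mulVec_nonneg u)
    have hSu : S t' *ᵥ u = 0 := by
      have h := posSemidef_cauchySchwarz hpsd (S t' *ᵥ u) u
      rw [hzero, mul_zero] at h
      exact dotProduct_self_eq_zero.1 (pow_eq_zero_iff two_ne_zero |>.1 (le_antisymm h (sq_nonneg _)))
    have huS : ∀ M : Matrix n n ℝ, u ⬝ᵥ ((S t' * M) *ᵥ u) = 0 := fun M => by
      rw [← Matrix.mulVec_mulVec, ← hs t' ht, ← mulVec_dotProduct, hSu, zero_dotProduct]
    have hSu' : ∀ M : Matrix n n ℝ, u ⬝ᵥ ((M * S t') *ᵥ u) = 0 := fun M => by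
      rw [← Matrix.mulVec_mulVec, hSu, Matrix.mulVec_zero, dotProduct_zero]
    have hd := (hder u t' ht).mono hsub
    have hval : u ⬝ᵥ ((A t' * S t' + S t' * (A t')ᵀ + P - S t' * B * S t') *ᵥ u) =
        u ⬝ᵥ (P *ᵥ u) := by
      simp only [Matrix.sub_mulVec, Matrix.add_mulVec, dotProduct_sub, dotProduct_add, huS, hSu']
      ring
    rw [hval] at hd
    have hPu : 0 < u ⬝ᵥ (P *ᵥ u) := by
      have hu0 : u ≠ 0 := fun h => by simp [h] at hu
      simpa using hP.dotProduct_mulVec_pos hu0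
    have hslope := hasDerivWithinAt_iff_tendsto_slope.1 hd
    have hdiff : Ico 0 t' \ {t'} = Ico 0 t' := sdiff_singleton_eq_self fun h => lt_irrefl _ h.2
    rw [hdiff] at hslope
    have hle : u ⬝ᵥ (P *ᵥ u) ≤ 0 :=
      le_of_tendsto hslope (eventually_mem_nhdsWithin.mono fun s hst => by
        rw [slope_def_field, hzero, sub_zero]
        exact div_nonpos_of_nonneg_of_nonpos (hnn _ (hbefore s hst) u) (sub_nonpos.2 hst.2.le))
    linarith
  intro t ht
  refine posDef_of_forall_unit (hs t ht) fun u hu => ?_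
  by_contra hcon
  have : (t, u) ∈ F := ⟨⟨ht, hu⟩, not_lt.1 hcon⟩
  rw [hFe] at this
  exact this

end RiccatiPosDef

/-! ### The error equations as an ordinary differential equation -/

section ErrorField

/-- The coordinates `(R, V, e₂^∨, Σ)` of the error `([R V; 0 1], e₂)` and of the Riccati matrix. -/
abbrev ErrorState :=
  Matrix (Fin 3) (Fin 3) ℝ × Matrix (Fin 3) (Fin 2) ℝ × (I9 → ℝ) × Matrix I18 I18 ℝ

/-- The pose error `[R V; 0 1]`. -/
def errPose (y : ErrorState) : Mat5 := fromBlocks y.1 y.2.1 0 1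

/-- A polynomial expression for the inverse of the pose error. -/
def errPoseInv (y : ErrorState) : Mat5 := fromBlocks y.1ᵀ (-(y.1ᵀ * y.2.1)) 0 1

/-- The pose component of the innovation, for the local logarithm `Λ`. -/
def errInnovation₁ (Q : Matrix I9 I9 ℝ) (Λ : (I9 → ℝ) → (I9 → ℝ)) (y : ErrorState) : Mat5 :=
  wedge fun i => ((y.2.2.2 * outputMatrixᵀ * Q⁻¹) *ᵥ Λ (vee (errPose y))) (Sum.inl i)

/-- The bias component of the innovation, for the local logarithm `Λ`. -/
def errInnovation₂ (Q : Matrix I9 I9 ℝ) (Λ : (I9 → ℝ) → (I9 → ℝ)) (y : ErrorState) : Mat5 :=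
  -wedge fun i => ((y.2.2.2 * outputMatrixᵀ * Q⁻¹) *ᵥ Λ (vee (errPose y))) (Sum.inr i)

/-- The observer velocity in the fixed frame, expressed through the error and the parameters
`p = (T, Ad_T (w - b))`. -/
def errVelocity (g : Fin 3 → ℝ) (p : Mat5 × Mat5) (y : ErrorState) : Mat5 :=
  errPoseInv y * p.2 * errPose y + wedge y.2.2.1 + gravity g + drift (errPoseInv y * p.1)

/-- The velocity of the pose error. -/
def errPoseField (g : Fin 3 → ℝ) (Q : Matrix I9 I9 ℝ) (Λ : (I9 → ℝ) → (I9 → ℝ))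
    (y : ErrorState) : Mat5 :=
  drift (errPose y) - errPose y * wedge y.2.2.1 + gravity g * errPose y - errPose y * gravity g
    - errPose y * errInnovation₁ Q Λ y

/-- The linearized state matrix, expressed through the error and the parameters. -/
def errStateMatrix (g : Fin 3 → ℝ) (p : Mat5 × Mat5) (y : ErrorState) : Matrix I18 I18 ℝ :=
  fromBlocks (upsilon g) (-1) 0 (adMatrix (errVelocity g p y))

/-- The vector field of the errors and the Riccati matrix.  The Riccati equation is arranged so that
its right-hand side is symmetric even where the Riccati matrix is not. -/
def errField (g : Fin 3 → ℝ) (P : Matrix I18 I18 ℝ) (Q : Matrix I9 I9 ℝ)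
    (Λ : (I9 → ℝ) → (I9 → ℝ)) (q : (Mat5 × Mat5) × ErrorState) : ErrorState :=
  ((errPoseField g Q Λ q.2).toBlocks₁₁, (errPoseField g Q Λ q.2).toBlocks₁₂,
    vee (ad (errVelocity g q.1 q.2 + errInnovation₁ Q Λ q.2) (wedge q.2.2.2.1)
      + errInnovation₂ Q Λ q.2),
    errStateMatrix g q.1 q.2 * q.2.2.2.2 + (errStateMatrix g q.1 q.2 * q.2.2.2.2)ᵀ + P
      - q.2.2.2.2ᵀ * (outputMatrixᵀ * Q⁻¹ * outputMatrix) * q.2.2.2.2)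

end ErrorField

section Smoothness

attribute [local instance] Matrix.normedAddCommGroup Matrix.normedSpace

variable {F : Type*} [NormedAddCommGroup F] [NormedSpace ℝ F] {s : Set F}
variable {l m n p : Type*} [Fintype l] [Fintype m] [Fintype n] [Fintype p]

theorem contDiffOn_matrix {f : F → Matrix m n ℝ} :
    ContDiffOn ℝ 1 f s ↔ ∀ i j, ContDiffOn ℝ 1 (fun x => f x i j) s :=
  Iff.trans (contDiffOn_pi (Φ := fun x i => f x i)) (forall_congr' fun _ => contDiffOn_pi)

theorem contDiffOn_mul_matrix {f : F → Matrix l m ℝ} {g : F → Matrix m n ℝ}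
    (hf : ContDiffOn ℝ 1 f s) (hg : ContDiffOn ℝ 1 g s) :
    ContDiffOn ℝ 1 (fun x => f x * g x) s := by
  rw [contDiffOn_matrix] at *
  exact fun i j => ContDiffOn.sum fun k _ => (hf i k).mul (hg k j)

theorem contDiffOn_mulVec {f : F → Matrix m n ℝ} {v : F → n → ℝ}
    (hf : ContDiffOn ℝ 1 f s) (hv : ContDiffOn ℝ 1 v s) :
    ContDiffOn ℝ 1 (fun x => f x *ᵥ v x) s := by
  rw [contDiffOn_matrix] at hf
  rw [contDiffOn_pi] at *
  exact fun i => ContDiffOn.sum fun k _ => (hf i k).mul (hv k)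

theorem contDiffOn_transpose {f : F → Matrix m n ℝ} (hf : ContDiffOn ℝ 1 f s) :
    ContDiffOn ℝ 1 (fun x => (f x)ᵀ) s := by
  rw [contDiffOn_matrix] at *
  exact fun i j => hf j i

theorem contDiffOn_fromBlocks {a : F → Matrix m n ℝ} {b : F → Matrix m p ℝ} {c : F → Matrix l n ℝ}
    {d : F → Matrix l p ℝ} (ha : ContDiffOn ℝ 1 a s) (hb : ContDiffOn ℝ 1 b s)
    (hc : ContDiffOn ℝ 1 c s) (hd : ContDiffOn ℝ 1 d s) :
    ContDiffOn ℝ 1 (fun x => fromBlocks (a x) (b x) (c x) (d x)) s := by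
  rw [contDiffOn_matrix] at *
  rintro (i | i) (j | j)
  · exact ha i j
  · exact hb i j
  · exact hc i j
  · exact hd i j

theorem contDiffOn_toBlocks₁₁ {f : F → Matrix (m ⊕ l) (n ⊕ p) ℝ} (hf : ContDiffOn ℝ 1 f s) :
    ContDiffOn ℝ 1 (fun x => (f x).toBlocks₁₁) s := by
  rw [contDiffOn_matrix] at *
  exact fun i j => hf (Sum.inl i) (Sum.inl j)

theorem contDiffOn_toBlocks₁₂ {f : F → Matrix (m ⊕ l) (n ⊕ p) ℝ} (hf : ContDiffOn ℝ 1 f s) :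
    ContDiffOn ℝ 1 (fun x => (f x).toBlocks₁₂) s := by
  rw [contDiffOn_matrix] at *
  exact fun i j => hf (Sum.inl i) (Sum.inr j)

theorem contDiffOn_vee {f : F → Mat5} (hf : ContDiffOn ℝ 1 f s) :
    ContDiffOn ℝ 1 (fun x => vee (f x)) s :=
  (LinearMap.toContinuousLinearMap veeₗ).contDiff.comp_contDiffOn hf

theorem contDiffOn_wedge {f : F → I9 → ℝ} (hf : ContDiffOn ℝ 1 f s) :
    ContDiffOn ℝ 1 (fun x => wedge (f x)) s :=
  (LinearMap.toContinuousLinearMap wedgeₗ).contDiff.comp_contDiffOn hf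

theorem contDiffOn_drift {f : F → Mat5} (hf : ContDiffOn ℝ 1 f s) :
    ContDiffOn ℝ 1 (fun x => drift (f x)) s :=
  (LinearMap.toContinuousLinearMap driftₗ).contDiff.comp_contDiffOn hf

theorem contDiffOn_ad {f h : F → Mat5} (hf : ContDiffOn ℝ 1 f s) (hh : ContDiffOn ℝ 1 h s) :
    ContDiffOn ℝ 1 (fun x => ad (f x) (h x)) s :=
  (contDiffOn_mul_matrix hf hh).sub (contDiffOn_mul_matrix hh hf)

theorem contDiffOn_adMatrix {f : F → Mat5} (hf : ContDiffOn ℝ 1 f s) :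
    ContDiffOn ℝ 1 (fun x => adMatrix (f x)) s := by
  rw [contDiffOn_matrix]
  intro i j
  exact contDiffOn_pi.1 (contDiffOn_vee (contDiffOn_ad hf contDiffOn_const)) i

theorem contDiffOn_errField (g : Fin 3 → ℝ) (P : Matrix I18 I18 ℝ) (Q : Matrix I9 I9 ℝ)
    {Λ : (I9 → ℝ) → (I9 → ℝ)} {B : Set (I9 → ℝ)} (hΛ : ContDiffOn ℝ 1 Λ B) {Ω : Set ErrorState}
    (hΩ : ∀ y ∈ Ω, vee (errPose y) ∈ B) :
    ContDiffOn ℝ 1 (errField g P Q Λ) (univ ×ˢ Ω) := by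
  have hp1 : ContDiffOn ℝ 1 (fun q : (Mat5 × Mat5) × ErrorState => q.1.1) (univ ×ˢ Ω) :=
    (contDiff_fst.comp contDiff_fst).contDiffOn
  have hp2 : ContDiffOn ℝ 1 (fun q : (Mat5 × Mat5) × ErrorState => q.1.2) (univ ×ˢ Ω) :=
    (contDiff_snd.comp contDiff_fst).contDiffOn
  have hR : ContDiffOn ℝ 1 (fun q : (Mat5 × Mat5) × ErrorState => q.2.1) (univ ×ˢ Ω) :=
    (contDiff_fst.comp contDiff_snd).contDiffOn
  have hV : ContDiffOn ℝ 1 (fun q : (Mat5 × Mat5) × ErrorState => q.2.2.1) (univ ×ˢ Ω) :=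
    (contDiff_fst.comp (contDiff_snd.comp contDiff_snd)).contDiffOn
  have hz : ContDiffOn ℝ 1 (fun q : (Mat5 × Mat5) × ErrorState => wedge q.2.2.2.1) (univ ×ˢ Ω) :=
    contDiffOn_wedge
      (contDiff_fst.comp (contDiff_snd.comp (contDiff_snd.comp contDiff_snd))).contDiffOn
  have hM : ContDiffOn ℝ 1 (fun q : (Mat5 × Mat5) × ErrorState => q.2.2.2.2) (univ ×ˢ Ω) :=
    (contDiff_snd.comp (contDiff_snd.comp (contDiff_snd.comp contDiff_snd))).contDiffOn
  have hE : ContDiffOn ℝ 1 (fun q : (Mat5 × Mat5) × ErrorState => errPose q.2) (univ ×ˢ Ω) :=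
    contDiffOn_fromBlocks hR hV contDiffOn_const contDiffOn_const
  have hF : ContDiffOn ℝ 1 (fun q : (Mat5 × Mat5) × ErrorState => errPoseInv q.2) (univ ×ˢ Ω) :=
    contDiffOn_fromBlocks (contDiffOn_transpose hR)
      (contDiffOn_mul_matrix (contDiffOn_transpose hR) hV).neg contDiffOn_const contDiffOn_const
  have hΛE : ContDiffOn ℝ 1 (fun q : (Mat5 × Mat5) × ErrorState => Λ (vee (errPose q.2)))
      (univ ×ˢ Ω) := hΛ.comp (contDiffOn_vee hE) fun q hq => hΩ q.2 hq.2
  have hk : ContDiffOn ℝ 1 (fun q : (Mat5 × Mat5) × ErrorState =>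
      (q.2.2.2.2 * outputMatrixᵀ * Q⁻¹) *ᵥ Λ (vee (errPose q.2))) (univ ×ˢ Ω) :=
    contDiffOn_mulVec (contDiffOn_mul_matrix (contDiffOn_mul_matrix hM contDiffOn_const)
      contDiffOn_const) hΛE
  have hD1 : ContDiffOn ℝ 1 (fun q : (Mat5 × Mat5) × ErrorState => errInnovation₁ Q Λ q.2)
      (univ ×ˢ Ω) := contDiffOn_wedge (contDiffOn_pi.2 fun i => contDiffOn_pi.1 hk (Sum.inl i))
  have hD2 : ContDiffOn ℝ 1 (fun q : (Mat5 × Mat5) × ErrorState => errInnovation₂ Q Λ q.2)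
      (univ ×ˢ Ω) :=
    (contDiffOn_wedge (contDiffOn_pi.2 fun i => contDiffOn_pi.1 hk (Sum.inr i))).neg
  have hU : ContDiffOn ℝ 1 (fun q : (Mat5 × Mat5) × ErrorState => errVelocity g q.1 q.2)
      (univ ×ˢ Ω) :=
    (((contDiffOn_mul_matrix (contDiffOn_mul_matrix hF hp2) hE).add hz).add contDiffOn_const).add
      (contDiffOn_drift (contDiffOn_mul_matrix hF hp1))
  have hA : ContDiffOn ℝ 1 (fun q : (Mat5 × Mat5) × ErrorState => errStateMatrix g q.1 q.2)
      (univ ×ˢ Ω) :=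
    contDiffOn_fromBlocks contDiffOn_const contDiffOn_const contDiffOn_const
      (contDiffOn_adMatrix hU)
  have hG : ContDiffOn ℝ 1 (fun q : (Mat5 × Mat5) × ErrorState => errPoseField g Q Λ q.2)
      (univ ×ˢ Ω) :=
    ((((contDiffOn_drift hE).sub (contDiffOn_mul_matrix hE hz)).add
      (contDiffOn_mul_matrix contDiffOn_const hE)).sub
      (contDiffOn_mul_matrix hE contDiffOn_const)).sub (contDiffOn_mul_matrix hE hD1)
  have hAM := contDiffOn_mul_matrix hA hM
  exact (contDiffOn_toBlocks₁₁ hG).prodMk ((contDiffOn_toBlocks₁₂ hG).prodMk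
    ((contDiffOn_vee ((contDiffOn_ad (hU.add hD1) hz).add hD2)).prodMk
      (((hAM.add (contDiffOn_transpose hAM)).add contDiffOn_const).sub
        (contDiffOn_mul_matrix (contDiffOn_mul_matrix (contDiffOn_transpose hM) contDiffOn_const)
          hM))))

end Smoothness

/-! ### Reconstruction of the observer from the errors -/

section Components

attribute [local instance] Matrix.normedAddCommGroup Matrix.normedSpace

theorem hasDerivWithinAt_errorState {y : ℝ → ErrorState} {v : ErrorState} {J : Set ℝ} {t : ℝ}
    (h : HasDerivWithinAt y v J t) :
    HasDerivWithinAt (fun s => (y s).1) v.1 J t ∧ HasDerivWithinAt (fun s => (y s).2.1) v.2.1 J t ∧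
      HasDerivWithinAt (fun s => (y s).2.2.1) v.2.2.1 J t ∧
      HasDerivWithinAt (fun s => (y s).2.2.2) v.2.2.2 J t := by
  have h2 := hasFDerivAt_snd.comp_hasDerivWithinAt t h
  have h3 := hasFDerivAt_snd.comp_hasDerivWithinAt t h2
  have h1 := hasFDerivAt_fst.comp_hasDerivWithinAt t h
  have h4 := hasFDerivAt_fst.comp_hasDerivWithinAt t h2
  have h5 := hasFDerivAt_fst.comp_hasDerivWithinAt t h3
  have h6 := hasFDerivAt_snd.comp_hasDerivWithinAt t h3
  exact ⟨h1, h4, h5, h6⟩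

theorem hasDerivWithinAt_wedge {z : ℝ → I9 → ℝ} {z' : I9 → ℝ} {J : Set ℝ} {t : ℝ}
    (h : HasDerivWithinAt z z' J t) : HasDerivWithinAt (fun s => wedge (z s)) (wedge z') J t :=
  (LinearMap.toContinuousLinearMap wedgeₗ).hasFDerivAt.comp_hasDerivWithinAt t h

theorem hasDerivWithinAt_fromBlocks_left {l m n p : Type*} [Fintype l] [Fintype m] [Fintype n]
    [Fintype p] {a : ℝ → Matrix m n ℝ} {a' : Matrix m n ℝ} {b : ℝ → Matrix m p ℝ}
    {b' : Matrix m p ℝ} {c : Matrix l n ℝ} {d : Matrix l p ℝ} {J : Set ℝ} {t : ℝ}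
    (ha : HasDerivWithinAt a a' J t) (hb : HasDerivWithinAt b b' J t) :
    HasDerivWithinAt (fun s => fromBlocks (a s) (b s) c d) (fromBlocks a' b' 0 0) J t := by
  rw [hasDerivWithinAt_matrix] at *
  rintro (i | i) (j | j)
  · exact ha i j
  · exact hb i j
  · exact hasDerivWithinAt_const _ _ _
  · exact hasDerivWithinAt_const _ _ _

/-- A matrix function with zero derivative on an interval is constant. -/
theorem eq_of_hasDerivWithinAt_zero_matrix {m n : Type*} [Fintype m] [Fintype n]
    {f : ℝ → Matrix m n ℝ} {J : Set ℝ} (hJ : Convex ℝ J)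
    (hf : ∀ t ∈ J, HasDerivWithinAt f 0 J t) {a b : ℝ} (ha : a ∈ J) (hb : b ∈ J) : f b = f a := by
  have h := hJ.norm_image_sub_le_of_norm_hasDerivWithin_le (C := 0) (f' := fun _ => 0)
    hf (fun _ _ => by simp) ha hb
  rw [zero_mul] at h
  exact sub_eq_zero.1 (norm_le_zero_iff.1 h)

end Components

section PoseField

theorem skew_zero : skew 0 = 0 := by
  ext i j
  fin_cases i <;> fin_cases j <;> simp [skew]

/-- The bottom rows of the velocity of the pose error vanish, and its rotational block is `R` times
a skew-symmetric matrix. -/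
theorem exists_errPoseField_eq (g : Fin 3 → ℝ) (Q : Matrix I9 I9 ℝ) (Λ : (I9 → ℝ) → (I9 → ℝ))
    (y : ErrorState) : ∃ (W : Matrix (Fin 3) (Fin 3) ℝ) (V' : Matrix (Fin 3) (Fin 2) ℝ), Wᵀ = -W ∧
      errPoseField g Q Λ y = fromBlocks (y.1 * W) V' 0 0 := by
  obtain ⟨x, hx⟩ : ∃ x, errInnovation₁ Q Λ y = wedge x := ⟨_, rfl⟩
  have hw : ∀ x : I9 → ℝ, ∃ V', errPose y * wedge x = fromBlocks (y.1 * skew (rotPart x)) V' 0 0 := by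
    intro x
    rw [errPose, wedge, fromBlocks_multiply]
    simp
  have hg : gravity g = wedge (Sum.elim 0 (Sum.elim 0 g)) := rfl
  have hr : rotPart (Sum.elim 0 (Sum.elim 0 g)) = 0 := rfl
  have hg' : ∃ V', gravity g * errPose y = fromBlocks 0 V' 0 0 := by
    rw [hg, errPose, wedge, fromBlocks_multiply, hr, skew_zero]
    simp
  obtain ⟨V₁, h1⟩ := hw x
  obtain ⟨V₂, h2⟩ := hw y.2.2.1
  obtain ⟨V₃, h3⟩ := hw (Sum.elim 0 (Sum.elim 0 g))
  obtain ⟨V₄, h4⟩ := hg'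
  rw [hr, skew_zero, Matrix.mul_zero, ← hg] at h3
  refine ⟨-(skew (rotPart y.2.2.1) + skew (rotPart x)),
    (Matrix.of fun i j => if j = 0 then (errPose y) (Sum.inl i) (Sum.inr 1) else 0) - V₂ + V₄ - V₃
      - V₁, ?_, ?_⟩
  · simp only [Matrix.transpose_neg, Matrix.transpose_add, skew_transpose]
    abel
  · simp only [errPoseField]
    rw [hx, h1, h2, h3, h4, drift]
    simp only [sub_eq_add_neg, fromBlocks_neg, fromBlocks_add, neg_zero, add_zero, zero_add,
      Matrix.mul_neg, Matrix.mul_add, neg_add]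

end PoseField

section Reconstruction

attribute [local instance] Matrix.linftyOpNormedRing Matrix.linftyOpNormedAlgebra

/-- The error states with a pose error in the domain of the local logarithm. -/
def nearOrigin (r : ℝ) : Set ErrorState := {y | ‖errPose y - 1‖ < r}

/-- The parameters `(T, Ad_T (w - b))` of the error equations along a trajectory. -/
def errParam (w : ℝ → I9 → ℝ) (ξ : ℝ → Mat5 × Mat5) (t : ℝ) : Mat5 × Mat5 :=
  ((ξ t).1, (ξ t).1 * (wedge (w t) - (ξ t).2) * (ξ t).1⁻¹)

/-- The observer state with error `y` along the trajectory `ξ`. -/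
def obsState (ξ : ℝ → Mat5 × Mat5) (y : ℝ → ErrorState) (t : ℝ) : Mat5 × Mat5 :=
  ((errPose (y t))⁻¹ * (ξ t).1,
    wedge (y t).2.2.1 - Ad ((errPose (y t))⁻¹ * (ξ t).1) (ξ t).2)

variable {g : Fin 3 → ℝ} {P : Matrix I18 I18 ℝ} {Q : Matrix I9 I9 ℝ} {S₀ : Matrix I18 I18 ℝ}
  {w τ : ℝ → I9 → ℝ} {ξ : ℝ → Mat5 × Mat5} {J : Set ℝ} {r : ℝ} {Λ : (I9 → ℝ) → (I9 → ℝ)}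
  {y : ℝ → ErrorState}

theorem errVelocity_eq {T W b E : Mat5} (w : I9 → ℝ) (z : Mat5) (hE : IsUnit E.det) (hW : W = T * (wedge w - b) * T⁻¹) :
    E⁻¹ * W * E + z + gravity g + drift (E⁻¹ * T) =
      frameVelocity g w (E⁻¹ * T, z - Ad (E⁻¹ * T) b) := by
  have h1 : (E⁻¹ * T)⁻¹ = T⁻¹ * E := by
    rw [Matrix.mul_inv_rev, Matrix.nonsing_inv_nonsing_inv _ hE]
  simp only [frameVelocity, Ad, h1, hW]
  noncomm_ring

/-- A solution of the error equations keeps the rotation orthogonal and the Riccati matrix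
symmetric. -/
theorem errState_invariants (hP : Pᵀ = P) (hQ : Qᵀ = Q) {p : ℝ → Mat5 × Mat5}
    (hJ : Convex ℝ J) (h0 : (0 : ℝ) ∈ J) (hR0 : (y 0).1 * (y 0).1ᵀ = 1)
    (hM0 : ((y 0).2.2.2)ᵀ = (y 0).2.2.2)
    (hy : ∀ t ∈ J, HasDerivWithinAt y (errField g P Q Λ (p t, y t)) J t) :
    ∀ t ∈ J, (y t).1 * (y t).1ᵀ = 1 ∧ ((y t).2.2.2)ᵀ = (y t).2.2.2 := by
  intro t ht
  constructor
  · rw [← hR0]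
    refine eq_of_hasDerivWithinAt_zero_matrix (f := fun s => (y s).1 * (y s).1ᵀ) hJ
      (fun s hs => ?_) h0 ht
    obtain ⟨hR, -⟩ := hasDerivWithinAt_errorState (hy s hs)
    have h := hasDerivWithinAt_mul_matrix hR (hasDerivWithinAt_transpose hR)
    refine hasDerivWithinAt_congr_deriv_matrix h ?_
    obtain ⟨W, V', hW, hF⟩ := exists_errPoseField_eq g Q Λ (y s)
    have e : (errField g P Q Λ (p s, y s)).1 = (y s).1 * W := by
      simp only [errField]
      rw [hF, toBlocks_fromBlocks₁₁]
    rw [e, Matrix.transpose_mul, hW]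
    noncomm_ring
  · have h := eq_of_hasDerivWithinAt_zero_matrix (f := fun s => ((y s).2.2.2)ᵀ - (y s).2.2.2) hJ
      (fun s hs => ?_) h0 ht
    · simp only [hM0, sub_self] at h
      exact sub_eq_zero.1 h
    · obtain ⟨-, -, -, hM⟩ := hasDerivWithinAt_errorState (hy s hs)
      refine hasDerivWithinAt_congr_deriv_matrix
        (hasDerivWithinAt_sub_matrix (hasDerivWithinAt_transpose hM) hM) ?_
      have hQi : Q⁻¹ᵀ = Q⁻¹ := by rw [Matrix.transpose_nonsing_inv, hQ]
      simp only [errField, Matrix.transpose_sub, Matrix.transpose_add, Matrix.transpose_mul,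
        Matrix.transpose_transpose, hP, hQi, Matrix.mul_assoc]
      abel

/-- A solution of the error equations yields an observer with these errors. -/
theorem isObserver_of_errField (hΛ : IsLocalLog r Λ) (hP : P.PosDef) (hQ : Q.PosDef)
    (hS₀ : S₀.PosDef) (hξ : IsTrajectory g w τ ξ) (hJ : Convex ℝ J) (h0 : (0 : ℝ) ∈ J)
    (hJ0 : J ⊆ Ici 0) (hE0 : errPose (y 0) = (ξ 0).1) (hz0 : (y 0).2.2.1 = vee (ξ 0).2)
    (hM0 : (y 0).2.2.2 = S₀)
    (hy : ∀ t ∈ J, y t ∈ nearOrigin r ∧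
      HasDerivWithinAt y (errField g P Q Λ (errParam w ξ t, y t)) J t) :
    IsObserver g P Q S₀ w τ (fun t => output (ξ t)) J (obsState ξ y) (fun t => (y t).2.2.2) ∧
      ∀ t ∈ J, stateError (obsState ξ y t) (ξ t) = (errPose (y t), wedge (y t).2.2.1) := by
  have hPs := transpose_eq_of_isHermitian hP.isHermitian
  have hQs := transpose_eq_of_isHermitian hQ.isHermitian
  have hSs := transpose_eq_of_isHermitian hS₀.isHermitian
  have hT := fun t ht => (hξ.mem t (hJ0 ht)).1
  have hb := fun t ht => (hξ.mem t (hJ0 ht)).2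
  have hR0 : (y 0).1 * (y 0).1ᵀ = 1 := by
    obtain ⟨R, V, hRV, hR, -⟩ := exists_of_mem_SE23 (hT 0 h0)
    rw [← hE0, errPose, fromBlocks_inj] at hRV
    rw [hRV.1, hR]
  have hinv := errState_invariants hPs hQs hJ h0 hR0 (by rw [hM0, hSs]) fun t ht => (hy t ht).2
  have hspec := fun t ht => hΛ.spec (y t).1 (y t).2.1 (hinv t ht).1 (hy t ht).1
  have hE : ∀ t ∈ J, errPose (y t) ∈ SE23 := fun t ht => (hspec t ht).1
  have hEu := fun t ht => det_isUnit_of_mem_SE23 (hE t ht)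
  have hTu := fun t ht => det_isUnit_of_mem_SE23 (hT t ht)
  have hA : ∀ t ∈ J, (obsState ξ y t).1 ∈ SE23 := fun t ht =>
    mul_mem_SE23 (inv_mem_SE23 (hE t ht)) (hT t ht)
  have hTA : ∀ t ∈ J, (ξ t).1 * ((obsState ξ y t).1)⁻¹ = errPose (y t) := fun t ht => by
    rw [obsState, Matrix.mul_inv_rev, Matrix.nonsing_inv_nonsing_inv _ (hEu t ht),
      ← Matrix.mul_assoc, Matrix.mul_nonsing_inv _ (hTu t ht), Matrix.one_mul]
  have hEi : ∀ t ∈ J, errPoseInv (y t) = (errPose (y t))⁻¹ := fun t ht =>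
    (inv_fromBlocks_SE23 (y t).2.1 (hinv t ht).1).symm
  have hU : ∀ t ∈ J, errVelocity g (errParam w ξ t) (y t) = frameVelocity g (w t) (obsState ξ y t) :=
    fun t ht => by
      rw [errVelocity, hEi t ht]
      exact errVelocity_eq (w t) _ (hEu t ht) rfl
  have hinn : ∀ t ∈ J, innovation Q (obsState ξ y t) (y t).2.2.2 (output (ξ t)) =
      (errInnovation₁ Q Λ (y t), errInnovation₂ Q Λ (y t)) := fun t ht => by
    rw [innovation_eq, output, hTA t ht, errInnovation₁, errInnovation₂]
    have h : logVee (errPose (y t)) = Λ (vee (errPose (y t))) := (hspec t ht).2.2.1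
    rw [h]
  have hea : ∀ t, Ad (obsState ξ y t).1 (ξ t).2 + (obsState ξ y t).2 = wedge (y t).2.2.1 := fun t =>
    add_sub_cancel _ _
  have hgroup : ∀ t ∈ J, HasDerivWithinAt (fun s => (obsState ξ y s).1)
      ((obsState ξ y t).1 * (wedge (w t) + Ad (obsState ξ y t).1⁻¹ (obsState ξ y t).2)
        + gravity g * (obsState ξ y t).1 + drift (obsState ξ y t).1
        + errInnovation₁ Q Λ (y t) * (obsState ξ y t).1) J t := by
    intro t ht
    obtain ⟨hR, hV, -, -⟩ := hasDerivWithinAt_errorState (hy t ht).2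
    have hEd : HasDerivWithinAt (fun s => errPose (y s)) (errPoseField g Q Λ (y t)) J t := by
      have h := hasDerivWithinAt_fromBlocks_left (c := (0 : Matrix (Fin 2) (Fin 3) ℝ))
        (d := (1 : Matrix (Fin 2) (Fin 2) ℝ)) hR hV
      refine hasDerivWithinAt_congr_deriv_matrix h ?_
      obtain ⟨W, V', -, hF⟩ := exists_errPoseField_eq g Q Λ (y t)
      simp only [errField]
      rw [hF, toBlocks_fromBlocks₁₁, toBlocks_fromBlocks₁₂]
    refine hasDerivWithinAt_of_poseError (T := fun s => (ξ s).1) (A := fun s => (obsState ξ y s).1)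
      (b := fun s => (ξ s).2) (a := fun s => (obsState ξ y s).2) (E := fun s => errPose (y s))
      (t := t) (hT t ht) (hE t ht) (fun s => rfl)
      (hasDerivWithinAt_mono_matrix (hξ.pose t (hJ0 ht)) hJ0)
      (hasDerivWithinAt_congr_deriv_matrix hEd ?_)
    rw [hea]
    rfl
  have hric : ∀ t ∈ J, HasDerivWithinAt (fun t => (y t).2.2.2)
      (stateMatrix g (w t) (obsState ξ y t) * (y t).2.2.2
        + (y t).2.2.2 * (stateMatrix g (w t) (obsState ξ y t))ᵀ + P
        - (y t).2.2.2 * outputMatrixᵀ * Q⁻¹ * outputMatrix * (y t).2.2.2) J t := by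
    intro t ht
    obtain ⟨-, -, -, hM⟩ := hasDerivWithinAt_errorState (hy t ht).2
    refine hasDerivWithinAt_congr_deriv_matrix hM ?_
    have hA' : errStateMatrix g (errParam w ξ t) (y t) = stateMatrix g (w t) (obsState ξ y t) := by
      rw [errStateMatrix, stateMatrix, hU t ht,
        psi_add_gravity (det_isUnit_of_mem_SE23 (hA t ht))]
    simp only [errField]
    rw [hA', Matrix.transpose_mul, (hinv t ht).2]
    simp only [Matrix.mul_assoc]
  refine ⟨⟨?_, hM0, hA, ?_, ?_, ?_, ?_, ?_, hric⟩, fun t ht => ?_⟩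
  · rw [obsState, hE0, hz0, Matrix.nonsing_inv_mul _ (hTu 0 h0), wedge_vee (hb 0 h0), Ad, inv_one,
      Matrix.one_mul, Matrix.mul_one, sub_self]
  · exact fun t ht => sub_mem_se23 (wedge_mem _) (Ad_mem_se23 (hA t ht) (hb t ht))
  · intro t ht
    have hsub : Icc 0 t ⊆ J := hJ.ordConnected.out h0 ht
    refine posDef_of_riccati (A := fun s => stateMatrix g (w s) (obsState ξ y s))
      (B := outputMatrixᵀ * Q⁻¹ * outputMatrix) hP (by rw [hM0]; exact hS₀)
      (fun s hs => (hinv s (hsub hs)).2) (fun s hs => ?_) t (right_mem_Icc.2 (hJ0 ht))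
    refine hasDerivWithinAt_congr_deriv_matrix
      (hasDerivWithinAt_mono_matrix (hric s (hsub hs)) hsub) ?_
    simp only [Matrix.mul_assoc]
  · intro t ht
    have h : rho (sdInv (obsState ξ y t)) (output (ξ t)) = errPose (y t) := hTA t ht
    rw [h]
    exact (hspec t ht).2.1
  · intro t ht
    simp only [hinn t ht]
    exact hgroup t ht
  · intro t ht
    simp only [hinn t ht]
    obtain ⟨-, -, hz, -⟩ := hasDerivWithinAt_errorState (hy t ht).2
    refine hasDerivWithinAt_of_biasError (A := fun s => (obsState ξ y s).1)
      (b := fun s => (ξ s).2) (a := fun s => (obsState ξ y s).2)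
      (e₂ := fun s => wedge (y s).2.2.1) (t := t) (hA t ht) (fun s => rfl)
      (hasDerivWithinAt_mono_matrix (hξ.bias t (hJ0 ht)) hJ0) (hgroup t ht)
      (hasDerivWithinAt_congr_deriv_matrix (hasDerivWithinAt_wedge hz) ?_)
    simp only [errField]
    rw [hU t ht, hea, wedge_vee]
    exact add_mem_se23 (ad_mem_se23 (add_mem_se23
      (frameVelocity_mem_se23 (hA t ht) (sub_mem_se23 (wedge_mem _) (Ad_mem_se23 (hA t ht) (hb t ht)))
        g (w t)) (wedge_mem _)) (wedge_mem _)) (neg_mem_se23 (wedge_mem _))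
  · have h := stateError_eq (det_isUnit_of_mem_SE23 (hA t ht)) (obsState ξ y t).2 (ξ t).1 (ξ t).2
    rw [hTA t ht, hea] at h
    exact h

end Reconstruction

/-! ### Existence of the observer for all time -/

section Existence

attribute [local instance] Matrix.linftyOpNormedRing Matrix.linftyOpNormedAlgebra

/-- The compact set of error states that the a priori bounds confine the observer to. -/
def errBox (r σ : ℝ) : Set ErrorState :=
  {y | ‖errPose y - 1‖ ≤ r / 4 ∧ ‖y.2.2.1‖ ≤ 1 ∧ ∀ i j, y.2.2.2 i j ∈ Icc (-σ) σ}

theorem continuous_errPose : Continuous errPose :=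
  Continuous.matrix_fromBlocks continuous_fst (continuous_fst.comp continuous_snd)
    continuous_const continuous_const

theorem isOpen_nearOrigin (r : ℝ) : IsOpen (nearOrigin r) :=
  isOpen_lt (continuous_errPose.sub continuous_const).norm continuous_const

theorem errBox_subset {r : ℝ} (hr : 0 < r) (σ : ℝ) : errBox r σ ⊆ nearOrigin r := fun y hy =>
  lt_of_le_of_lt hy.1 (by linarith)

theorem vee_errPose_mem {r : ℝ} {y : ErrorState} (hy : y ∈ nearOrigin r) :
    vee (errPose y) ∈ Metric.ball 0 r := by
  rw [mem_ball_zero_iff]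
  have h := norm_vee_le (errPose y - 1)
  rw [vee_sub, vee_one, sub_zero] at h
  exact h.trans_lt hy

theorem isCompact_matrix_box (m n : Type*) (a : ℝ) :
    IsCompact {M : Matrix m n ℝ | ∀ i j, M i j ∈ Icc (-a) a} := by
  have h : IsCompact (Set.pi univ fun _ : m => Set.pi univ fun _ : n => Icc (-a) a) :=
    isCompact_univ_pi fun _ => isCompact_univ_pi fun _ => isCompact_Icc
  have e : {M : Matrix m n ℝ | ∀ i j, M i j ∈ Icc (-a) a} =
      (Set.pi univ fun _ : m => Set.pi univ fun _ : n => Icc (-a) a) := by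
    ext M
    exact ⟨fun h i _ j _ => h i j, fun h i j => h i trivial j trivial⟩
  rw [e]
  exact h

theorem isCompact_errBox {r : ℝ} (hr1 : r ≤ 1) (σ : ℝ) : IsCompact (errBox r σ) := by
  have hbox := (isCompact_matrix_box (Fin 3) (Fin 3) 2).prod
    ((isCompact_matrix_box (Fin 3) (Fin 2) 2).prod
      ((isCompact_closedBall (0 : I9 → ℝ) 1).prod (isCompact_matrix_box I18 I18 σ)))
  refine hbox.of_isClosed_subset ?_ ?_
  · refine IsClosed.inter (isClosed_le (continuous_errPose.sub continuous_const).norm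
      continuous_const) (IsClosed.inter (isClosed_le
      (continuous_fst.comp (continuous_snd.comp continuous_snd)).norm continuous_const) ?_)
    have h : {y : ErrorState | ∀ i j, y.2.2.2 i j ∈ Icc (-σ) σ} =
        ⋂ i, ⋂ j, {y : ErrorState | y.2.2.2 i j ∈ Icc (-σ) σ} := by
      ext y; simp
    change IsClosed {y : ErrorState | ∀ i j, y.2.2.2 i j ∈ Icc (-σ) σ}
    rw [h]
    refine isClosed_iInter fun i => isClosed_iInter fun j => isClosed_Icc.preimage ?_
    exact (continuous_apply_apply i j).comp
      (continuous_snd.comp (continuous_snd.comp continuous_snd))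
  · rintro y ⟨h1, h2, h3⟩
    have hent : ∀ i j, |errPose y i j| ≤ 2 := by
      intro i j
      have e1 := (abs_entry_le_norm (errPose y - 1) i j).trans h1
      rw [Matrix.sub_apply] at e1
      have e2 : |(1 : Mat5) i j| ≤ 1 := by
        rw [Matrix.one_apply]; split_ifs <;> simp
      have e3 := abs_sub_abs_le_abs_sub (errPose y i j) ((1 : Mat5) i j)
      linarith
    refine ⟨fun i j => abs_le.1 (hent (Sum.inl i) (Sum.inl j)),
      fun i j => abs_le.1 (hent (Sum.inl i) (Sum.inr j)), mem_closedBall_zero_iff.2 h2, h3⟩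

theorem abs_entry_le_of_posSemidef {n : Type*} [Fintype n] [DecidableEq n] {M : Matrix n n ℝ}
    (hM : M.PosSemidef) {σ : ℝ} (hσ : ∀ u, u ⬝ᵥ (M *ᵥ u) ≤ σ * (u ⬝ᵥ u)) (hσ0 : 0 ≤ σ) (i j : n) :
    |M i j| ≤ σ := by
  have h := posSemidef_cauchySchwarz hM (Pi.single i 1) (Pi.single j 1)
  have h0 : ∀ k : n, 0 ≤ M k k := fun k => hM.diag_nonneg
  have h1 : ∀ k : n, M k k ≤ σ := fun k => by simpa using hσ (Pi.single k 1)
  have h2 : (M i j) ^ 2 ≤ M i i * M j j := by simpa using h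
  have h3 : M i i * M j j ≤ σ * σ := mul_le_mul (h1 i) (h1 j) (h0 j) hσ0
  exact abs_le_of_sq_le_sq (by nlinarith) hσ0

variable {g : Fin 3 → ℝ} {P : Matrix I18 I18 ℝ} {Q : Matrix I9 I9 ℝ} {S₀ : Matrix I18 I18 ℝ}
  {w τ : ℝ → I9 → ℝ} {ξ : ℝ → Mat5 × Mat5} {r σ : ℝ} {Λ : (I9 → ℝ) → (I9 → ℝ)}

theorem continuousOn_errParam (hw : ContinuousOn w (Ici 0)) (hξ : IsTrajectory g w τ ξ) :
    ContinuousOn (errParam w ξ) (Ici 0) := by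
  have hT : ContinuousOn (fun t => (ξ t).1) (Ici 0) := continuousOn_of_hasDerivWithinAt_matrix hξ.pose
  have hb : ContinuousOn (fun t => (ξ t).2) (Ici 0) := continuousOn_of_hasDerivWithinAt_matrix hξ.bias
  have hTi : ContinuousOn (fun t => (ξ t).1⁻¹) (Ici 0) :=
    continuousOn_of_hasDerivWithinAt_matrix fun t ht =>
      hasDerivWithinAt_inv_matrix (hξ.pose t ht) ((Matrix.isUnit_iff_isUnit_det _).2
        (det_isUnit_of_mem_SE23 (hξ.mem t ht).1))
  have hwedge : Continuous wedge := (LinearMap.toContinuousLinearMap wedgeₗ).continuous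
  exact hT.prodMk ((hT.mul ((hwedge.comp_continuousOn hw).sub hb)).mul hTi)

/-- The a priori bounds, in terms of the error equations. -/
theorem mem_errBox_of_apriori (hΛ : IsLocalLog r Λ) (hP : P.PosDef) (hQ : Q.PosDef)
    (hS₀ : S₀.PosDef) (hσ : 0 < σ) (hξ : IsTrajectory g w τ ξ)
    (hap : ∀ (t₁ : ℝ) (X : ℝ → Mat5 × Mat5) (S : ℝ → Matrix I18 I18 ℝ),
      IsObserver g P Q S₀ w τ (fun t => output (ξ t)) (Icc 0 t₁) X S → ∀ t ∈ Icc 0 t₁,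
        ‖(stateError (X t) (ξ t)).1 - 1‖ ≤ r / 4 ∧ ‖linCoord (stateError (X t) (ξ t))‖ ≤ 1 / 640 ∧
        ∀ u, u ⬝ᵥ (S t *ᵥ u) ≤ σ * (u ⬝ᵥ u))
    {t₁ : ℝ} {y : ℝ → ErrorState} (hE0 : errPose (y 0) = (ξ 0).1) (hz0 : (y 0).2.2.1 = vee (ξ 0).2)
    (hM0 : (y 0).2.2.2 = S₀)
    (hy : ∀ t ∈ Icc 0 t₁, y t ∈ nearOrigin r ∧
      HasDerivWithinAt y (errField g P Q Λ (errParam w ξ t, y t)) (Icc 0 t₁) t) :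
    ∀ t ∈ Icc 0 t₁, y t ∈ errBox r σ := by
  intro t ht
  obtain ⟨hX, he⟩ := isObserver_of_errField hΛ hP hQ hS₀ hξ (convex_Icc 0 t₁)
    (left_mem_Icc.2 (ht.1.trans ht.2)) Icc_subset_Ici_self hE0 hz0 hM0 hy
  obtain ⟨h1, h2, h3⟩ := hap t₁ _ _ hX t ht
  rw [he t ht] at h1 h2
  have h4 : ‖(y t).2.2.1‖ ≤ 1 / 640 := by
    have h := (norm_vee_snd_le (errPose (y t), wedge (y t).2.2.1)).trans h2
    rwa [vee_wedge] at h
  exact ⟨h1, h4.trans (by norm_num), fun i j =>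
    abs_le.1 (abs_entry_le_of_posSemidef (hX.posDef t ht).posSemidef h3 hσ.le i j)⟩

end Existence

section GlobalExistence

attribute [local instance] Matrix.normedAddCommGroup Matrix.normedSpace

variable {g : Fin 3 → ℝ} {P : Matrix I18 I18 ℝ} {Q : Matrix I9 I9 ℝ} {S₀ : Matrix I18 I18 ℝ}
  {w τ : ℝ → I9 → ℝ} {ξ : ℝ → Mat5 × Mat5} {r σ : ℝ} {Λ : (I9 → ℝ) → (I9 → ℝ)}

/-- The error equations have a global solution if every solution stays in a compact box. -/
theorem exists_solution_errField (hΛ : IsLocalLog r Λ) (hw : ContinuousOn w (Ici 0))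
    (hξ : IsTrajectory g w τ ξ) {y₀ : ErrorState} (hy₀ : y₀ ∈ nearOrigin r)
    (hap : ∀ (t₁ : ℝ) (y : ℝ → ErrorState), y 0 = y₀ → (∀ t ∈ Icc 0 t₁, y t ∈ nearOrigin r ∧
      HasDerivWithinAt y (errField g P Q Λ (errParam w ξ t, y t)) (Icc 0 t₁) t) →
      ∀ t ∈ Icc 0 t₁, y t ∈ errBox r σ) :
    ∃ y : ℝ → ErrorState, y 0 = y₀ ∧ ∀ t ∈ Ici 0, y t ∈ nearOrigin r ∧
      HasDerivWithinAt y (errField g P Q Λ (errParam w ξ t, y t)) (Ici 0) t := by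
  have hbox : y₀ ∈ errBox r σ := by
    refine hap 0 (fun _ => y₀) rfl (fun t ht => ⟨hy₀, ?_⟩) 0 (left_mem_Icc.2 le_rfl)
    rw [Icc_self]
    exact HasFDerivWithinAt.of_subsingleton subsingleton_singleton
  exact exists_global_solution (isOpen_nearOrigin r)
    (contDiffOn_errField g P Q hΛ.contDiffOn fun y hy => vee_errPose_mem hy)
    (isCompact_errBox hΛ.le_one σ) (errBox_subset hΛ.pos σ) (continuousOn_errParam hw hξ) hbox hap

end GlobalExistence

/-! ### Convergence of the error -/

section Conclusion

attribute [local instance] Matrix.linftyOpNormedRing Matrix.linftyOpNormedAlgebra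

variable {g : Fin 3 → ℝ} {P : Matrix I18 I18 ℝ} {Q : Matrix I9 I9 ℝ} {S₀ : Matrix I18 I18 ℝ}
  {w τ : ℝ → I9 → ℝ} {ξ : ℝ → Mat5 × Mat5} {r σ : ℝ} {Λ : (I9 → ℝ) → (I9 → ℝ)}

/-- The a priori bounds imply that the observer exists for all time. -/
theorem exists_isObserver (hΛ : IsLocalLog r Λ) (hP : P.PosDef) (hQ : Q.PosDef)
    (hS₀ : S₀.PosDef) (hσ : 0 < σ) (hw : ContinuousOn w (Ici 0)) (hξ : IsTrajectory g w τ ξ)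
    (h0 : ‖(stateError (1, 0) (ξ 0)).1 - 1‖ < r)
    (hap : ∀ (t₁ : ℝ) (X : ℝ → Mat5 × Mat5) (S : ℝ → Matrix I18 I18 ℝ),
      IsObserver g P Q S₀ w τ (fun t => output (ξ t)) (Icc 0 t₁) X S → ∀ t ∈ Icc 0 t₁,
        ‖(stateError (X t) (ξ t)).1 - 1‖ ≤ r / 4 ∧ ‖linCoord (stateError (X t) (ξ t))‖ ≤ 1 / 640 ∧
        ∀ u, u ⬝ᵥ (S t *ᵥ u) ≤ σ * (u ⬝ᵥ u)) :
    ∃ X S, IsObserver g P Q S₀ w τ (fun t => output (ξ t)) (Ici 0) X S := by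
  obtain ⟨R, V, hRV, -⟩ := exists_of_mem_SE23 (hξ.mem 0 self_mem_Ici).1
  have he := stateError_eq (A := 1) (by simp) 0 (ξ 0).1 (ξ 0).2
  have he1 : (stateError (1, 0) (ξ 0)).1 = (ξ 0).1 := by
    have h := congrArg Prod.fst he
    simpa using h
  rw [he1] at h0
  obtain ⟨y, hy0, hy⟩ := exists_solution_errField (P := P) (Q := Q) (σ := σ) hΛ hw hξ
    (y₀ := (R, V, vee (ξ 0).2, S₀)) (show ‖fromBlocks R V 0 1 - 1‖ < r by rw [← hRV]; exact h0)
    (fun t₁ y hy0 hy => mem_errBox_of_apriori hΛ hP hQ hS₀ hσ hξ hap (by rw [hy0, hRV]; rfl)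
      (by rw [hy0]) (by rw [hy0]) hy)
  exact ⟨_, _, (isObserver_of_errField hΛ hP hQ hS₀ hξ (convex_Ici 0) self_mem_Ici Subset.rfl
    (by rw [hy0, hRV]; rfl) (by rw [hy0]) (by rw [hy0]) hy).1⟩

/-- The neighbourhood of the origin in which the errors have size less than `δ`. -/
def errBall (δ : ℝ) : Set (Mat5 × Mat5) := {e | ‖e.1 - 1‖ < δ ∧ ‖vee e.2‖ < δ}

theorem errBall_mem_nhds {δ : ℝ} (hδ : 0 < δ) : errBall δ ∈ 𝓝 origin := by
  have hv : Continuous vee := (LinearMap.toContinuousLinearMap veeₗ).continuous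
  have ho : IsOpen (errBall δ) :=
    (isOpen_lt (continuous_fst.sub continuous_const).norm continuous_const).inter
      (isOpen_lt (hv.comp continuous_snd).norm continuous_const)
  refine ho.mem_nhds ⟨?_, ?_⟩
  · simpa [origin] using hδ
  · have h : vee (0 : Mat5) = 0 := veeₗ.map_zero
    simpa [origin, h] using hδ

/-- Near the origin the logarithmic coordinates and the linear coordinates have comparable size. -/
theorem norm_eps_comparison (hΛ : IsLocalLog r Λ) {e : Mat5 × Mat5} (he : e.1 ∈ SE23)
    (hr : ‖e.1 - 1‖ < r) (hz : ‖linCoord e‖ ≤ 1 / 640) :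
    ‖eps e‖ ≤ 3 / 2 * ‖linCoord e‖ ∧ ‖linCoord e‖ ≤ 2 * ‖eps e‖ := by
  have hb := (hΛ.bounds he hr).1
  have hv := (norm_vee_fst_le e).trans hz
  have hd : ‖logVee e.1 - vee e.1‖ ≤ 1 / 2 * ‖vee e.1‖ := by
    nlinarith [norm_nonneg (vee e.1)]
  have h1 : ‖logVee e.1‖ ≤ ‖vee e.1‖ + ‖logVee e.1 - vee e.1‖ := norm_le_norm_add_norm_sub' _ _
  have h2 : ‖vee e.1‖ ≤ ‖logVee e.1‖ + ‖logVee e.1 - vee e.1‖ := norm_le_norm_add_norm_sub _ _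
  have h3 : ‖logVee e.1‖ ≤ ‖eps e‖ := norm_restrict_inl_le (eps e)
  have h4 : ‖vee e.2‖ ≤ ‖eps e‖ := norm_restrict_inr_le (eps e)
  have h5 := norm_vee_fst_le e
  have h6 := norm_vee_snd_le e
  constructor
  · refine (pi_norm_le_iff_of_nonneg (by positivity)).2 ?_
    rintro (i | i)
    · exact (norm_le_pi_norm (logVee e.1) i).trans (by linarith)
    · exact (norm_le_pi_norm (vee e.2) i).trans (by linarith [norm_nonneg (vee e.2)])
  · refine (pi_norm_le_iff_of_nonneg (by positivity)).2 ?_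
    rintro (i | i)
    · exact (norm_le_pi_norm (vee e.1) i).trans (by linarith)
    · exact (norm_le_pi_norm (vee e.2) i).trans (by linarith [norm_nonneg (vee e.2)])

/-- Exponential decay in linear coordinates gives exponential decay in logarithmic coordinates. -/
theorem euclNorm_eps_le {e e₀ : Mat5 × Mat5} {C c t : ℝ} (hC : 0 ≤ C)
    (h : ‖eps e‖ ≤ 3 / 2 * ‖linCoord e‖) (h₀ : ‖linCoord e₀‖ ≤ 2 * ‖eps e₀‖)
    (hdecay : linCoord e ⬝ᵥ linCoord e ≤ C * Real.exp (-c * t) * (linCoord e₀ ⬝ᵥ linCoord e₀)) :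
    euclNorm (eps e) ≤ 54 * Real.sqrt C * Real.exp (-(c / 2) * t) * euclNorm (eps e₀) := by
  have h18 : (Fintype.card I18 : ℝ) = 18 := by norm_num [I18, I9]
  have hexp : Real.exp (-c * t) = Real.exp (-(c / 2) * t) ^ 2 := by
    rw [← Real.exp_nat_mul]
    congr 1
    push_cast
    ring
  have e1 := dotProduct_self_le_norm_sq (eps e)
  have e2 := norm_sq_le_dotProduct_self (linCoord e)
  have e3 := dotProduct_self_le_norm_sq (linCoord e₀)
  have e4 := norm_sq_le_dotProduct_self (eps e₀)
  rw [h18] at e1 e3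
  have e5 : ‖eps e‖ ^ 2 ≤ (3 / 2 * ‖linCoord e‖) ^ 2 := pow_le_pow_left₀ (norm_nonneg _) h 2
  have e6 : ‖linCoord e₀‖ ^ 2 ≤ (2 * ‖eps e₀‖) ^ 2 := pow_le_pow_left₀ (norm_nonneg _) h₀ 2
  have hp : 0 ≤ C * Real.exp (-c * t) := by positivity
  have e7 : linCoord e₀ ⬝ᵥ linCoord e₀ ≤ 72 * (eps e₀ ⬝ᵥ eps e₀) := by nlinarith
  have e8 := mul_le_mul_of_nonneg_left e7 hp
  have e9 : eps e ⬝ᵥ eps e ≤ 2916 * (C * Real.exp (-c * t) * (eps e₀ ⬝ᵥ eps e₀)) := by nlinarith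
  rw [← sq_le_sq₀ (euclNorm_nonneg _) (by have := euclNorm_nonneg (eps e₀); positivity),
    mul_pow, mul_pow, mul_pow, Real.sq_sqrt hC, ← hexp, euclNorm_sq, euclNorm_sq]
  linarith

/-- Convergence of the linear coordinates implies convergence of the error, since near the identity
the pose error is controlled by the entries that the vee map reads. -/
theorem tendsto_origin {e : ℝ → Mat5 × Mat5} {C c B : ℝ} (hΛ : IsLocalLog r Λ) (hc : 0 < c)
    (he1 : ∀ t ∈ Ici (0 : ℝ), (e t).1 ∈ SE23 ∧ ‖(e t).1 - 1‖ < r)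
    (he2 : ∀ t ∈ Ici (0 : ℝ), (e t).2 ∈ se23)
    (hz : ∀ t ∈ Ici (0 : ℝ), ‖linCoord (e t)‖ ≤ 1 / 640)
    (hdecay : ∀ t ∈ Ici (0 : ℝ), linCoord (e t) ⬝ᵥ linCoord (e t) ≤ C * Real.exp (-c * t) * B) :
    Tendsto e atTop (𝓝 origin) := by
  have hexp : Tendsto (fun t : ℝ => Real.exp (-c * t)) atTop (𝓝 0) :=
    Real.tendsto_exp_atBot.comp (tendsto_id.const_mul_atTop_of_neg (neg_lt_zero.2 hc))
  have hsq : Tendsto (fun t => ‖linCoord (e t)‖ ^ 2) atTop (𝓝 0) := by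
    have h := (hexp.const_mul C).mul_const B
    rw [mul_zero, zero_mul] at h
    refine squeeze_zero' (Eventually.of_forall fun t => by positivity) ?_ h
    filter_upwards [eventually_ge_atTop (0 : ℝ)] with t ht
    exact (norm_sq_le_dotProduct_self _).trans (hdecay t ht)
  have hn : Tendsto (fun t => ‖linCoord (e t)‖) atTop (𝓝 0) := by
    have h := hsq.sqrt
    simpa [Real.sqrt_sq] using h
  have h1 : Tendsto (fun t => (e t).1) atTop (𝓝 1) := by
    refine tendsto_iff_norm_sub_tendsto_zero.2 ?_
    refine squeeze_zero' (Eventually.of_forall fun t => norm_nonneg _) ?_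
      (by simpa using hn.const_mul 324)
    filter_upwards [eventually_ge_atTop (0 : ℝ)] with t ht
    have hb := (hΛ.bounds (he1 t ht).1 (he1 t ht).2).2
    have hv := norm_vee_fst_le (e t)
    have hw := norm_wedge_le (vee (e t).1)
    have htri : ‖(e t).1 - 1‖ ≤ ‖(e t).1 - 1 - wedge (vee (e t).1)‖ + ‖wedge (vee (e t).1)‖ := by
      have := norm_add_le ((e t).1 - 1 - wedge (vee (e t).1)) (wedge (vee (e t).1))
      rwa [sub_add_cancel] at this
    have := hz t ht
    nlinarith [norm_nonneg (vee (e t).1)]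
  have h2 : Tendsto (fun t => (e t).2) atTop (𝓝 0) := by
    refine tendsto_zero_iff_norm_tendsto_zero.2 ?_
    refine squeeze_zero' (Eventually.of_forall fun t => norm_nonneg _) ?_
      (by simpa using hn.const_mul 4)
    filter_upwards [eventually_ge_atTop (0 : ℝ)] with t ht
    have hw := norm_wedge_le (vee (e t).2)
    rw [wedge_vee (he2 t ht)] at hw
    linarith [norm_vee_snd_le (e t)]
  exact h1.prodMk_nhds h2

end Conclusion

end BINS

end

theorem mainTheorem3 (g : Fin 3 → ℝ)
    (P : Matrix BINS.I18 BINS.I18 ℝ) (hP : P.PosDef)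
    (Q : Matrix BINS.I9 BINS.I9 ℝ) (hQ : Q.PosDef)
    (S₀ : Matrix BINS.I18 BINS.I18 ℝ) (hS₀ : S₀.PosDef)
    (T α β : ℝ) (hT : 0 < T) (hα : 0 < α) :
    ∃ U ∈ 𝓝[BINS.stateSpace] BINS.origin, ∃ k > 0, ∃ c > 0,
      ∀ (w τ : ℝ → BINS.I9 → ℝ), ContinuousOn w (Ici 0) → ContinuousOn τ (Ici 0) →
      ∀ ξ : ℝ → BINS.Mat5 × BINS.Mat5, BINS.IsTrajectory g w τ ξ →
        BINS.stateError (1, 0) (ξ 0) ∈ U →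
        BINS.ObservableAlong g P Q S₀ w τ (fun t => BINS.output (ξ t)) T α β →
        (∃ X S, BINS.IsObserver g P Q S₀ w τ (fun t => BINS.output (ξ t)) (Ici 0) X S) ∧
        ∀ X S, BINS.IsObserver g P Q S₀ w τ (fun t => BINS.output (ξ t)) (Ici 0) X S →
          (∀ t ∈ Ici (0 : ℝ),
            BINS.euclNorm (BINS.eps (BINS.stateError (X t) (ξ t))) ≤
              k * Real.exp (-c * t) * BINS.euclNorm (BINS.eps (BINS.stateError (X 0) (ξ 0)))) ∧
          Tendsto (fun t => BINS.stateError (X t) (ξ t)) atTop (𝓝 BINS.origin) := by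
  obtain ⟨r, Λ, hΛ⟩ := BINS.exists_isLocalLog
  have hr := hΛ.pos
  obtain ⟨δ, hδ, hδr, C, hC, c, hc, σ, hσ, hap⟩ :=
    BINS.exists_apriori_decay g hP hQ S₀ β hT hα hΛ
  refine ⟨BINS.errBall δ, mem_nhdsWithin_of_mem_nhds (BINS.errBall_mem_nhds hδ),
    54 * Real.sqrt C, by positivity, c / 2, by positivity, ?_⟩
  intro w τ hw _ ξ hξ hU hobs
  have hap' := hap w τ ξ hξ hU.1 hU.2 hobs
  refine ⟨BINS.exists_isObserver hΛ hP hQ hS₀ hσ hw hξ (hU.1.trans_le hδr)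
    fun t₁ X S hX t ht => ?_, fun X S hX => ?_⟩
  · obtain ⟨h1, h2, -, h3⟩ := hap' t₁ X S hX t ht
    exact ⟨h1, h2, h3⟩
  · have hbd := fun t (ht : t ∈ Ici (0 : ℝ)) =>
      hap' t X S (hX.mono Icc_subset_Ici_self) t (right_mem_Icc.2 ht)
    have hmem := fun t (ht : t ∈ Ici (0 : ℝ)) => BINS.stateError_fst_mem hξ hX Subset.rfl ht
    have hlt := fun t (ht : t ∈ Ici (0 : ℝ)) =>
      (hbd t ht).1.trans_lt (show r / 4 < r by linarith)
    have hcmp := fun t (ht : t ∈ Ici (0 : ℝ)) =>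
      BINS.norm_eps_comparison hΛ (hmem t ht) (hlt t ht) (hbd t ht).2.1
    refine ⟨fun t ht => BINS.euclNorm_eps_le hC.le (hcmp t ht).1 (hcmp 0 self_mem_Ici).2
      (hbd t ht).2.2.1, ?_⟩
    exact BINS.tendsto_origin hΛ hc (fun t ht => ⟨hmem t ht, hlt t ht⟩)
      (fun t ht => BINS.stateError_snd_mem hξ hX Subset.rfl ht) (fun t ht => (hbd t ht).2.1)
      (fun t ht => (hbd t ht).2.2.1)
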